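/- For $c\in\mathbb R$ let $M^{n+k}(c)$ denote the complete simply connected Riemannian manifold of dimension $n+k$ and constant sectional curvature $c$, i.e. the round sphere of radius $1/\sqrt c$ if $c>0$, Euclidean space if $c=0$, and hyperbolic space of curvature $c$ if $c<0$. For an isometric immersion $f:M^n\to M^{n+k}(c)$ with second fundamental form $\alpha$, a point $x\in M^n$ and a normal vector $\eta$ of $f$ at $x$, put $$E_\eta=\{X\in T_xM^n:\ \alpha(x)(X,Y)=\langle X,Y\rangle\,\eta\ \text{ for all } Y\in T_xM^n\}.$$ If $f$ has flat normal bundle, then at each $x$ there are unique pairwise distinct normal vectors $\eta_1(x),\dots,\eta_{s(x)}(x)$ (the principal normal vectors) with $E_{\eta_i(x)}\neq 0$ such that $T_xM^n$ is the orthogonal direct sum of the $E_{\eta_i(x)}$. The immersion $f$ is called proper if $s(x)$ does not depend on $x$, and $f$ has type $(l_1,\dots,l_s)$ if at every point $x$ there are $s$ principal normal vectors and, suitably numbered, they satisfy $\dim E_{\eta_i(x)}=l_i$ for $1\le i\le s$. Theorem. Let $M^n$, $n\ge 3$, be a connected, complete $C^\infty$ Riemannian manifold of constant scalar curvature $R$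 (the trace of the Ricci tensor), and let $f:M^n\to M^{n+k}(c)$ be a $C^\infty$ isometric immersion with flat normal bundle which is proper and has type $(1,n-1)$. Then: (i) if $c=0$, then $R\ge 0$, and $R>0$ if $M^n$ is compact; (ii) if $c>0$, then $R>(n-1)(n-2)c$; (iii) if $c<0$, then $R\ge n(n-1)c$, and $R>n(n-1)c$ if $M^n$ is compact. -/

import Mathlib

open Bundle
open scoped Manifold ContDiff Matrix

noncomputable section

/-! ### Scalar curvature of a Riemannian metric -/

/-- The model space `ℝⁿ` of coordinates. -/
abbrev Coord (n : ℕ) : Type := EuclideanSpace ℝ (Fin n)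

/-- The partial derivative `∂ᵢ h` at `u` of a function of the coordinates. -/
def partialD {n : ℕ} {W : Type*} [NormedAddCommGroup W] [NormedSpace ℝ W]
    (i : Fin n) (h : Coord n → W) (u : Coord n) : W :=
  fderiv ℝ h u (EuclideanSpace.single i 1)

/-- The Christoffel symbol `Γᵏᵢⱼ` at `u` of the metric with matrix `G = (gᵢⱼ)`. -/
def christoffel {n : ℕ} (G : Coord n → Matrix (Fin n) (Fin n) ℝ)
    (k i j : Fin n) (u : Coord n) : ℝ :=
  (1 / 2) * ∑ l, (G u)⁻¹ k l *
    (partialD i (fun p => G p j l) u + partialD j (fun p => G p i l) u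
      - partialD l (fun p => G p i j) u)

/-- The `l`-th component of `R(∂ᵢ, ∂ⱼ)∂ₖ`, where `R(X,Y)Z = ∇_X∇_Y Z - ∇_Y∇_X Z - ∇_[X,Y] Z`. -/
def riemannCoeff {n : ℕ} (G : Coord n → Matrix (Fin n) (Fin n) ℝ)
    (l k i j : Fin n) (u : Coord n) : ℝ :=
  partialD i (christoffel G l j k) u - partialD j (christoffel G l i k) u
    + ∑ p, (christoffel G l i p u * christoffel G p j k u
        - christoffel G l j p u * christoffel G p i k u)

/-- `Ric(∂ⱼ, ∂ₖ) = tr (X ↦ R(X, ∂ⱼ)∂ₖ)`. -/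
def ricciCoeff {n : ℕ} (G : Coord n → Matrix (Fin n) (Fin n) ℝ)
    (j k : Fin n) (u : Coord n) : ℝ :=
  ∑ i, riemannCoeff G i k i j u

/-- The trace of the Ricci tensor with respect to the metric `G`. -/
def scalarCoord {n : ℕ} (G : Coord n → Matrix (Fin n) (Fin n) ℝ) (u : Coord n) : ℝ :=
  ∑ j, ∑ k, (G u)⁻¹ j k * ricciCoeff G j k u

section Intrinsic

variable {n : ℕ} {M : Type*} [TopologicalSpace M] [ChartedSpace (Coord n) M]

/-- The matrix `gᵢⱼ = ⟨∂ᵢ, ∂ⱼ⟩` of the Riemannian metric of `M` in the preferred chart at `x`. -/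
def metricInChart [RiemannianBundle (fun y : M => TangentSpace (𝓡 n) y)]
    (x : M) (u : Coord n) : Matrix (Fin n) (Fin n) ℝ :=
  fun i j =>
    let d : Coord n →L[ℝ] TangentSpace (𝓡 n) ((extChartAt (𝓡 n) x).symm u) :=
      mfderiv 𝓘(ℝ, Coord n) (𝓡 n) (extChartAt (𝓡 n) x).symm u
    inner ℝ (d (EuclideanSpace.single i 1)) (d (EuclideanSpace.single j 1))

/-- The scalar curvature at `x`: the trace of the Ricci tensor, i.e. the sum of the sectional
curvatures `K(eᵢ, eⱼ)` over all ordered pairs `i ≠ j` from an orthonormal basis of `T_xM`. -/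
def scalarCurvature [RiemannianBundle (fun y : M => TangentSpace (𝓡 n) y)] (x : M) : ℝ :=
  scalarCoord (metricInChart x) (extChartAt (𝓡 n) x x)

end Intrinsic

/-! ### Space forms

The complete simply connected `m`-dimensional Riemannian manifold of constant sectional
curvature `c`, realised in `ℝ^(m+1)` as the round sphere of radius `1/√c` (`c > 0`), as the
Euclidean space `{p₀ = 0}` (`c = 0`), or as the upper sheet of the hyperboloid `⟨p, p⟩ = 1/c` in
Lorentz space (`c < 0`). -/

/-- The vector space `ℝ^(m+1)` containing the `m`-dimensional space form. -/
abbrev Ambient (m : ℕ) : Type := Fin (m + 1) → ℝ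

/-- The Euclidean (`c ≥ 0`) or Lorentzian (`c < 0`) scalar product of `ℝ^(m+1)`; the metric of
the space form is its restriction to tangent vectors. -/
def form (c : ℝ) {m : ℕ} (p q : Ambient m) : ℝ :=
  (if c < 0 then -1 else 1) * (p 0 * q 0) + ∑ i : Fin m, p i.succ * q i.succ

/-- The space form of dimension `m` and curvature `c`. -/
def SpaceForm (c : ℝ) (m : ℕ) : Set (Ambient m) :=
  {p | if c = 0 then p 0 = 0 else form c p p = 1 / c ∧ (c < 0 → 0 < p 0)}

/-- `v` is tangent to the space form of curvature `c` at the point `p`. -/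
def IsTangent (c : ℝ) {m : ℕ} (p v : Ambient m) : Prop :=
  if c = 0 then v 0 = 0 else form c p v = 0

/-! ### Immersions into space forms, in coordinates

`F` is an immersion of an open subset of `ℝⁿ` into the space form of curvature `c`. -/

section Local

variable {n m : ℕ}

/-- The induced metric `⟨∂ᵢF, ∂ⱼF⟩`. -/
def gram (c : ℝ) (F : Coord n → Ambient m) (u : Coord n) : Matrix (Fin n) (Fin n) ℝ :=
  fun i j => form c (partialD i F u) (partialD j F u)

/-- The component of `w` normal to the immersion and tangent to the space form: the part of `w`
in the span of the `∂ₗF` and the part in the direction `F`, which is normal to the space form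
when `c ≠ 0` (where `⟨F, F⟩ = 1/c`), are removed. When `c = 0`, the vectors `w` to which it is
applied below are derivatives of maps into `{p₀ = 0}`, so no further component has to be removed. -/
def normalPart (c : ℝ) (F : Coord n → Ambient m) (u : Coord n) (w : Ambient m) : Ambient m :=
  w - (∑ k, ∑ l, ((gram c F u)⁻¹ k l * form c w (partialD k F u)) • partialD l F u)
    - (c * form c w (F u)) • F u

/-- The second fundamental form `α(v, w)`: the normal part of the derivative in the direction `v`
of the vector field `dF(w)`. -/
def secondFF (c : ℝ) (F : Coord n → Ambient m) (u v w : Coord n) : Ambient m :=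
  normalPart c F u (fderiv ℝ (fun p => fderiv ℝ F p w) u v)

/-- The normal connection: the normal part of the derivative of the normal field `ξ`. -/
def normalD (c : ℝ) (F : Coord n → Ambient m) (v : Coord n) (ξ : Coord n → Ambient m)
    (u : Coord n) : Ambient m :=
  normalPart c F u (fderiv ℝ ξ u v)

/-- The curvature `R^⊥(v, w)ξ` of the normal connection; `v` and `w` are constant vector fields in
the coordinates, so that their bracket vanishes. -/
def normalCurvature (c : ℝ) (F : Coord n → Ambient m) (v w : Coord n) (ξ : Coord n → Ambient m)
    (u : Coord n) : Ambient m :=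
  normalD c F v (normalD c F w ξ) u - normalD c F w (normalD c F v ξ) u

theorem form_add_left (c : ℝ) (p q r : Ambient m) :
    form c (p + q) r = form c p r + form c q r := by
  simp only [form, Pi.add_apply, add_mul, Finset.sum_add_distrib]
  ring

theorem form_smul_left (c a : ℝ) (p r : Ambient m) : form c (a • p) r = a * form c p r := by
  simp only [form, Pi.smul_apply, smul_eq_mul, mul_add, Finset.mul_sum]
  congr 1
  · ring
  · exact Finset.sum_congr rfl fun i _ => by ring

theorem normalPart_add (c : ℝ) (F : Coord n → Ambient m) (u : Coord n) (v w : Ambient m) :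
    normalPart c F u (v + w) = normalPart c F u v + normalPart c F u w := by
  simp only [normalPart, form_add_left, mul_add, add_smul, Finset.sum_add_distrib]
  abel

theorem normalPart_smul (c : ℝ) (F : Coord n → Ambient m) (u : Coord n) (a : ℝ) (w : Ambient m) :
    normalPart c F u (a • w) = a • normalPart c F u w := by
  simp only [normalPart, form_smul_left, smul_sub, Finset.smul_sum, smul_smul, mul_left_comm _ a]

end Local

/-! ### Isometric immersions of a Riemannian manifold into a space form -/

section Global

variable {n m : ℕ} {M : Type*} [TopologicalSpace M] [ChartedSpace (Coord n) M]

/-- The differential of `f` at `x`. -/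
def differential (f : M → Ambient m) (x : M) : TangentSpace (𝓡 n) x →L[ℝ] Ambient m :=
  mfderiv (𝓡 n) 𝓘(ℝ, Ambient m) f x

/-- The expression of `f` in the preferred chart at `x`. -/
def inChart (n : ℕ) {m : ℕ} {M : Type*} [TopologicalSpace M] [ChartedSpace (Coord n) M]
    (f : M → Ambient m) (x : M) : Coord n → Ambient m :=
  fun u => f ((extChartAt (𝓡 n) x).symm u)

/-- The coordinates of a tangent vector at `x` in the preferred chart at `x`. -/
def coords (x : M) : TangentSpace (𝓡 n) x →L[ℝ] Coord n :=
  mfderiv (𝓡 n) 𝓘(ℝ, Coord n) (extChartAt (𝓡 n) x) x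

/-- `f` is a smooth isometric immersion of `M` into the space form of curvature `c`. -/
structure IsIsometricImmersion [RiemannianBundle (fun y : M => TangentSpace (𝓡 n) y)]
    (c : ℝ) (f : M → Ambient m) : Prop where
  smooth : ContMDiff (𝓡 n) 𝓘(ℝ, Ambient m) ∞ f
  mem_spaceForm : ∀ x, f x ∈ SpaceForm c m
  isometric : ∀ (x : M) (X Y : TangentSpace (𝓡 n) x),
    form c (differential f x X) (differential f x Y) = inner ℝ X Y

/-- `ξ` is a normal vector of `f` at `x`. -/
def IsNormal (n : ℕ) {m : ℕ} {M : Type*} [TopologicalSpace M] [ChartedSpace (Coord n) M]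
    (c : ℝ) (f : M → Ambient m) (x : M) (ξ : Ambient m) : Prop :=
  IsTangent c (f x) ξ ∧ ∀ X : TangentSpace (𝓡 n) x, form c ξ (differential f x X) = 0

/-- The normal bundle of `f` is flat: `R^⊥(v, w)ξ = 0` for all local normal fields `ξ`. -/
def FlatNormalBundle (n : ℕ) {m : ℕ} {M : Type*} [TopologicalSpace M] [ChartedSpace (Coord n) M]
    (c : ℝ) (f : M → Ambient m) : Prop :=
  ∀ (x : M) (ξ : Coord n → Ambient m),
    ContDiffOn ℝ ∞ ξ (extChartAt (𝓡 n) x).target →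
    (∀ u ∈ (extChartAt (𝓡 n) x).target,
      IsNormal n c f ((extChartAt (𝓡 n) x).symm u) (ξ u)) →
    ∀ u ∈ (extChartAt (𝓡 n) x).target, ∀ v w : Coord n,
      normalCurvature c (inChart n f x) v w ξ u = 0

/-- The second fundamental form `α(x)(X, Y)` of `f`. -/
def secondFundamentalForm (c : ℝ) (f : M → Ambient m) (x : M)
    (X Y : TangentSpace (𝓡 n) x) : Ambient m :=
  secondFF c (inChart n f x) (extChartAt (𝓡 n) x x) (coords x X) (coords x Y)

variable [RiemannianBundle (fun y : M => TangentSpace (𝓡 n) y)]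

/-- `E_η = {X ∈ T_xM : α(x)(X, Y) = ⟨X, Y⟩ η for all Y ∈ T_xM}`. -/
def principalSpace (c : ℝ) (f : M → Ambient m) (x : M) (η : Ambient m) :
    Submodule ℝ (TangentSpace (𝓡 n) x) where
  carrier := {X | ∀ Y : TangentSpace (𝓡 n) x,
    secondFundamentalForm c f x X Y = (inner ℝ X Y : ℝ) • η}
  add_mem' := by
    intro X X' hX hX' Y
    have h : secondFundamentalForm c f x (X + X') Y
        = secondFundamentalForm c f x X Y + secondFundamentalForm c f x X' Y := by
      simp only [secondFundamentalForm, secondFF, map_add, normalPart_add]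
    rw [h, hX Y, hX' Y, inner_add_left, add_smul]
  zero_mem' := by
    intro Y
    have h : secondFundamentalForm c f x ((0 : ℝ) • (0 : TangentSpace (𝓡 n) x)) Y
        = (0 : ℝ) • secondFundamentalForm c f x 0 Y := by
      simp only [secondFundamentalForm, secondFF, map_smul, normalPart_smul]
    rw [zero_smul, zero_smul] at h
    rw [h, inner_zero_left, zero_smul]
  smul_mem' := by
    intro a X hX Y
    have h : secondFundamentalForm c f x (a • X) Y = a • secondFundamentalForm c f x X Y := by
      simp only [secondFundamentalForm, secondFF, map_smul, normalPart_smul]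
    rw [h, hX Y, real_inner_smul_left, smul_smul]

/-- `η 0, …, η (s - 1)` are the principal normal vectors of `f` at `x`: pairwise distinct normal
vectors, with nonzero spaces `E_(η i)`, such that `T_xM` is the orthogonal direct sum of the
`E_(η i)`. -/
structure ArePrincipalNormals (n : ℕ) {m : ℕ} {M : Type*} [TopologicalSpace M]
    [ChartedSpace (Coord n) M] [RiemannianBundle (fun y : M => TangentSpace (𝓡 n) y)]
    (c : ℝ) (f : M → Ambient m) (x : M) {s : ℕ} (η : Fin s → Ambient m) : Prop where
  distinct : Function.Injective η
  normal : ∀ i, IsNormal n c f x (η i)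
  ne_bot : ∀ i, principalSpace (n := n) c f x (η i) ≠ ⊥
  orthogonal : ∀ i j, i ≠ j → ∀ X ∈ principalSpace (n := n) c f x (η i),
    ∀ Y ∈ principalSpace (n := n) c f x (η j), (inner ℝ X Y : ℝ) = 0
  iSup_eq_top : ⨆ i, principalSpace (n := n) c f x (η i) = ⊤

/-- `f` is proper: the number `s(x)` of principal normal vectors does not depend on `x`. -/
def IsProperImmersion (n : ℕ) {m : ℕ} {M : Type*} [TopologicalSpace M]
    [ChartedSpace (Coord n) M] [RiemannianBundle (fun y : M => TangentSpace (𝓡 n) y)]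
    (c : ℝ) (f : M → Ambient m) : Prop :=
  ∃ s : ℕ, ∀ x, ∃ η : Fin s → Ambient m, ArePrincipalNormals n c f x η

/-- `f` has type `(l 0, …, l (s - 1))`: at every point the principal normal vectors can be numbered
so that `dim E_(η i) = l i`. -/
def HasType (n : ℕ) {m : ℕ} {M : Type*} [TopologicalSpace M]
    [ChartedSpace (Coord n) M] [RiemannianBundle (fun y : M => TangentSpace (𝓡 n) y)]
    (c : ℝ) (f : M → Ambient m) {s : ℕ} (l : Fin s → ℕ) : Prop :=
  ∀ x, ∃ η : Fin s → Ambient m, ArePrincipalNormals n c f x η ∧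
    ∀ i, Module.finrank ℝ (principalSpace (n := n) c f x (η i)) = l i

end Global

end

/-! Let `T` be a unit vector spanning the line `E_η`, determined up to sign, so that the second
fundamental form is `⟨X, Y⟩ ζ + ⟨X, T⟩ ⟨Y, T⟩ (η - ζ)`. The Gauss equation (`scalarCoord_eq`) gives
`R = n(n-1)c + (n-1)ρ` with `ρ = 2⟨η, ζ⟩ + (n-2)⟨ζ, ζ⟩`. So `ρ` is constant, and what has to be
shown is `ρ ≥ 0` for `c ≤ 0`, strictly in the compact case, and `ρ > -2c` for `c > 0`.

The Codazzi equation with `n ≥ 3` shows that `ζ` is parallel in the normal bundle in directions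
orthogonal to `T`, that `∇_T ζ = ψ (η - ζ)`, and that `∇_X T = ψ X` for `X ⊥ T`. Let `w = n⟨ζ, ζ⟩ -
ρ = 2(⟨ζ, ζ⟩ - ⟨η, ζ⟩)` be the gap. Constancy of `ρ` makes `T` geodesic wherever `w ≠ 0`
(`fderiv_tau_eq`), and then `T(w) = -nψw` (`fderiv_gap`) and `T(ψ) = -ψ² - (⟨η, ζ⟩ + c)`
(`riccati`).

Suppose that `w ≥ w₀ > 0` and `⟨η, ζ⟩ + c < 0` everywhere. In the direction `sign(ψ) T` the gap
decreases, while `|ψ|ⁿ / w` increases: the `ψ²` terms cancel exactly. A lower bound for this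
quotient keeps `|ψ|` away from zero, so `w` falls at a definite rate per unit length; on a complete
manifold this contradicts `w ≥ w₀`. This is `false_of_gap_pos`, where Ekeland's principle takes the
place of integral curves of `T`.

A forbidden value of `ρ` produces exactly these hypotheses. In the compact case with `ρ = 0` the gap
is `n⟨ζ, ζ⟩`. Its zero set is closed, and open because the gap solves a linear equation
(`isOpen_gap_eq_zero`); it is not all of `M`, since at a maximum of a suitable ambient function `ζ`
cannot vanish identically (`exists_zeta_ne_zero`). Hence the gap is positive and has a positive
minimum. -/

/-! ### Immersions with a principal frame; the Codazzi equation -/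

section LocalFrame

open Filter Topology

variable {E A : Type*} [NormedAddCommGroup E] [NormedSpace ℝ E]
  [NormedAddCommGroup A] [NormedSpace ℝ A]

/-- `T` is a unit vector, and `η`, `ζ` are distinct normal vectors at `u` of the immersion `F` into
a space form of curvature `c`, such that the second fundamental form is
`⟨v, w⟩ ζ + ⟨v, T⟩ ⟨w, T⟩ (η - ζ)`. -/
structure IsPrincipalFrameAt (B : A →L[ℝ] A →L[ℝ] ℝ) (c : ℝ) (F : E → A) (u : E) (T : E)
    (η ζ : A) : Prop where
  unit : B (fderiv ℝ F u T) (fderiv ℝ F u T) = 1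
  eta_normal : ∀ v, B η (fderiv ℝ F u v) = 0
  zeta_normal : ∀ v, B ζ (fderiv ℝ F u v) = 0
  eta_radial : c * B η (F u) = 0
  zeta_radial : c * B ζ (F u) = 0
  diff_pos : 0 < B (η - ζ) (η - ζ)
  second : ∀ v w, ∃ γ, fderiv ℝ (fderiv ℝ F) u v w = fderiv ℝ F u γ
    + B (fderiv ℝ F u v) (fderiv ℝ F u w) • ζ
    + (B (fderiv ℝ F u v) (fderiv ℝ F u T) * B (fderiv ℝ F u w) (fderiv ℝ F u T)) • (η - ζ)
    - (c * B (fderiv ℝ F u v) (fderiv ℝ F u w)) • F u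

/-- `F` is a smooth immersion of the open set `Ω` into a space with scalar product `B`, orthogonal
to its position vector if `c ≠ 0`. -/
structure IsLocalImmersion (B : A →L[ℝ] A →L[ℝ] ℝ) (c : ℝ) (F : E → A) (Ω : Set E) : Prop where
  isOpen : IsOpen Ω
  smooth : ContDiffOn ℝ ∞ F Ω
  symm : ∀ p q, B p q = B q p
  pos : ∀ u ∈ Ω, ∀ v, v ≠ 0 → 0 < B (fderiv ℝ F u v) (fderiv ℝ F u v)
  radial : ∀ u ∈ Ω, ∀ v, c * B (F u) (fderiv ℝ F u v) = 0

/-- A smooth principal frame on the open set `Ω`. -/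
structure IsPrincipalFrame (B : A →L[ℝ] A →L[ℝ] ℝ) (c : ℝ) (F : E → A) (Ω : Set E) (T : E → E)
    (η ζ : E → A) : Prop extends IsLocalImmersion B c F Ω where
  smooth_T : ContDiffOn ℝ ∞ T Ω
  smooth_eta : ContDiffOn ℝ ∞ η Ω
  smooth_zeta : ContDiffOn ℝ ∞ ζ Ω
  frame : ∀ u ∈ Ω, IsPrincipalFrameAt B c F u (T u) (η u) (ζ u)

theorem fderiv_bilin (B : A →L[ℝ] A →L[ℝ] ℝ) {p q : E → A} {u : E}
    (hp : DifferentiableAt ℝ p u) (hq : DifferentiableAt ℝ q u) (z : E) :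
    fderiv ℝ (fun x => B (p x) (q x)) u z
      = B (fderiv ℝ p u z) (q u) + B (p u) (fderiv ℝ q u z) := by
  rw [(B.hasFDerivAt_of_bilinear hp.hasFDerivAt hq.hasFDerivAt).fderiv]
  simp [add_comm]

theorem differentiableAt_bilin (B : A →L[ℝ] A →L[ℝ] ℝ) {p q : E → A} {u : E}
    (hp : DifferentiableAt ℝ p u) (hq : DifferentiableAt ℝ q u) :
    DifferentiableAt ℝ (fun x => B (p x) (q x)) u :=
  (B.hasFDerivAt_of_bilinear hp.hasFDerivAt hq.hasFDerivAt).differentiableAt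

theorem fderiv_fderiv_apply {F : E → A} {u : E} (h : DifferentiableAt ℝ (fderiv ℝ F) u) (v z : E) :
    fderiv ℝ (fun x => fderiv ℝ F x v) u z = fderiv ℝ (fderiv ℝ F) u z v := by
  rw [fderiv_clm_apply h (differentiableAt_const v)]
  simp

theorem fderiv_eq_of_eqOn {W : Type*} [NormedAddCommGroup W] [NormedSpace ℝ W] {Ω : Set E}
    (hΩ : IsOpen Ω) {u : E} (hu : u ∈ Ω) {p q : E → W}
    (h : ∀ x ∈ Ω, p x = q x) : fderiv ℝ p u = fderiv ℝ q u :=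
  (Filter.eventuallyEq_of_mem (hΩ.mem_nhds hu) h).fderiv_eq

theorem contDiffOn_infty_fderiv {W : Type*} [NormedAddCommGroup W] [NormedSpace ℝ W] {Ω : Set E}
    (hΩ : IsOpen Ω) {p : E → W} (h : ContDiffOn ℝ ∞ p Ω) : ContDiffOn ℝ ∞ (fderiv ℝ p) Ω :=
  h.fderiv_of_isOpen hΩ (by simp)

theorem ContDiffOn.differentiableAt_of_isOpen {W : Type*} [NormedAddCommGroup W] [NormedSpace ℝ W]
    {Ω : Set E} (hΩ : IsOpen Ω) {u : E} (hu : u ∈ Ω) {p : E → W} (h : ContDiffOn ℝ ∞ p Ω) :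
    DifferentiableAt ℝ p u :=
  (h.contDiffAt (hΩ.mem_nhds hu)).differentiableAt (by simp)

theorem fderiv_fderiv_symm {W : Type*} [NormedAddCommGroup W] [NormedSpace ℝ W]
    {Ω : Set E} (hΩ : IsOpen Ω) {u : E} (hu : u ∈ Ω) {p : E → W} (h : ContDiffOn ℝ ∞ p Ω)
    (v w : E) : fderiv ℝ (fderiv ℝ p) u v w = fderiv ℝ (fderiv ℝ p) u w v :=
  (h.contDiffAt (hΩ.mem_nhds hu)).isSymmSndFDerivAt (by simpa using WithTop.coe_le_coe.2 (le_top : (2 : ℕ∞) ≤ ⊤)) v w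

namespace IsLocalImmersion

variable {B : A →L[ℝ] A →L[ℝ] ℝ} {c : ℝ} {F : E → A} {Ω : Set E}
  (h : IsLocalImmersion B c F Ω) {u : E} (hu : u ∈ Ω)

include h

theorem smooth_fderiv : ContDiffOn ℝ ∞ (fderiv ℝ F) Ω := contDiffOn_infty_fderiv h.isOpen h.smooth

theorem smooth_second : ContDiffOn ℝ ∞ (fderiv ℝ (fderiv ℝ F)) Ω :=
  contDiffOn_infty_fderiv h.isOpen h.smooth_fderiv

include hu

theorem differentiableAt : DifferentiableAt ℝ F u :=
  h.smooth.differentiableAt_of_isOpen h.isOpen hu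

theorem differentiableAt_fderiv : DifferentiableAt ℝ (fderiv ℝ F) u :=
  h.smooth_fderiv.differentiableAt_of_isOpen h.isOpen hu

theorem differentiableAt_partial (v : E) : DifferentiableAt ℝ (fun x => fderiv ℝ F x v) u :=
  (h.differentiableAt_fderiv hu).clm_apply (differentiableAt_const v)

theorem second_symm (v w : E) :
    fderiv ℝ (fderiv ℝ F) u v w = fderiv ℝ (fderiv ℝ F) u w v :=
  fderiv_fderiv_symm h.isOpen hu h.smooth v w

/-- The derivative of the induced metric. -/
theorem fderiv_metric (v w z : E) :
    fderiv ℝ (fun x => B (fderiv ℝ F x v) (fderiv ℝ F x w)) u z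
      = B (fderiv ℝ (fderiv ℝ F) u z v) (fderiv ℝ F u w)
        + B (fderiv ℝ (fderiv ℝ F) u z w) (fderiv ℝ F u v) := by
  rw [fderiv_bilin B (h.differentiableAt_partial hu v) (h.differentiableAt_partial hu w),
    fderiv_fderiv_apply (h.differentiableAt_fderiv hu),
    fderiv_fderiv_apply (h.differentiableAt_fderiv hu), h.symm (fderiv ℝ F u v)]

/-- This is the derivative of `⟨F, F_w⟩ = 0`. The factor `c` is kept throughout so that the
Euclidean case, where the position vector satisfies no such condition, needs no separate treatment.
-/
theorem radial_second (v w : E) :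
    c * B (F u) (fderiv ℝ (fderiv ℝ F) u v w) = -(c * B (fderiv ℝ F u v) (fderiv ℝ F u w)) := by
  have h1 : fderiv ℝ (fun x => c * B (F x) (fderiv ℝ F x w)) u = fderiv ℝ (fun _ => (0 : ℝ)) u :=
    fderiv_eq_of_eqOn h.isOpen hu fun x hx => h.radial x hx w
  have hd : DifferentiableAt ℝ (fun x => B (F x) (fderiv ℝ F x w)) u :=
    (B.hasFDerivAt_of_bilinear (h.differentiableAt hu).hasFDerivAt
      (h.differentiableAt_partial hu w).hasFDerivAt).differentiableAt
  have h2 := congrArg (fun L => L v) h1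
  simp only [fderiv_const_mul hd, smul_apply, smul_eq_mul,
    fderiv_bilin B (h.differentiableAt hu) (h.differentiableAt_partial hu w),
    fderiv_fderiv_apply (h.differentiableAt_fderiv hu)] at h2
  rw [fderiv_const_apply, zero_apply] at h2
  linarith

end IsLocalImmersion

/-- A normal vector `ξ` does not see the tangential and radial parts of the second derivative. -/
theorem IsPrincipalFrameAt.second_bilin {B : A →L[ℝ] A →L[ℝ] ℝ} {c : ℝ} {F : E → A} {u T : E}
    {η ζ : A} (h : IsPrincipalFrameAt B c F u T η ζ)
    {ξ : A} (hξ : ∀ v, B ξ (fderiv ℝ F u v) = 0) (hξc : c * B ξ (F u) = 0) (v w : E) :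
    B ξ (fderiv ℝ (fderiv ℝ F) u v w) = B (fderiv ℝ F u v) (fderiv ℝ F u w) * B ξ ζ
      + B (fderiv ℝ F u v) (fderiv ℝ F u T) * B (fderiv ℝ F u w) (fderiv ℝ F u T)
        * B ξ (η - ζ) := by
  obtain ⟨γ, hγ⟩ := h.second v w
  rw [hγ, map_sub, map_add, map_add, hξ, map_smul, map_smul, map_smul]
  simp only [smul_eq_mul, zero_add]
  linear_combination -(B (fderiv ℝ F u v) (fderiv ℝ F u w)) * hξc

namespace IsPrincipalFrame

variable {B : A →L[ℝ] A →L[ℝ] ℝ} {c : ℝ} {F : E → A} {Ω : Set E} {T : E → E} {η ζ : E → A}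
  (h : IsPrincipalFrame B c F Ω T η ζ) {u : E} (hu : u ∈ Ω)

include h

theorem smooth_tau : ContDiffOn ℝ ∞ (fun x => fderiv ℝ F x (T x)) Ω :=
  h.smooth_fderiv.clm_apply h.smooth_T

include hu

theorem differentiableAt_tau : DifferentiableAt ℝ (fun x => fderiv ℝ F x (T x)) u :=
  h.smooth_tau.differentiableAt_of_isOpen h.isOpen hu

theorem differentiableAt_eta : DifferentiableAt ℝ η u :=
  h.smooth_eta.differentiableAt_of_isOpen h.isOpen hu

theorem differentiableAt_zeta : DifferentiableAt ℝ ζ u :=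
  h.smooth_zeta.differentiableAt_of_isOpen h.isOpen hu

/-- The derivative of `⟨v, T⟩`. -/
theorem fderiv_inner_T (v z : E) :
    fderiv ℝ (fun x => B (fderiv ℝ F x v) (fderiv ℝ F x (T x))) u z
      = B (fderiv ℝ (fderiv ℝ F) u z v) (fderiv ℝ F u (T u))
        + B (fderiv ℝ (fun x => fderiv ℝ F x (T x)) u z) (fderiv ℝ F u v) := by
  rw [fderiv_bilin B (h.differentiableAt_partial hu v) (h.differentiableAt_tau hu),
    fderiv_fderiv_apply (h.differentiableAt_fderiv hu), h.symm (fderiv ℝ F u v)]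

theorem fderiv_tau_T (z : E) :
    B (fderiv ℝ (fun x => fderiv ℝ F x (T x)) u z) (fderiv ℝ F u (T u)) = 0 := by
  have h1 := congrArg (fun L => L z) (fderiv_eq_of_eqOn (W := ℝ) h.isOpen hu
    (q := fun _ => 1) fun x hx => (h.frame x hx).unit)
  simp only [fderiv_bilin B (h.differentiableAt_tau hu) (h.differentiableAt_tau hu)] at h1
  rw [h.symm (fderiv ℝ F u (T u))] at h1
  simp at h1
  linarith

/-- For a normal field `ξ`, `⟨D_z ξ, F_v⟩ = -⟨ξ, D²F(z, v)⟩`. -/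
theorem fderiv_normal_tangent {ξ : E → A} (hξ : DifferentiableAt ℝ ξ u)
    (hn : ∀ x ∈ Ω, ∀ v, B (ξ x) (fderiv ℝ F x v) = 0) (v z : E) :
    B (fderiv ℝ ξ u z) (fderiv ℝ F u v) = -B (ξ u) (fderiv ℝ (fderiv ℝ F) u z v) := by
  have h1 := congrArg (fun L => L z) (fderiv_eq_of_eqOn (W := ℝ) h.isOpen hu
    (q := fun _ => 0) fun x hx => hn x hx v)
  simp only [fderiv_bilin B hξ (h.differentiableAt_partial hu v),
    fderiv_fderiv_apply (h.differentiableAt_fderiv hu)] at h1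
  simp at h1
  linarith

/-- A normal field has no radial derivative. -/
theorem fderiv_normal_radial {ξ : E → A} (hξ : DifferentiableAt ℝ ξ u)
    (hn : ∀ x ∈ Ω, ∀ v, B (ξ x) (fderiv ℝ F x v) = 0)
    (hr : ∀ x ∈ Ω, c * B (ξ x) (F x) = 0) (z : E) :
    c * B (fderiv ℝ ξ u z) (F u) = 0 := by
  have h1 := congrArg (fun L => L z) (fderiv_eq_of_eqOn (W := ℝ) h.isOpen hu
    (q := fun _ => 0) fun x hx => hr x hx)
  have hd := differentiableAt_bilin B hξ (h.differentiableAt hu)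
  simp only [fderiv_const_mul hd, smul_apply, smul_eq_mul,
    fderiv_bilin B hξ (h.differentiableAt hu), hn u hu] at h1
  simpa using h1

/-- The Codazzi equation, paired with a normal field `ξ`. -/
theorem codazzi {ξ : E → A} (hξ : DifferentiableAt ℝ ξ u)
    (hn : ∀ x ∈ Ω, ∀ v, B (ξ x) (fderiv ℝ F x v) = 0)
    (hr : ∀ x ∈ Ω, c * B (ξ x) (F x) = 0) (z v w : E) :
    let g := fun v w => B (fderiv ℝ F u v) (fderiv ℝ F u w)
    let σ := fun z v => B (fderiv ℝ (fun x => fderiv ℝ F x (T x)) u z) (fderiv ℝ F u v)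
    g v w * B (ξ u) (fderiv ℝ ζ u z)
        + (σ z v * g w (T u) + g v (T u) * σ z w) * B (ξ u) (η u - ζ u)
        + g v (T u) * g w (T u) * B (ξ u) (fderiv ℝ η u z - fderiv ℝ ζ u z)
      = g z w * B (ξ u) (fderiv ℝ ζ u v)
        + (σ v z * g w (T u) + g z (T u) * σ v w) * B (ξ u) (η u - ζ u)
        + g z (T u) * g w (T u) * B (ξ u) (fderiv ℝ η u v - fderiv ℝ ζ u v) := by
  intro g σ
  -- Differentiate the normal component of `D²F(v, w)` along `z`. The first two groups on the right
  -- are totally symmetric because `D²F` is, so exchanging `z` and `v` cancels them and leaves the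
  -- Codazzi equation.
  have key : ∀ z v w : E, B (ξ u) (fderiv ℝ (fderiv ℝ (fderiv ℝ F)) u z v w)
      = (B (fderiv ℝ (fderiv ℝ F) u v w) (fderiv ℝ F u z)
          + B (fderiv ℝ (fderiv ℝ F) u z v) (fderiv ℝ F u w)
          + B (fderiv ℝ (fderiv ℝ F) u z w) (fderiv ℝ F u v)) * B (ξ u) (ζ u)
        + (g z (T u) * B (fderiv ℝ (fderiv ℝ F) u v w) (fderiv ℝ F u (T u))
          + g w (T u) * B (fderiv ℝ (fderiv ℝ F) u z v) (fderiv ℝ F u (T u))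
          + g v (T u) * B (fderiv ℝ (fderiv ℝ F) u z w) (fderiv ℝ F u (T u)))
          * B (ξ u) (η u - ζ u)
        + (g v w * B (ξ u) (fderiv ℝ ζ u z)
        + (σ z v * g w (T u) + g v (T u) * σ z w) * B (ξ u) (η u - ζ u)
        + g v (T u) * g w (T u) * B (ξ u) (fderiv ℝ η u z - fderiv ℝ ζ u z)) := by
    intro z v w
    have hS := h.smooth_second.differentiableAt_of_isOpen h.isOpen hu
    have hS1 : DifferentiableAt ℝ (fun x => fderiv ℝ (fderiv ℝ F) x v w) u :=
      (hS.clm_apply (differentiableAt_const v)).clm_apply (differentiableAt_const w)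
    have h3 : fderiv ℝ (fun x => fderiv ℝ (fderiv ℝ F) x v w) u z
        = fderiv ℝ (fderiv ℝ (fderiv ℝ F)) u z v w := by
      rw [fderiv_clm_apply (hS.clm_apply (differentiableAt_const v)) (differentiableAt_const w),
        fderiv_clm_apply hS (differentiableAt_const v)]
      simp
    have hg := differentiableAt_bilin B (h.differentiableAt_partial hu v)
      (h.differentiableAt_partial hu w)
    have htv := differentiableAt_bilin B (h.differentiableAt_partial hu v)
      (h.differentiableAt_tau hu)
    have htw := differentiableAt_bilin B (h.differentiableAt_partial hu w)
      (h.differentiableAt_tau hu)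
    have hη := h.differentiableAt_eta hu
    have hζ := h.differentiableAt_zeta hu
    have h1 := congrArg (fun L => L z) (fderiv_eq_of_eqOn (W := ℝ) h.isOpen hu
      fun x hx => (h.frame x hx).second_bilin (hn x hx) (hr x hx) v w)
    have hξζ := differentiableAt_bilin B hξ hζ
    have hξδ := differentiableAt_bilin B hξ (hη.sub hζ)
    simp only [Pi.sub_apply] at hξδ
    have hsub : fderiv ℝ (fun x => η x - ζ x) u z = fderiv ℝ η u z - fderiv ℝ ζ u z := by
      rw [fderiv_fun_sub hη hζ]; rfl
    have e1 := h.fderiv_metric hu v w z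
    have e2 := h.fderiv_inner_T hu v z
    have e3 := h.fderiv_inner_T hu w z
    simp only [fderiv_bilin B hξ hS1, h3] at h1
    rw [fderiv_fun_add (hg.fun_mul hξζ) ((htv.fun_mul htw).fun_mul hξδ)] at h1
    rw [fderiv_fun_mul hg hξζ, fderiv_fun_mul (htv.fun_mul htw) hξδ] at h1
    simp only [add_apply, smul_apply, smul_eq_mul] at h1
    rw [fderiv_fun_mul htv htw] at h1
    simp only [add_apply, smul_apply, smul_eq_mul] at h1
    rw [e1, e2, e3, fderiv_bilin B hξ hζ, fderiv_bilin B hξ (hη.fun_sub hζ), hsub] at h1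
    obtain ⟨γ, hγ⟩ := (h.frame u hu).second v w
    -- `γ` is the tangential part of `D²F(v, w)`; what `D_z ξ` contributes through it becomes part
    -- of the symmetric groups by `k2`.
    have k1 : B (fderiv ℝ ξ u z) (fderiv ℝ (fderiv ℝ F) u v w)
        = -(g z γ * B (ξ u) (ζ u) + g z (T u) * g γ (T u) * B (ξ u) (η u - ζ u))
          + g v w * B (fderiv ℝ ξ u z) (ζ u)
          + g v (T u) * g w (T u) * B (fderiv ℝ ξ u z) (η u - ζ u) := by
      rw [hγ, map_sub, map_add, map_add, map_smul, map_smul, map_smul,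
        h.fderiv_normal_tangent hu hξ hn,
        (h.frame u hu).second_bilin (hn u hu) (hr u hu) z γ]
      have := h.fderiv_normal_radial hu hξ hn hr z
      simp only [smul_eq_mul]
      linear_combination -(g v w) * this
    have k2 : ∀ y, B (fderiv ℝ (fderiv ℝ F) u v w) (fderiv ℝ F u y) = g γ y := by
      intro y
      rw [hγ]
      simp only [map_add, map_sub, map_smul, add_apply,
        sub_apply, smul_apply, smul_eq_mul,
        (h.frame u hu).eta_normal, (h.frame u hu).zeta_normal]
      linear_combination -(g v w) * h.radial u hu y
    rw [k1] at h1
    rw [k2, k2, show g γ z = g z γ from h.symm _ _]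
    linear_combination h1
  have h1 := key z v w
  have h2 := key v z w
  rw [fderiv_fderiv_symm h.isOpen hu h.smooth_fderiv z v] at h1
  rw [h1, h.second_symm hu z v, h.second_symm hu z w, h.second_symm hu v w] at h2
  linear_combination h2

end IsPrincipalFrame
end LocalFrame

/-! ### Consequences of Codazzi and constant scalar curvature; the Riccati equation -/

section LocalRiccati

open Filter Topology

theorem exists_ne_zero_of_two_functionals {E : Type*} [NormedAddCommGroup E] [NormedSpace ℝ E]
    [FiniteDimensional ℝ E] (hE : 3 ≤ Module.finrank ℝ E) (l₁ l₂ : E →ₗ[ℝ] ℝ) :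
    ∃ y, y ≠ 0 ∧ l₁ y = 0 ∧ l₂ y = 0 := by
  have h : LinearMap.ker (l₁.prod l₂) ≠ ⊥ := by
    apply LinearMap.ker_ne_bot_of_finrank_lt
    rw [Module.finrank_prod, Module.finrank_self]
    omega
  obtain ⟨y, hy, hy0⟩ := Submodule.exists_mem_ne_zero_of_ne_bot h
  have := LinearMap.mem_ker.1 hy
  simp only [LinearMap.prod_apply, Prod.mk_eq_zero, Function.prod_apply] at this
  exact ⟨y, hy0, this.1, this.2⟩

variable {E A : Type*} [NormedAddCommGroup E] [NormedSpace ℝ E]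
  [NormedAddCommGroup A] [NormedSpace ℝ A]

theorem contDiffOn_bilin (B : A →L[ℝ] A →L[ℝ] ℝ) {p q : E → A} {Ω : Set E}
    (hp : ContDiffOn ℝ ∞ p Ω) (hq : ContDiffOn ℝ ∞ q Ω) :
    ContDiffOn ℝ ∞ (fun x => B (p x) (q x)) Ω :=
  (B.contDiff.comp_contDiffOn hp).clm_apply hq

/-- The function `ψ` with `∇_X T = ψ X` for `X` orthogonal to `T`. -/
noncomputable def umbilicity (B : A →L[ℝ] A →L[ℝ] ℝ) (T : E → E) (η ζ : E → A) (u : E) : ℝ :=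
  B (fderiv ℝ ζ u (T u)) (η u - ζ u) / B (η u - ζ u) (η u - ζ u)

namespace IsPrincipalFrame

variable {B : A →L[ℝ] A →L[ℝ] ℝ} {c : ℝ} {F : E → A} {Ω : Set E} {T : E → E} {η ζ : E → A}
  (h : IsPrincipalFrame B c F Ω T η ζ) {u : E} (hu : u ∈ Ω)

include h

theorem smooth_umbilicity : ContDiffOn ℝ ∞ (umbilicity B T η ζ) Ω := by
  have hδ := h.smooth_eta.sub h.smooth_zeta
  exact (contDiffOn_bilin B
    ((contDiffOn_infty_fderiv h.isOpen h.smooth_zeta).clm_apply h.smooth_T) hδ).div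
    (contDiffOn_bilin B hδ hδ) fun x hx => (h.frame x hx).diff_pos.ne'

include hu

variable [FiniteDimensional ℝ E] (hE : 3 ≤ Module.finrank ℝ E)

include hE in
-- Dimension at least three enters the Codazzi argument here: two linear conditions leave a nonzero
-- vector.
theorem exists_orthogonal (X : E) : ∃ Y, 0 < B (fderiv ℝ F u Y) (fderiv ℝ F u Y) ∧
    B (fderiv ℝ F u Y) (fderiv ℝ F u (T u)) = 0 ∧ B (fderiv ℝ F u X) (fderiv ℝ F u Y) = 0 := by
  obtain ⟨Y, h0, h1, h2⟩ := exists_ne_zero_of_two_functionals hE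
    ((B (fderiv ℝ F u (T u))) ∘L (fderiv ℝ F u)).toLinearMap
    ((B (fderiv ℝ F u X)) ∘L (fderiv ℝ F u)).toLinearMap
  refine ⟨Y, h.pos u hu Y h0, ?_, h2⟩
  rw [h.symm]; exact h1

include hE in
/-- `ζ` is parallel in the directions orthogonal to `T`. -/
theorem fderiv_zeta_orthogonal {ξ : E → A} (hξ : DifferentiableAt ℝ ξ u)
    (hn : ∀ x ∈ Ω, ∀ v, B (ξ x) (fderiv ℝ F x v) = 0)
    (hr : ∀ x ∈ Ω, c * B (ξ x) (F x) = 0) {X : E}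
    (hX : B (fderiv ℝ F u X) (fderiv ℝ F u (T u)) = 0) :
    B (ξ u) (fderiv ℝ ζ u X) = 0 := by
  obtain ⟨Y, hY, hYT, hXY⟩ := h.exists_orthogonal hu hE X
  -- With `Y` orthogonal to both `T` and `X`, only `|Y|² ⟨ξ, ∇_X ζ⟩` survives.
  have hc := h.codazzi hu hξ hn hr X Y Y
  dsimp only at hc
  rw [hX, hYT, hXY] at hc
  have : B (fderiv ℝ F u Y) (fderiv ℝ F u Y) * B (ξ u) (fderiv ℝ ζ u X) = 0 := by
    linear_combination hc
  exact (mul_eq_zero.1 this).resolve_left hY.ne'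

omit [FiniteDimensional ℝ E] in
-- Codazzi with one argument `T` and two orthogonal to it. It yields both the umbilicity of `T^⊥`
-- (take `ξ = η - ζ`) and the derivative of `ζ` along `T`.
theorem codazzi_T {ξ : E → A} (hξ : DifferentiableAt ℝ ξ u)
    (hn : ∀ x ∈ Ω, ∀ v, B (ξ x) (fderiv ℝ F x v) = 0)
    (hr : ∀ x ∈ Ω, c * B (ξ x) (F x) = 0) {X Y : E}
    (hX : B (fderiv ℝ F u X) (fderiv ℝ F u (T u)) = 0)
    (hY : B (fderiv ℝ F u Y) (fderiv ℝ F u (T u)) = 0) :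
    B (fderiv ℝ F u X) (fderiv ℝ F u Y) * B (ξ u) (fderiv ℝ ζ u (T u))
      = B (fderiv ℝ (fun x => fderiv ℝ F x (T x)) u X) (fderiv ℝ F u Y)
        * B (ξ u) (η u - ζ u) := by
  have hc := h.codazzi hu hξ hn hr (T u) X Y
  dsimp only at hc
  rw [hX, hY, (h.frame u hu).unit, h.symm (fderiv ℝ F u (T u)) (fderiv ℝ F u Y), hY] at hc
  linear_combination hc

omit [FiniteDimensional ℝ E] in
theorem differentiableAt_diff : DifferentiableAt ℝ (fun x => η x - ζ x) u :=
  (h.differentiableAt_eta hu).fun_sub (h.differentiableAt_zeta hu)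

omit [FiniteDimensional ℝ E] hu in
theorem diff_normal : ∀ x ∈ Ω, ∀ v, B (η x - ζ x) (fderiv ℝ F x v) = 0 := fun x hx v => by
  rw [map_sub, sub_apply, (h.frame x hx).eta_normal, (h.frame x hx).zeta_normal, sub_zero]

omit [FiniteDimensional ℝ E] hu in
theorem diff_radial : ∀ x ∈ Ω, c * B (η x - ζ x) (F x) = 0 := fun x hx => by
  rw [map_sub, sub_apply, mul_sub, (h.frame x hx).eta_radial, (h.frame x hx).zeta_radial, sub_zero]

omit [FiniteDimensional ℝ E] in
/-- The distribution orthogonal to `T` is umbilic. -/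
theorem fderiv_tau_orthogonal {X Y : E}
    (hX : B (fderiv ℝ F u X) (fderiv ℝ F u (T u)) = 0)
    (hY : B (fderiv ℝ F u Y) (fderiv ℝ F u (T u)) = 0) :
    B (fderiv ℝ (fun x => fderiv ℝ F x (T x)) u X) (fderiv ℝ F u Y)
      = umbilicity B T η ζ u * B (fderiv ℝ F u X) (fderiv ℝ F u Y) := by
  -- Division by `|η - ζ|² > 0` is what defines `umbilicity`.
  have hc := h.codazzi_T hu (h.differentiableAt_diff hu) h.diff_normal h.diff_radial hX hY
  have hp := (h.frame u hu).diff_pos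
  rw [umbilicity, h.symm (fderiv ℝ ζ u (T u))]
  field_simp
  linear_combination -hc

include hE in
-- Insert the umbilicity back into `codazzi_T` and cancel `|Y|²`. Since `ξ` is an arbitrary normal
-- field, this means `∇_T ζ = ψ (η - ζ)` in the normal bundle.
theorem fderiv_zeta_T {ξ : E → A} (hξ : DifferentiableAt ℝ ξ u)
    (hn : ∀ x ∈ Ω, ∀ v, B (ξ x) (fderiv ℝ F x v) = 0)
    (hr : ∀ x ∈ Ω, c * B (ξ x) (F x) = 0) :
    B (ξ u) (fderiv ℝ ζ u (T u)) = umbilicity B T η ζ u * B (ξ u) (η u - ζ u) := by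
  obtain ⟨Y, hY, hYT, -⟩ := h.exists_orthogonal hu hE 0
  have hc := h.codazzi_T hu hξ hn hr hYT hYT
  rw [h.fderiv_tau_orthogonal hu hYT hYT] at hc
  apply mul_left_cancel₀ hY.ne'
  linear_combination hc

include hE in
-- Codazzi for `(X, T, T)`: the variation of `η` across `T` is governed by the acceleration `∇_T T`.
theorem fderiv_eta_orthogonal {ξ : E → A} (hξ : DifferentiableAt ℝ ξ u)
    (hn : ∀ x ∈ Ω, ∀ v, B (ξ x) (fderiv ℝ F x v) = 0)
    (hr : ∀ x ∈ Ω, c * B (ξ x) (F x) = 0) {X : E}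
    (hX : B (fderiv ℝ F u X) (fderiv ℝ F u (T u)) = 0) :
    B (ξ u) (fderiv ℝ η u X)
      = B (fderiv ℝ (fun x => fderiv ℝ F x (T x)) u (T u)) (fderiv ℝ F u X)
        * B (ξ u) (η u - ζ u) := by
  have hc := h.codazzi hu hξ hn hr X (T u) (T u)
  have h0 := h.fderiv_zeta_orthogonal hu hE hξ hn hr hX
  dsimp only at hc
  rw [hX, (h.frame u hu).unit, h.fderiv_tau_T hu, h.fderiv_tau_T hu, h0,
    map_sub (B (ξ u)) (fderiv ℝ η u X), h0] at hc
  linear_combination hc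

omit [FiniteDimensional ℝ E] in
theorem orthogonal_part (v : E) :
    B (fderiv ℝ F u (v - B (fderiv ℝ F u v) (fderiv ℝ F u (T u)) • T u))
      (fderiv ℝ F u (T u)) = 0 := by
  rw [map_sub, map_smul, map_sub, sub_apply, map_smul, smul_apply, (h.frame u hu).unit]
  simp

include hE in
theorem fderiv_zeta {ξ : E → A} (hξ : DifferentiableAt ℝ ξ u)
    (hn : ∀ x ∈ Ω, ∀ v, B (ξ x) (fderiv ℝ F x v) = 0)
    (hr : ∀ x ∈ Ω, c * B (ξ x) (F x) = 0) (v : E) :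
    B (ξ u) (fderiv ℝ ζ u v)
      = umbilicity B T η ζ u * B (fderiv ℝ F u v) (fderiv ℝ F u (T u)) * B (ξ u) (η u - ζ u) := by
  have h1 := h.fderiv_zeta_orthogonal hu hE hξ hn hr (h.orthogonal_part hu v)
  rw [map_sub, map_smul, map_sub, map_smul, h.fderiv_zeta_T hu hE hξ hn hr, smul_eq_mul] at h1
  linear_combination h1

include hE in
/-- The derivative of `⟨ζ, ζ⟩`. -/
theorem fderiv_zeta_zeta (v : E) :
    fderiv ℝ (fun x => B (ζ x) (ζ x)) u v
      = 2 * umbilicity B T η ζ u * B (fderiv ℝ F u v) (fderiv ℝ F u (T u))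
        * (B (η u) (ζ u) - B (ζ u) (ζ u)) := by
  have hζ := h.differentiableAt_zeta hu
  rw [fderiv_bilin B hζ hζ, h.symm (fderiv ℝ ζ u v), h.fderiv_zeta hu hE hζ
    (fun x hx => (h.frame x hx).zeta_normal) (fun x hx => (h.frame x hx).zeta_radial),
    map_sub, h.symm (η u)]
  ring

include hE in
/-- The derivative of `⟨η, ζ⟩` in the directions orthogonal to `T`. -/
theorem fderiv_eta_zeta {X : E} (hX : B (fderiv ℝ F u X) (fderiv ℝ F u (T u)) = 0) :
    fderiv ℝ (fun x => B (η x) (ζ x)) u X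
      = B (fderiv ℝ (fun x => fderiv ℝ F x (T x)) u (T u)) (fderiv ℝ F u X)
        * (B (η u) (ζ u) - B (ζ u) (ζ u)) := by
  have hζ := h.differentiableAt_zeta hu
  have hη := h.differentiableAt_eta hu
  rw [fderiv_bilin B hη hζ, h.symm (fderiv ℝ η u X), h.fderiv_eta_orthogonal hu hE hζ
    (fun x hx => (h.frame x hx).zeta_normal) (fun x hx => (h.frame x hx).zeta_radial) hX,
    h.fderiv_zeta_orthogonal hu hE hη (fun x hx => (h.frame x hx).eta_normal)
    (fun x hx => (h.frame x hx).eta_radial) hX, map_sub, h.symm (η u)]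
  ring

variable {ρ : ℝ} {N : ℝ} (hρ : ∀ x ∈ Ω, 2 * B (η x) (ζ x) + (N - 2) * B (ζ x) (ζ x) = ρ)

include hE hρ

/-- If the scalar curvature is constant, then `T` is geodesic where `⟨η, ζ⟩ ≠ ⟨ζ, ζ⟩`. -/
theorem fderiv_tau_eq (hw : N * B (ζ u) (ζ u) - ρ ≠ 0) (z v : E) :
    B (fderiv ℝ (fun x => fderiv ℝ F x (T x)) u z) (fderiv ℝ F u v)
      = umbilicity B T η ζ u * (B (fderiv ℝ F u z) (fderiv ℝ F u v)
        - B (fderiv ℝ F u z) (fderiv ℝ F u (T u)) * B (fderiv ℝ F u v) (fderiv ℝ F u (T u))) := by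
  have hζ := h.differentiableAt_zeta hu
  have hη := h.differentiableAt_eta hu
  -- Along `X ⊥ T` the function `⟨ζ, ζ⟩` is stationary, so constancy of `ρ` makes the derivative of
  -- `⟨η, ζ⟩` vanish. That derivative is `⟨∇_T T, X⟩` times `-1/2` of the gap.
  have hT : ∀ X, B (fderiv ℝ F u X) (fderiv ℝ F u (T u)) = 0 →
      B (fderiv ℝ (fun x => fderiv ℝ F x (T x)) u (T u)) (fderiv ℝ F u X) = 0 := by
    intro X hX
    have h1 := congrArg (fun L => L X) (fderiv_eq_of_eqOn h.isOpen hu (q := fun _ => ρ) hρ)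
    rw [fderiv_fun_add ((differentiableAt_bilin B hη hζ).const_mul 2)
      ((differentiableAt_bilin B hζ hζ).const_mul (N - 2)),
      fderiv_const_mul (differentiableAt_bilin B hη hζ),
      fderiv_const_mul (differentiableAt_bilin B hζ hζ)] at h1
    simp only [add_apply, smul_apply, smul_eq_mul, fderiv_const_apply, zero_apply] at h1
    rw [h.fderiv_zeta_zeta hu hE, h.fderiv_eta_zeta hu hE hX, hX] at h1
    have h2 := hρ u hu
    have h3 : B (fderiv ℝ (fun x => fderiv ℝ F x (T x)) u (T u)) (fderiv ℝ F u X)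
        * (N * B (ζ u) (ζ u) - ρ) = 0 := by
      rw [← h2]; linear_combination -h1
    exact (mul_eq_zero.1 h3).resolve_right hw
  have hv := h.orthogonal_part hu v
  have hz := h.orthogonal_part hu z
  have h1 := h.fderiv_tau_orthogonal hu hz hv
  have h2 := hT _ hv
  simp only [map_sub, map_smul, sub_apply, smul_apply, smul_eq_mul, h.fderiv_tau_T hu,
    (h.frame u hu).unit, h.symm (fderiv ℝ F u (T u)) (fderiv ℝ F u v)] at h1 h2
  linear_combination h1 + B (fderiv ℝ F u z) (fderiv ℝ F u (T u)) * h2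

/-- The Riccati equation for `ψ` along `T`. -/
theorem riccati (hw : ∀ x ∈ Ω, N * B (ζ x) (ζ x) - ρ ≠ 0) :
    fderiv ℝ (umbilicity B T η ζ) u (T u)
      = -umbilicity B T η ζ u ^ 2 - B (η u) (ζ u) - c := by
  obtain ⟨X, hX, hXT, -⟩ := h.exists_orthogonal hu hE 0
  have hζ := h.differentiableAt_zeta hu
  have hη := h.differentiableAt_eta hu
  have hψ : DifferentiableAt ℝ (umbilicity B T η ζ) u :=
    h.smooth_umbilicity.differentiableAt_of_isOpen h.isOpen hu
  have hτ := h.differentiableAt_tau hu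
  have hτ' : DifferentiableAt ℝ (fderiv ℝ (fun x => fderiv ℝ F x (T x))) u :=
    (contDiffOn_infty_fderiv h.isOpen h.smooth_tau).differentiableAt_of_isOpen h.isOpen hu
  have hσ := fun z v => h.fderiv_tau_eq hu hE hρ (hw u hu) z v
  -- The normal part of the derivative of `dF(T)` along `z` is `α(z, T) = ⟨z, T⟩ η`; the next step
  -- finds its radial part.
  have tnormal : ∀ {ξ : E → A}, DifferentiableAt ℝ ξ u →
      (∀ x ∈ Ω, ∀ v, B (ξ x) (fderiv ℝ F x v) = 0) → (∀ x ∈ Ω, c * B (ξ x) (F x) = 0) → ∀ z,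
      B (fderiv ℝ (fun x => fderiv ℝ F x (T x)) u z) (ξ u)
        = B (fderiv ℝ F u z) (fderiv ℝ F u (T u)) * B (ξ u) (η u) := by
    intro ξ hξ hn hr z
    have h1 := congrArg (fun L => L z) (fderiv_eq_of_eqOn (W := ℝ) h.isOpen hu
      (q := fun _ => 0) fun x hx => hn x hx (T x))
    simp only [fderiv_bilin B hξ hτ, h.fderiv_normal_tangent hu hξ hn,
      (h.frame u hu).second_bilin (hn u hu) (hr u hu), (h.frame u hu).unit, map_sub,
      fderiv_const_apply, zero_apply] at h1
    rw [h.symm]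
    linear_combination h1
  have tradial : ∀ z, c * B (fderiv ℝ (fun x => fderiv ℝ F x (T x)) u z) (F u)
        = -(c * B (fderiv ℝ F u z) (fderiv ℝ F u (T u))) := by
    intro z
    have h1 := congrArg (fun L => L z) (fderiv_eq_of_eqOn (W := ℝ) h.isOpen hu
      (q := fun _ => 0) fun x hx => h.radial x hx (T x))
    rw [fderiv_const_mul (differentiableAt_bilin B (h.differentiableAt hu) hτ)] at h1
    simp only [smul_apply, smul_eq_mul, fderiv_bilin B (h.differentiableAt hu) hτ,
      fderiv_const_apply, zero_apply] at h1
    rw [h.symm _ (F u)]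
    linear_combination h1
  -- Differentiate the formula of `fderiv_tau_eq`, paired with `X ⊥ T`, once more. The term `⟨η, ζ⟩
  -- + c` comes from the normal and radial parts of `D²F(z, X)`.
  have key : ∀ z y : E, B (fderiv ℝ (fderiv ℝ (fun x => fderiv ℝ F x (T x))) u z y)
        (fderiv ℝ F u X)
      = fderiv ℝ (umbilicity B T η ζ) u z * B (fderiv ℝ F u y) (fderiv ℝ F u X)
        + umbilicity B T η ζ u * B (fderiv ℝ (fderiv ℝ F) u z y) (fderiv ℝ F u X)
        - B (fderiv ℝ F u y) (fderiv ℝ F u (T u)) * B (fderiv ℝ F u z) (fderiv ℝ F u X)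
          * (umbilicity B T η ζ u ^ 2 + B (η u) (ζ u) + c) := by
    intro z y
    have hp : DifferentiableAt ℝ (fun x => fderiv ℝ (fun x => fderiv ℝ F x (T x)) x y) u :=
      hτ'.clm_apply (differentiableAt_const y)
    have hFX := h.differentiableAt_partial hu X
    have hFy := h.differentiableAt_partial hu y
    have h1 := congrArg (fun L => L z) (fderiv_eq_of_eqOn (W := ℝ) h.isOpen hu
      fun x hx => h.fderiv_tau_eq hx hE hρ (hw x hx) y X)
    rw [fderiv_bilin B hp hFX, fderiv_fderiv_apply (h.differentiableAt_fderiv hu),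
      fderiv_fderiv_apply hτ'] at h1
    have hg := differentiableAt_bilin B hFy hFX
    have hty := differentiableAt_bilin B hFy hτ
    have htX := differentiableAt_bilin B hFX hτ
    rw [fderiv_fun_mul hψ (hg.fun_sub (hty.fun_mul htX)), fderiv_fun_sub hg (hty.fun_mul htX),
      fderiv_fun_mul hty htX] at h1
    simp only [add_apply, sub_apply, smul_apply, smul_eq_mul] at h1
    rw [h.fderiv_metric hu, h.fderiv_inner_T hu, h.fderiv_inner_T hu, hXT, hσ z X, hXT] at h1
    obtain ⟨γ, hγ⟩ := (h.frame u hu).second z X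
    have k2 : ∀ y, B (fderiv ℝ (fderiv ℝ F) u z X) (fderiv ℝ F u y)
        = B (fderiv ℝ F u γ) (fderiv ℝ F u y) := by
      intro y
      rw [hγ]
      simp only [map_add, map_sub, map_smul, add_apply,
        sub_apply, smul_apply, smul_eq_mul,
        (h.frame u hu).eta_normal, (h.frame u hu).zeta_normal]
      linear_combination -(B (fderiv ℝ F u z) (fderiv ℝ F u X)) * h.radial u hu y
    have k1 : B (fderiv ℝ (fun x => fderiv ℝ F x (T x)) u y) (fderiv ℝ (fderiv ℝ F) u z X)
        = umbilicity B T η ζ u * (B (fderiv ℝ F u γ) (fderiv ℝ F u y)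
          - B (fderiv ℝ F u y) (fderiv ℝ F u (T u)) * B (fderiv ℝ F u γ) (fderiv ℝ F u (T u)))
          + B (fderiv ℝ F u y) (fderiv ℝ F u (T u)) * B (fderiv ℝ F u z) (fderiv ℝ F u X)
            * (B (η u) (ζ u) + c) := by
      rw [hγ, hXT]
      simp only [map_add, map_sub, map_smul, smul_eq_mul]
      rw [hσ y γ, tnormal hζ (fun x hx => (h.frame x hx).zeta_normal)
        (fun x hx => (h.frame x hx).zeta_radial), h.symm (ζ u) (η u),
        h.symm (fderiv ℝ F u y) (fderiv ℝ F u γ)]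
      linear_combination -(B (fderiv ℝ F u z) (fderiv ℝ F u X)) * tradial y
    rw [k1, k2, k2] at h1
    linear_combination h1
  -- Second derivatives of `dF(T)` commute. Comparing the orders `(T, X)` and `(X, T)` computes the
  -- curvature of the plane of `T` and `X`; dividing by `|X|²` gives the Riccati equation.
  have h1 := key (T u) X
  have h2 := key X (T u)
  rw [fderiv_fderiv_symm h.isOpen hu h.smooth_tau (T u) X, h2, h.second_symm hu X,
    h.symm (fderiv ℝ F u (T u)) (fderiv ℝ F u X), hXT, (h.frame u hu).unit] at h1
  apply mul_left_cancel₀ hX.ne'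
  linear_combination -h1

end IsPrincipalFrame
end LocalRiccati

/-! ### Smoothness of the principal frame from pointwise data -/

section FrameSmoothness

open Filter Topology

variable {E A ι : Type*} [NormedAddCommGroup E] [NormedSpace ℝ E]
  [NormedAddCommGroup A] [NormedSpace ℝ A] [Fintype ι] [DecidableEq ι]

theorem contDiffOn_det {D : E → Matrix ι ι ℝ} {Ω : Set E}
    (h : ∀ i j, ContDiffOn ℝ ∞ (fun u => D u i j) Ω) :
    ContDiffOn ℝ ∞ (fun u => (D u).det) Ω := by
  simp only [Matrix.det_apply]
  exact ContDiffOn.sum fun σ _ => (contDiffOn_prod fun i _ => h (σ i) i).const_smul _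

/-- Cramer's rule: each entry of the inverse is a quotient of determinants. -/
theorem contDiffOn_inv_apply {D : E → Matrix ι ι ℝ} {Ω : Set E}
    (h : ∀ i j, ContDiffOn ℝ ∞ (fun u => D u i j) Ω) (hD : ∀ u ∈ Ω, (D u).det ≠ 0) (i j : ι) :
    ContDiffOn ℝ ∞ (fun u => (D u)⁻¹ i j) Ω := by
  have : (fun u => (D u)⁻¹ i j)
      = fun u => ((D u).det)⁻¹ * ((D u).updateRow j (Pi.single i 1)).det := by
    ext u
    rw [Matrix.inv_def, Matrix.smul_apply, Matrix.adjugate_apply, Ring.inverse_eq_inv', smul_eq_mul]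
  rw [this]
  refine ((contDiffOn_det h).inv hD).mul (contDiffOn_det fun k l => ?_)
  by_cases hk : k = j
  · subst hk
    simp only [Matrix.updateRow_self]
    exact contDiffOn_const
  · simp only [Matrix.updateRow_ne hk]
    exact h k l

/-- The matrix of the induced metric in the basis `e`. -/
noncomputable def gramMatrix (B : A →L[ℝ] A →L[ℝ] ℝ) (e : Module.Basis ι ℝ E) (F : E → A) (u : E) :
    Matrix ι ι ℝ :=
  Matrix.of fun i j => B (fderiv ℝ F u (e i)) (fderiv ℝ F u (e j))

/-- The part of `w` orthogonal to the image of the differential of `F`. -/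
noncomputable def removeTangent (B : A →L[ℝ] A →L[ℝ] ℝ) (e : Module.Basis ι ℝ E) (F : E → A)
    (u : E) (w : A) : A :=
  w - ∑ k, ∑ l, ((gramMatrix B e F u)⁻¹ k l * B w (fderiv ℝ F u (e k))) • fderiv ℝ F u (e l)

namespace IsLocalImmersion

variable {B : A →L[ℝ] A →L[ℝ] ℝ} {c : ℝ} {F : E → A} {Ω : Set E}
  (h : IsLocalImmersion B c F Ω) (e : Module.Basis ι ℝ E) {u : E} (hu : u ∈ Ω)

include h

theorem mono {Ω' : Set E} (hΩ : IsOpen Ω') (hs : Ω' ⊆ Ω) : IsLocalImmersion B c F Ω' :=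
  ⟨hΩ, h.smooth.mono hs, h.symm, fun u hu => h.pos u (hs hu), fun u hu => h.radial u (hs hu)⟩

omit [Fintype ι] [DecidableEq ι] in
theorem gramMatrix_symm (i j : ι) : gramMatrix B e F u i j = gramMatrix B e F u j i :=
  h.symm _ _

omit [Fintype ι] [DecidableEq ι] in
theorem smooth_gramMatrix (i j : ι) : ContDiffOn ℝ ∞ (fun x => gramMatrix B e F x i j) Ω :=
  contDiffOn_bilin B (h.smooth_fderiv.clm_apply contDiffOn_const)
    (h.smooth_fderiv.clm_apply contDiffOn_const)

include hu in
theorem det_gramMatrix_ne_zero : (gramMatrix B e F u).det ≠ 0 := by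
  intro hdet
  obtain ⟨x, hx, hGx⟩ := Matrix.exists_mulVec_eq_zero_iff.2 hdet
  set v : E := ∑ i, x i • e i with hv
  have hv0 : v ≠ 0 := by
    intro h0
    apply hx
    funext i
    exact Fintype.linearIndependent_iff.1 e.linearIndependent x (hv ▸ h0) i
  have hpos := h.pos u hu v hv0
  have : B (fderiv ℝ F u v) (fderiv ℝ F u v) = ∑ i, x i * (gramMatrix B e F u *ᵥ x) i := by
    rw [hv]
    simp only [map_sum, map_smul, sum_apply, smul_apply,
      smul_eq_mul, Matrix.mulVec, dotProduct, gramMatrix, Matrix.of_apply, Finset.mul_sum]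
    rw [Finset.sum_comm]
    exact Finset.sum_congr rfl fun i _ => Finset.sum_congr rfl fun j _ => by ring
  rw [this, hGx] at hpos
  simp at hpos

theorem smooth_gramMatrix_inv (i j : ι) :
    ContDiffOn ℝ ∞ (fun x => (gramMatrix B e F x)⁻¹ i j) Ω :=
  contDiffOn_inv_apply (h.smooth_gramMatrix e) (fun _ hx => h.det_gramMatrix_ne_zero e hx) i j

theorem smooth_removeTangent {w : E → A} (hw : ContDiffOn ℝ ∞ w Ω) :
    ContDiffOn ℝ ∞ (fun x => removeTangent B e F x (w x)) Ω :=
  hw.sub <| ContDiffOn.sum fun k _ => ContDiffOn.sum fun l _ =>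
    ((h.smooth_gramMatrix_inv e k l).mul
      (contDiffOn_bilin B hw (h.smooth_fderiv.clm_apply contDiffOn_const))).smul
    (h.smooth_fderiv.clm_apply contDiffOn_const)

include hu

/-- Raising an index: a tangent vector is recovered from its scalar products with the basis.
`contract` is the same identity after pairing. -/
theorem sharp (v : E) : ∑ k, ∑ l, ((gramMatrix B e F u)⁻¹ k l
    * B (fderiv ℝ F u v) (fderiv ℝ F u (e k))) • e l = v := by
  have hinv : gramMatrix B e F u * (gramMatrix B e F u)⁻¹ = 1 :=
    Matrix.mul_nonsing_inv _ (Ne.isUnit (h.det_gramMatrix_ne_zero e hu))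
  have hk : ∀ k, B (fderiv ℝ F u v) (fderiv ℝ F u (e k))
      = ∑ m, e.repr v m * gramMatrix B e F u m k := by
    intro k
    conv_lhs => rw [← e.sum_repr v]
    simp only [map_sum, map_smul, sum_apply, smul_apply, smul_eq_mul, gramMatrix, Matrix.of_apply]
  rw [Finset.sum_comm]
  conv_rhs => rw [← e.sum_repr v]
  refine Finset.sum_congr rfl fun l _ => ?_
  rw [← Finset.sum_smul]
  congr 1
  calc ∑ k, (gramMatrix B e F u)⁻¹ k l * B (fderiv ℝ F u v) (fderiv ℝ F u (e k))
      = ∑ m, e.repr v m * ∑ k, gramMatrix B e F u m k * (gramMatrix B e F u)⁻¹ k l := by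
        simp only [hk, Finset.mul_sum]
        rw [Finset.sum_comm]
        exact Finset.sum_congr rfl fun i _ => Finset.sum_congr rfl fun j _ => by ring
    _ = ∑ m, e.repr v m * (1 : Matrix ι ι ℝ) m l := by
        simp only [← hinv, Matrix.mul_apply]
    _ = e.repr v l := by simp [Matrix.one_apply]

theorem contract (v w : E) : ∑ k, ∑ l, (gramMatrix B e F u)⁻¹ k l
    * (B (fderiv ℝ F u v) (fderiv ℝ F u (e k)) * B (fderiv ℝ F u (e l)) (fderiv ℝ F u w))
    = B (fderiv ℝ F u v) (fderiv ℝ F u w) := by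
  conv_rhs => rw [← h.sharp e hu v]
  simp only [map_sum, map_smul, sum_apply, smul_apply, smul_eq_mul, mul_assoc]

theorem trace_gramMatrix : ∑ k, ∑ l, (gramMatrix B e F u)⁻¹ k l * gramMatrix B e F u k l
    = Fintype.card ι := by
  have hinv : (gramMatrix B e F u)⁻¹ * gramMatrix B e F u = 1 :=
    Matrix.nonsing_inv_mul _ (Ne.isUnit (h.det_gramMatrix_ne_zero e hu))
  calc _ = ((gramMatrix B e F u)⁻¹ * gramMatrix B e F u).trace := by
        simp only [Matrix.trace, Matrix.diag, Matrix.mul_apply]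
        exact Finset.sum_congr rfl fun k _ => Finset.sum_congr rfl fun l _ => by
          rw [h.gramMatrix_symm e k l]
    _ = _ := by rw [hinv, Matrix.trace_one]

theorem removeTangent_eq {w ξ : A} {v : E} (hξ : ∀ v, B ξ (fderiv ℝ F u v) = 0)
    (hw : w = fderiv ℝ F u v + ξ) : removeTangent B e F u w = ξ := by
  have h1 : ∀ k, B w (fderiv ℝ F u (e k)) = B (fderiv ℝ F u v) (fderiv ℝ F u (e k)) := by
    intro k; rw [hw, map_add, add_apply, hξ, add_zero]
  have h2 := congrArg (fderiv ℝ F u) (h.sharp e hu v)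
  simp only [map_sum, map_smul] at h2
  simp only [removeTangent, h1]
  rw [h2, hw, add_sub_cancel_left]

/-- The second fundamental form, in terms of a principal frame. -/
theorem removeTangent_second {T : E} {η ζ : A} (hf : IsPrincipalFrameAt B c F u T η ζ) (v w : E) :
    removeTangent B e F u (fderiv ℝ (fderiv ℝ F) u v w)
      + (c * B (fderiv ℝ F u v) (fderiv ℝ F u w)) • F u
    = B (fderiv ℝ F u v) (fderiv ℝ F u w) • ζ
      + (B (fderiv ℝ F u v) (fderiv ℝ F u T) * B (fderiv ℝ F u w) (fderiv ℝ F u T)) • (η - ζ) := by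
  obtain ⟨γ, hγ⟩ := hf.second v w
  rw [h.removeTangent_eq e hu (v := γ) (ξ := B (fderiv ℝ F u v) (fderiv ℝ F u w) • ζ
      + (B (fderiv ℝ F u v) (fderiv ℝ F u T) * B (fderiv ℝ F u w) (fderiv ℝ F u T)) • (η - ζ)
      - (c * B (fderiv ℝ F u v) (fderiv ℝ F u w)) • F u) ?_ ?_]
  · abel
  · intro y
    simp only [map_add, map_sub, map_smul, add_apply, sub_apply, smul_apply, smul_eq_mul,
      hf.eta_normal, hf.zeta_normal]
    linear_combination -(B (fderiv ℝ F u v) (fderiv ℝ F u w)) * h.radial u hu y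
  · rw [hγ]; abel

end IsLocalImmersion

theorem IsPrincipalFrameAt.smul_T {B : A →L[ℝ] A →L[ℝ] ℝ} {c : ℝ} {F : E → A} {u T : E} {η ζ : A}
    (h : IsPrincipalFrameAt B c F u T η ζ) {s : ℝ} (hs : s * s = 1) :
    IsPrincipalFrameAt B c F u (s • T) η ζ where
  unit := by
    simp only [map_smul, smul_apply, smul_eq_mul, h.unit]
    linear_combination hs
  eta_normal := h.eta_normal
  zeta_normal := h.zeta_normal
  eta_radial := h.eta_radial
  zeta_radial := h.zeta_radial
  diff_pos := h.diff_pos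
  second v w := by
    obtain ⟨γ, hγ⟩ := h.second v w
    refine ⟨γ, ?_⟩
    rw [hγ]
    congr 3
    simp only [map_smul, smul_eq_mul]
    linear_combination
      -(B (fderiv ℝ F u v) (fderiv ℝ F u T) * B (fderiv ℝ F u w) (fderiv ℝ F u T)) * hs

/-- The dyad `⟨v, T⟩ ⟨w, T⟩` is smooth. -/
theorem IsLocalImmersion.smooth_dyad {B : A →L[ℝ] A →L[ℝ] ℝ} {c : ℝ} {F : E → A} {Ω : Set E}
    (h : IsLocalImmersion B c F Ω) (e : Module.Basis ι ℝ E) (hι : 3 ≤ Fintype.card ι)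
    {T : E → E} {η ζ : E → A}
    (hf : ∀ u ∈ Ω, IsPrincipalFrameAt B c F u (T u) (η u) (ζ u)) :
    (∀ i j, ContDiffOn ℝ ∞ (fun u => B (fderiv ℝ F u (e i)) (fderiv ℝ F u (T u))
        * B (fderiv ℝ F u (e j)) (fderiv ℝ F u (T u))) Ω) ∧
    ContDiffOn ℝ ∞ (fun u => (Fintype.card ι : ℝ) • ζ u + (η u - ζ u)) Ω := by
  set N : ℝ := (Fintype.card ι : ℝ) with hN
  have hN3 : (3 : ℝ) ≤ N := by rw [hN]; exact_mod_cast hι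
  let G := gramMatrix B e F
  let t : E → ι → ℝ := fun u i => B (fderiv ℝ F u (e i)) (fderiv ℝ F u (T u))
  -- The second fundamental form is smooth because this expression involves only `F` and its
  -- derivatives; everything below extracts the dyad from it algebraically.
  let α : E → ι → ι → A := fun u i j =>
    removeTangent B e F u (fderiv ℝ (fderiv ℝ F) u (e i) (e j)) + (c * G u i j) • F u
  have hα : ∀ u ∈ Ω, ∀ i j, α u i j = G u i j • ζ u + (t u i * t u j) • (η u - ζ u) :=
    fun u hu i j => h.removeTangent_second e hu (hf u hu) (e i) (e j)
  have hαs : ∀ i j, ContDiffOn ℝ ∞ (fun u => α u i j) Ω := fun i j =>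
    (h.smooth_removeTangent e ((h.smooth_second.clm_apply contDiffOn_const).clm_apply
      contDiffOn_const)).add ((contDiffOn_const.mul (h.smooth_gramMatrix e i j)).smul h.smooth)
  have hGs := h.smooth_gramMatrix e
  have hIs := h.smooth_gramMatrix_inv e
  have ctt : ∀ u ∈ Ω, ∑ k, ∑ l, (G u)⁻¹ k l * (t u k * t u l) = 1 := by
    intro u hu
    rw [← (hf u hu).unit, ← h.contract e hu (T u) (T u)]
    simp only [t, h.symm (fderiv ℝ F u (T u)) (fderiv ℝ F u (e _)), G]
  have ctG : ∀ u ∈ Ω, ∀ i, ∑ k, ∑ l, (G u)⁻¹ k l * (t u k * G u l i) = t u i := by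
    intro u hu i
    rw [show t u i = B (fderiv ℝ F u (T u)) (fderiv ℝ F u (e i)) from h.symm _ _,
      ← h.contract e hu (T u) (e i)]
    simp only [t, h.symm (fderiv ℝ F u (T u)) (fderiv ℝ F u (e _)), G, gramMatrix, Matrix.of_apply]
  have cGt : ∀ u ∈ Ω, ∀ i, ∑ k, ∑ l, (G u)⁻¹ k l * (G u i k * t u l) = t u i :=
    fun u hu i => h.contract e hu (e i) (T u)
  have cGG : ∀ u ∈ Ω, ∀ i j, ∑ k, ∑ l, (G u)⁻¹ k l * (G u i k * G u l j) = G u i j :=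
    fun u hu i j => h.contract e hu (e i) (e j)
  have cG : ∀ u ∈ Ω, ∑ k, ∑ l, (G u)⁻¹ k l * G u k l = N := fun u hu => h.trace_gramMatrix e hu
  let H : E → A := fun u => ∑ k, ∑ l, (G u)⁻¹ k l • α u k l
  have hH : ∀ u ∈ Ω, H u = N • ζ u + (η u - ζ u) := by
    intro u hu
    simp only [H, hα u hu, smul_add, smul_smul, Finset.sum_add_distrib, ← Finset.sum_smul]
    rw [cG u hu, ctt u hu, one_smul]
  have hHs : ContDiffOn ℝ ∞ H Ω :=
    ContDiffOn.sum fun k _ => ContDiffOn.sum fun l _ => (hIs k l).smul (hαs k l)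
  refine ⟨?_, hHs.congr fun u hu => (hH u hu).symm⟩
  -- The trace-free part is a multiple of the single vector `η - ζ`.
  let β : E → ι → ι → A := fun u i j => α u i j - (G u i j / N) • H u
  have hβs : ∀ i j, ContDiffOn ℝ ∞ (fun u => β u i j) Ω := fun i j =>
    (hαs i j).sub (((hGs i j).div_const N).smul hHs)
  have hβ : ∀ u ∈ Ω, ∀ i j, β u i j = (t u i * t u j - G u i j / N) • (η u - ζ u) := by
    intro u hu i j
    simp only [β, hα u hu, hH u hu, smul_add, smul_smul, sub_smul]
    rw [div_mul_cancel₀ _ (by positivity)]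
    abel
  -- Contracting `β` with itself removes the unknown direction of `η - ζ`; the trace `D` below
  -- supplies its squared length.
  let Q : E → ι → ι → ℝ := fun u i j => ∑ k, ∑ l, (G u)⁻¹ k l * B (β u i k) (β u l j)
  have hQs : ∀ i j, ContDiffOn ℝ ∞ (fun u => Q u i j) Ω := fun i j =>
    ContDiffOn.sum fun k _ => ContDiffOn.sum fun l _ =>
      (hIs k l).mul (contDiffOn_bilin B (hβs i k) (hβs l j))
  have hQ : ∀ u ∈ Ω, ∀ i j, Q u i j
      = ((1 - 2 / N) * (t u i * t u j) + G u i j / N ^ 2) * B (η u - ζ u) (η u - ζ u) := by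
    intro u hu i j
    have : Q u i j = (t u i * t u j * ∑ k, ∑ l, (G u)⁻¹ k l * (t u k * t u l)
        - t u i / N * ∑ k, ∑ l, (G u)⁻¹ k l * (t u k * G u l j)
        - t u j / N * ∑ k, ∑ l, (G u)⁻¹ k l * (G u i k * t u l)
        + 1 / N ^ 2 * ∑ k, ∑ l, (G u)⁻¹ k l * (G u i k * G u l j))
        * B (η u - ζ u) (η u - ζ u) := by
      simp only [Q, hβ u hu, map_smul, smul_apply, smul_eq_mul, Finset.mul_sum, Finset.sum_mul,
        ← Finset.sum_sub_distrib, ← Finset.sum_add_distrib]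
      refine Finset.sum_congr rfl fun k _ => Finset.sum_congr rfl fun l _ => ?_
      field_simp
      ring
    rw [this, ctt u hu, ctG u hu, cGt u hu, cGG u hu]
    field_simp
    ring
  let D : E → ℝ := fun u => ∑ k, ∑ l, (G u)⁻¹ k l * Q u k l
  have hDs : ContDiffOn ℝ ∞ D Ω :=
    ContDiffOn.sum fun k _ => ContDiffOn.sum fun l _ => (hIs k l).mul (hQs k l)
  have hD : ∀ u ∈ Ω, D u = (1 - 1 / N) * B (η u - ζ u) (η u - ζ u) := by
    intro u hu
    have : D u = ((1 - 2 / N) * ∑ k, ∑ l, (G u)⁻¹ k l * (t u k * t u l)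
        + 1 / N ^ 2 * ∑ k, ∑ l, (G u)⁻¹ k l * G u k l) * B (η u - ζ u) (η u - ζ u) := by
      simp only [D, hQ u hu, Finset.mul_sum, Finset.sum_mul, ← Finset.sum_add_distrib]
      refine Finset.sum_congr rfl fun k _ => Finset.sum_congr rfl fun l _ => ?_
      ring
    rw [this, ctt u hu, cG u hu]
    field_simp
    ring
  intro i j
  have hN1 : 0 < 1 - 1 / N := by
    rw [sub_pos, div_lt_one (by linarith)]; linarith
  have hN2 : 0 < 1 - 2 / N := by
    rw [sub_pos, div_lt_one (by linarith)]; linarith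
  -- Solve the formula for `Q` for the dyad. Its coefficient `1 - 2/N` is nonzero because `N ≥ 3`.
  have hP : ContDiffOn ℝ ∞
      (fun u => (Q u i j * (1 - 1 / N) / D u - G u i j / N ^ 2) / (1 - 2 / N)) Ω :=
    ((((hQs i j).mul contDiffOn_const).div hDs fun u hu => by
      rw [hD u hu]; exact (mul_pos hN1 (hf u hu).diff_pos).ne').sub
      ((hGs i j).div_const _)).div_const _
  refine hP.congr fun u hu => ?_
  have hp := (hf u hu).diff_pos
  rw [hQ u hu, hD u hu]
  rw [eq_div_iff hN2.ne', eq_sub_iff_add_eq, eq_div_iff (mul_pos hN1 hp).ne']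
  ring

/-- Near each point a pointwise principal frame can be made smooth by changing the sign of `T`. -/
theorem IsLocalImmersion.exists_frame {B : A →L[ℝ] A →L[ℝ] ℝ} {c : ℝ} {F : E → A} {Ω : Set E}
    (h : IsLocalImmersion B c F Ω) (e : Module.Basis ι ℝ E) (hι : 3 ≤ Fintype.card ι)
    {T : E → E} {η ζ : E → A}
    (hf : ∀ u ∈ Ω, IsPrincipalFrameAt B c F u (T u) (η u) (ζ u)) {u₀ : E} (hu₀ : u₀ ∈ Ω) :
    ∃ (Ω' : Set E) (T' : E → E), u₀ ∈ Ω' ∧ Ω' ⊆ Ω ∧ IsPrincipalFrame B c F Ω' T' η ζ ∧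
      ∀ u ∈ Ω', T' u = T u ∨ T' u = -T u := by
  obtain ⟨hP, hH⟩ := h.smooth_dyad e hι hf
  -- A basis vector with `⟨e_m, T⟩ ≠ 0` at `u₀` fixes the sign of `T` nearby.
  obtain ⟨m, hm⟩ : ∃ m, B (fderiv ℝ F u₀ (e m)) (fderiv ℝ F u₀ (T u₀)) ≠ 0 := by
    by_contra! hcon
    have h1 := (hf u₀ hu₀).unit
    have h2 := h.contract e hu₀ (T u₀) (T u₀)
    simp only [hcon, mul_zero, Finset.sum_const_zero] at h2
    linarith
  set tm : E → ℝ := fun u => B (fderiv ℝ F u (e m)) (fderiv ℝ F u (T u)) with htm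
  set Ω' : Set E := Ω ∩ (fun u => tm u * tm u) ⁻¹' {0}ᶜ with hΩ'
  have hop : IsOpen Ω' :=
    (hP m m).continuousOn.isOpen_inter_preimage h.isOpen isOpen_compl_singleton
  have hsub : Ω' ⊆ Ω := Set.inter_subset_left
  have h' := h.mono hop hsub
  -- This is `sign⟨e_m, T⟩ T`, written with the products `⟨e_k, T⟩⟨e_m, T⟩` alone, which are known
  -- to be smooth.
  let T' : E → E := fun u => ∑ k, ∑ l, ((gramMatrix B e F u)⁻¹ k l *
    (B (fderiv ℝ F u (e k)) (fderiv ℝ F u (T u)) * tm u / √(tm u * tm u))) • e l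
  have htm0 : ∀ u ∈ Ω', tm u ≠ 0 := fun u hu h0 => hu.2 (by simp [h0])
  have hT' : ∀ u ∈ Ω', T' u = (tm u / √(tm u * tm u)) • T u := by
    intro u hu
    conv_rhs => rw [← h.sharp e hu.1 (T u)]
    simp only [T', Finset.smul_sum, smul_smul]
    refine Finset.sum_congr rfl fun k _ => Finset.sum_congr rfl fun l _ => ?_
    rw [h.symm (fderiv ℝ F u (T u))]
    congr 1
    ring
  have hs : ∀ u ∈ Ω', (tm u / √(tm u * tm u)) * (tm u / √(tm u * tm u)) = 1 := by
    intro u hu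
    have := htm0 u hu
    rw [div_mul_div_comm, Real.mul_self_sqrt (mul_self_nonneg _), div_self (mul_self_ne_zero.2 this)]
  have hT's : ContDiffOn ℝ ∞ T' Ω' := by
    refine ContDiffOn.sum fun k _ => ContDiffOn.sum fun l _ => ContDiffOn.smul ?_ contDiffOn_const
    refine ((h.smooth_gramMatrix_inv e k l).mono hsub).mul (((hP k m).mono hsub).div
      (((hP m m).mono hsub).sqrt fun u hu => hu.2) fun u hu => ?_)
    exact (Real.sqrt_pos.2 (mul_self_pos.2 (htm0 u hu))).ne'
  have hframe : ∀ u ∈ Ω', IsPrincipalFrameAt B c F u (T' u) (η u) (ζ u) := by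
    intro u hu
    rw [hT' u hu]
    exact (hf u hu.1).smul_T (hs u hu)
  -- `η = α(T', T')`; afterwards `ζ` is obtained from the trace `Nζ + (η - ζ)` as `(trace - η) / (N
  -- - 1)`.
  have hηs : ContDiffOn ℝ ∞ η Ω' := by
    have : ContDiffOn ℝ ∞ (fun u => removeTangent B e F u (fderiv ℝ (fderiv ℝ F) u (T' u) (T' u))
        + (c * B (fderiv ℝ F u (T' u)) (fderiv ℝ F u (T' u))) • F u) Ω' :=
      (h'.smooth_removeTangent e ((h'.smooth_second.clm_apply hT's).clm_apply hT's)).add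
        ((contDiffOn_const.mul (contDiffOn_bilin B (h'.smooth_fderiv.clm_apply hT's)
          (h'.smooth_fderiv.clm_apply hT's))).smul h'.smooth)
    refine this.congr fun u hu => ?_
    rw [h'.removeTangent_second e hu (hframe u hu), (hframe u hu).unit]
    simp
  refine ⟨Ω', T', ⟨hu₀, ?_⟩, hsub, ⟨h', hT's, hηs, ?_, hframe⟩, ?_⟩
  · simpa using hm
  · have hN : (0 : ℝ) < Fintype.card ι - 1 := by
      have : (3 : ℝ) ≤ Fintype.card ι := by exact_mod_cast hι
      linarith
    refine (((hH.mono hsub).sub hηs).const_smul ((Fintype.card ι : ℝ) - 1)⁻¹).congr fun u hu => ?_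
    rw [eq_inv_smul_iff₀ hN.ne', sub_smul, one_smul]
    abel
  · intro u hu
    rw [hT' u hu]
    rcases mul_self_eq_one_iff.1 (hs u hu) with h1 | h1 <;> rw [h1]
    · left; simp
    · right; simp

end FrameSmoothness

/-! ### The Gauss equation and the scalar curvature -/

section GaussEquation

open Filter Topology

theorem partialD_congr {n : ℕ} {W : Type*} [NormedAddCommGroup W] [NormedSpace ℝ W]
    {p q : Coord n → W} {u : Coord n} (h : p =ᶠ[𝓝 u] q) (i : Fin n) :
    partialD i p u = partialD i q u := by
  rw [partialD, partialD, h.fderiv_eq]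

theorem christoffel_congr {n : ℕ} {G G' : Coord n → Matrix (Fin n) (Fin n) ℝ} {u : Coord n}
    (h : G =ᶠ[𝓝 u] G') (k i j : Fin n) : christoffel G k i j =ᶠ[𝓝 u] christoffel G' k i j := by
  filter_upwards [h.eventuallyEq_nhds] with x hx
  have h1 : ∀ i j l, partialD i (fun p => G p j l) x = partialD i (fun p => G' p j l) x :=
    fun i j l => partialD_congr (hx.mono fun y hy => by rw [hy]) i
  simp only [christoffel, hx.eq_of_nhds, h1]

/-- The Riemannian metric and the induced Gram matrix are only known to agree inside a chart, so
locality of the curvature is needed. -/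
theorem scalarCoord_congr {n : ℕ} {G G' : Coord n → Matrix (Fin n) (Fin n) ℝ} {u : Coord n}
    (h : G =ᶠ[𝓝 u] G') : scalarCoord G u = scalarCoord G' u := by
  have h1 : ∀ m k i j, partialD m (christoffel G k i j) u = partialD m (christoffel G' k i j) u :=
    fun m k i j => partialD_congr (christoffel_congr h k i j) m
  have h2 : ∀ k i j, christoffel G k i j u = christoffel G' k i j u :=
    fun k i j => (christoffel_congr h k i j).eq_of_nhds
  simp only [scalarCoord, ricciCoeff, riemannCoeff, h1, h2, h.eq_of_nhds]

variable {n : ℕ} {A : Type*} [NormedAddCommGroup A] [NormedSpace ℝ A]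

/-- The standard basis of `Coord n`. -/
noncomputable abbrev coordBasis (n : ℕ) : Module.Basis (Fin n) ℝ (Coord n) :=
  (EuclideanSpace.basisFun (Fin n) ℝ).toBasis

theorem partialD_eq {W : Type*} [NormedAddCommGroup W] [NormedSpace ℝ W] (i : Fin n)
    (p : Coord n → W) (u : Coord n) : partialD i p u = fderiv ℝ p u (coordBasis n i) := by
  simp [partialD]

namespace IsLocalImmersion

variable {B : A →L[ℝ] A →L[ℝ] ℝ} {c : ℝ} {F : Coord n → A} {Ω : Set (Coord n)}
  (h : IsLocalImmersion B c F Ω) {u : Coord n} (hu : u ∈ Ω)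

include h

theorem smooth_inner_second (v w z : Coord n) :
    ContDiffOn ℝ ∞ (fun x => B (fderiv ℝ (fderiv ℝ F) x v w) (fderiv ℝ F x z)) Ω :=
  contDiffOn_bilin B ((h.smooth_second.clm_apply contDiffOn_const).clm_apply contDiffOn_const)
    (h.smooth_fderiv.clm_apply contDiffOn_const)

include hu

/-- In the Koszul combination of derivatives of the induced metric, all terms except two copies of
`⟨D²F(e_i, e_j), F_l⟩` cancel by symmetry of `D²F`. -/
theorem christoffel_eq (k i j : Fin n) :
    christoffel (gramMatrix B (coordBasis n) F) k i j u
      = ∑ l, (gramMatrix B (coordBasis n) F u)⁻¹ k l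
        * B (fderiv ℝ (fderiv ℝ F) u (coordBasis n i) (coordBasis n j))
          (fderiv ℝ F u (coordBasis n l)) := by
  have hp : ∀ i j l, partialD i (fun p => gramMatrix B (coordBasis n) F p j l) u
      = B (fderiv ℝ (fderiv ℝ F) u (coordBasis n i) (coordBasis n j))
          (fderiv ℝ F u (coordBasis n l))
        + B (fderiv ℝ (fderiv ℝ F) u (coordBasis n i) (coordBasis n l))
          (fderiv ℝ F u (coordBasis n j)) := by
    intro i j l
    rw [partialD_eq, ← h.fderiv_metric hu]
    rfl
  rw [christoffel, Finset.mul_sum]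
  refine Finset.sum_congr rfl fun l _ => ?_
  rw [hp, hp, hp, h.second_symm hu (coordBasis n j) (coordBasis n i),
    h.second_symm hu (coordBasis n l) (coordBasis n i),
    h.second_symm hu (coordBasis n l) (coordBasis n j)]
  ring

theorem sum_christoffel_mul (i j p : Fin n) :
    ∑ k, christoffel (gramMatrix B (coordBasis n) F) k i j u
        * gramMatrix B (coordBasis n) F u k p
      = B (fderiv ℝ (fderiv ℝ F) u (coordBasis n i) (coordBasis n j))
          (fderiv ℝ F u (coordBasis n p)) := by
  set G := gramMatrix B (coordBasis n) F u with hG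
  have hinv : G * G⁻¹ = 1 :=
    Matrix.mul_nonsing_inv _ (Ne.isUnit (h.det_gramMatrix_ne_zero (coordBasis n) hu))
  have hs : ∀ k, G k p = G p k := fun k => h.gramMatrix_symm _ _ _
  calc _ = ∑ l, (G * G⁻¹) p l * B (fderiv ℝ (fderiv ℝ F) u (coordBasis n i) (coordBasis n j))
          (fderiv ℝ F u (coordBasis n l)) := by
        simp only [h.christoffel_eq hu, Finset.sum_mul, Matrix.mul_apply, hs, ← hG]
        rw [Finset.sum_comm]
        exact Finset.sum_congr rfl fun l _ => Finset.sum_congr rfl fun k _ => by ring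
    _ = _ := by simp [hinv, Matrix.one_apply]

omit hu in
theorem smooth_christoffel (k i j : Fin n) :
    ContDiffOn ℝ ∞ (christoffel (gramMatrix B (coordBasis n) F) k i j) Ω :=
  (ContDiffOn.sum fun l _ => (h.smooth_gramMatrix_inv (coordBasis n) k l).mul
    (h.smooth_inner_second (coordBasis n i) (coordBasis n j) (coordBasis n l))).congr
    fun _ hx => h.christoffel_eq hx k i j

variable {T : Coord n} {η ζ : A} (hf : IsPrincipalFrameAt B c F u T η ζ)

include hf

/-- The Gauss equation. -/
theorem gauss (i j m p : Fin n) :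
    let e := coordBasis n
    let G := gramMatrix B (coordBasis n) F u
    let t := fun i => B (fderiv ℝ F u (e i)) (fderiv ℝ F u T)
    ∑ k, riemannCoeff (gramMatrix B (coordBasis n) F) k j m i u * G k p
      = (B ζ ζ + c) * (G i j * G m p - G m j * G i p)
        + (B η ζ - B ζ ζ) * (G i j * (t m * t p) + t i * t j * G m p
          - G m j * (t i * t p) - t m * t j * G i p) := by
  intro e G t
  have hGe : ∀ x i j, gramMatrix B (coordBasis n) F x i j
    = B (fderiv ℝ F x (e i)) (fderiv ℝ F x (e j)) := fun _ _ _ => rfl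
  -- The tangential part of `D³F` is expressed by derivatives and products of Christoffel symbols,
  -- up to the pairing of the non-tangential parts of `D²F`.
  have key : ∀ m i, B (fderiv ℝ (fderiv ℝ (fderiv ℝ F)) u (e m) (e i) (e j)) (fderiv ℝ F u (e p))
      = ∑ k, partialD m (christoffel (gramMatrix B (coordBasis n) F) k i j) u * G k p
        + ∑ k, christoffel (gramMatrix B (coordBasis n) F) k i j u
          * B (fderiv ℝ (fderiv ℝ F) u (e m) (e k)) (fderiv ℝ F u (e p))
        - ((B ζ ζ + c) * (G i j * G m p) + (B η ζ - B ζ ζ) * (G i j * (t m * t p)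
          + t i * t j * G m p) + t i * t j * t m * t p * B (η - ζ) (η - ζ)) := by
    intro m i
    have hS := h.smooth_second.differentiableAt_of_isOpen h.isOpen hu
    have hS1 : DifferentiableAt ℝ (fun x => fderiv ℝ (fderiv ℝ F) x (e i) (e j)) u :=
      (hS.clm_apply (differentiableAt_const _)).clm_apply (differentiableAt_const _)
    have h3 : fderiv ℝ (fun x => fderiv ℝ (fderiv ℝ F) x (e i) (e j)) u (e m)
        = fderiv ℝ (fderiv ℝ (fderiv ℝ F)) u (e m) (e i) (e j) := by
      rw [fderiv_clm_apply (hS.clm_apply (differentiableAt_const _)) (differentiableAt_const _),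
        fderiv_clm_apply hS (differentiableAt_const _)]
      simp
    have hΓ : ∀ k, DifferentiableAt ℝ (christoffel (gramMatrix B (coordBasis n) F) k i j) u :=
      fun k => (h.smooth_christoffel k i j).differentiableAt_of_isOpen h.isOpen hu
    have hG : ∀ k, DifferentiableAt ℝ (fun x => gramMatrix B (coordBasis n) F x k p) u :=
      fun k => (h.smooth_gramMatrix (coordBasis n) k p).differentiableAt_of_isOpen h.isOpen hu
    have h1 := congrArg (fun L => L (e m)) (fderiv_eq_of_eqOn (W := ℝ) h.isOpen hu
      (q := fun x => B (fderiv ℝ (fderiv ℝ F) x (e i) (e j)) (fderiv ℝ F x (e p)))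
      fun x hx => h.sum_christoffel_mul hx i j p)
    have hmet : ∀ k, fderiv ℝ (fun x => gramMatrix B (coordBasis n) F x k p) u (e m)
        = B (fderiv ℝ (fderiv ℝ F) u (e m) (e k)) (fderiv ℝ F u (e p))
          + B (fderiv ℝ (fderiv ℝ F) u (e m) (e p)) (fderiv ℝ F u (e k)) :=
      fun k => h.fderiv_metric hu (e k) (e p) (e m)
    rw [fderiv_fun_sum fun k _ => (hΓ k).fun_mul (hG k)] at h1
    simp only [sum_apply, fun k => fderiv_fun_mul (hΓ k) (hG k), add_apply, smul_apply,
      smul_eq_mul, hmet, fderiv_bilin B hS1 (h.differentiableAt_partial hu (e p)), h3,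
      fderiv_fderiv_apply (h.differentiableAt_fderiv hu)] at h1
    obtain ⟨γ, hγ⟩ := hf.second (e i) (e j)
    have hL : ∀ q, B (fderiv ℝ (fderiv ℝ F) u (e i) (e j)) (fderiv ℝ F u q)
        = B (fderiv ℝ F u γ) (fderiv ℝ F u q) := by
      intro q
      rw [hγ]
      simp only [map_add, map_sub, map_smul, add_apply, sub_apply, smul_apply, smul_eq_mul,
        hf.eta_normal, hf.zeta_normal]
      linear_combination -(B (fderiv ℝ F u (e i)) (fderiv ℝ F u (e j))) * h.radial u hu q
    have hinvs : ∀ k l, (gramMatrix B (coordBasis n) F u)⁻¹ k l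
        = (gramMatrix B (coordBasis n) F u)⁻¹ l k := by
      intro k l
      have : (gramMatrix B (coordBasis n) F u).IsSymm :=
        Matrix.IsSymm.ext fun i j => h.gramMatrix_symm _ _ _
      exact (this.inv.apply k l).symm
    have hΓγ : ∑ k, christoffel (gramMatrix B (coordBasis n) F) k i j u • e k = γ := by
      conv_rhs => rw [← h.sharp (coordBasis n) hu γ]
      rw [Finset.sum_comm]
      refine Finset.sum_congr rfl fun k _ => ?_
      rw [h.christoffel_eq hu, Finset.sum_smul]
      refine Finset.sum_congr rfl fun l _ => ?_
      rw [hinvs k l, hL]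
    -- Split `⟨D²F, D²F⟩` into tangential, normal and radial contributions; the radial one gives
    -- `c`.
    have hSS : B (fderiv ℝ (fderiv ℝ F) u (e i) (e j)) (fderiv ℝ (fderiv ℝ F) u (e m) (e p))
        = ∑ k, christoffel (gramMatrix B (coordBasis n) F) k i j u
          * B (fderiv ℝ (fderiv ℝ F) u (e m) (e p)) (fderiv ℝ F u (e k))
        + ((B ζ ζ + c) * (G i j * G m p) + (B η ζ - B ζ ζ) * (G i j * (t m * t p)
          + t i * t j * G m p) + t i * t j * t m * t p * B (η - ζ) (η - ζ)) := by
      have h5 : ∑ k, christoffel (gramMatrix B (coordBasis n) F) k i j u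
          * B (fderiv ℝ (fderiv ℝ F) u (e m) (e p)) (fderiv ℝ F u (e k))
          = B (fderiv ℝ F u γ) (fderiv ℝ (fderiv ℝ F) u (e m) (e p)) := by
        rw [h.symm (fderiv ℝ F u γ), ← hΓγ]
        simp only [map_sum, map_smul, smul_eq_mul]
      have h6 := hf.second_bilin hf.zeta_normal hf.zeta_radial (e m) (e p)
      have h7 := hf.second_bilin hf.eta_normal hf.eta_radial (e m) (e p)
      rw [h5]
      conv_lhs => rw [hγ]
      simp only [map_add, map_sub, map_smul, add_apply, sub_apply, smul_apply, smul_eq_mul]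
      rw [h6, h7]
      simp only [map_sub, h.symm ζ η, G, t, hGe]
      linear_combination -(B (fderiv ℝ F u (e i)) (fderiv ℝ F u (e j)))
        * h.radial_second hu (e m) (e p)
    rw [hSS] at h1
    simp only [mul_add, Finset.sum_add_distrib, G, partialD_eq] at h1 ⊢
    rw [Finset.sum_congr rfl fun k _ => mul_comm (fderiv ℝ
      (christoffel (gramMatrix B (coordBasis n) F) k i j) u _) _]
    linear_combination -h1
  have hLG := fun m k => h.sum_christoffel_mul hu m k p
  have hcomm : ∀ m i, ∑ k, christoffel (gramMatrix B (coordBasis n) F) k i j u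
          * B (fderiv ℝ (fderiv ℝ F) u (e m) (e k)) (fderiv ℝ F u (e p))
      = ∑ k, (∑ q, christoffel (gramMatrix B (coordBasis n) F) k m q u
          * christoffel (gramMatrix B (coordBasis n) F) q i j u) * G k p := by
    intro m i
    simp only [e, ← hLG, Finset.mul_sum, Finset.sum_mul]
    rw [Finset.sum_comm]
    exact Finset.sum_congr rfl fun l _ => Finset.sum_congr rfl fun k _ => by ring
  -- Antisymmetrize in `m` and `i`: `D³F` drops out, as does the quartic term in `t`.
  have h1 := key m i
  have h2 := key i m
  rw [fderiv_fderiv_symm h.isOpen hu h.smooth_fderiv (e m) (e i), h2, hcomm, hcomm] at h1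
  simp only [riemannCoeff, Finset.sum_sub_distrib, add_mul, sub_mul, Finset.sum_add_distrib]
  linear_combination -h1

/-- The scalar curvature of the induced metric, in terms of the principal normals. -/
theorem scalarCoord_eq :
    scalarCoord (gramMatrix B (coordBasis n) F) u
      = n * (n - 1) * c + (n - 1) * (2 * B η ζ + (n - 2) * B ζ ζ) := by
  let e := coordBasis n
  let G := gramMatrix B (coordBasis n) F u
  let t := fun i => B (fderiv ℝ F u (e i)) (fderiv ℝ F u T)
  have hinv : G * G⁻¹ = 1 :=
    Matrix.mul_nonsing_inv _ (Ne.isUnit (h.det_gramMatrix_ne_zero (coordBasis n) hu))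
  have hGs : ∀ i j, G i j = G j i := fun i j => h.gramMatrix_symm _ _ _
  have hTe : ∀ i, B (fderiv ℝ F u T) (fderiv ℝ F u (coordBasis n i)) = t i := fun i => h.symm _ _
  have ctt : ∑ k, ∑ l, G⁻¹ k l * (t k * t l) = 1 := by
    have := h.contract e hu T T
    rw [hf.unit] at this
    simp only [e, hTe] at this
    exact this
  have cGt : ∀ i, ∑ k, ∑ l, G⁻¹ k l * (G i k * t l) = t i :=
    fun i => h.contract e hu (e i) T
  have ctG : ∀ i, ∑ k, ∑ l, G⁻¹ k l * (t k * G l i) = t i := by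
    intro i
    have := h.contract e hu T (e i)
    simp only [e, hTe] at this
    exact this
  have cGG : ∀ i j, ∑ k, ∑ l, G⁻¹ k l * (G i k * G l j) = G i j :=
    fun i j => h.contract e hu (e i) (e j)
  have cG : ∑ k, ∑ l, G⁻¹ k l * G k l = n := by
    rw [h.trace_gramMatrix e hu, Fintype.card_fin]
  -- Raise the last index in `gauss`, so that the Ricci and scalar traces reduce to the contractions
  -- above.
  have hriem : ∀ q j m i, riemannCoeff (gramMatrix B (coordBasis n) F) q j m i u
      = ∑ p, G⁻¹ p q * ((B ζ ζ + c) * (G i j * G m p - G m j * G i p)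
        + (B η ζ - B ζ ζ) * (G i j * (t m * t p) + t i * t j * G m p
          - G m j * (t i * t p) - t m * t j * G i p)) := by
    intro q j m i
    calc _ = ∑ k, riemannCoeff (gramMatrix B (coordBasis n) F) k j m i u * (G * G⁻¹) k q := by
          simp [hinv, Matrix.one_apply]
      _ = ∑ p, G⁻¹ p q * ∑ k, riemannCoeff (gramMatrix B (coordBasis n) F) k j m i u * G k p := by
          simp only [Matrix.mul_apply, Finset.mul_sum]
          rw [Finset.sum_comm]
          exact Finset.sum_congr rfl fun l _ => Finset.sum_congr rfl fun k _ => by ring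
      _ = _ := Finset.sum_congr rfl fun p _ => by rw [h.gauss hu hf i j m p]
  have hric : ∀ i j, ricciCoeff (gramMatrix B (coordBasis n) F) i j u
      = (B ζ ζ + c) * ((n - 1) * G i j)
        + (B η ζ - B ζ ζ) * (G i j + (n - 2) * (t i * t j)) := by
    intro i j
    have : ricciCoeff (gramMatrix B (coordBasis n) F) i j u
        = (B ζ ζ + c) * (G i j * ∑ p, ∑ m, G⁻¹ p m * G p m
            - ∑ p, ∑ m, G⁻¹ p m * (G i p * G m j))
          + (B η ζ - B ζ ζ) * (G i j * ∑ p, ∑ m, G⁻¹ p m * (t p * t m)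
            + t i * t j * ∑ p, ∑ m, G⁻¹ p m * G p m
            - t i * ∑ p, ∑ m, G⁻¹ p m * (t p * G m j)
            - t j * ∑ p, ∑ m, G⁻¹ p m * (G i p * t m)) := by
      simp only [ricciCoeff, hriem, Finset.mul_sum,
        ← Finset.sum_sub_distrib, ← Finset.sum_add_distrib]
      rw [Finset.sum_comm]
      refine Finset.sum_congr rfl fun p _ => Finset.sum_congr rfl fun m _ => ?_
      rw [hGs m p]
      ring
    rw [this, cG, cGG, ctt, ctG, cGt]
    ring
  have : scalarCoord (gramMatrix B (coordBasis n) F) u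
      = (B ζ ζ + c) * (n - 1) * (∑ p, ∑ m, G⁻¹ p m * G p m)
        + (B η ζ - B ζ ζ) * (∑ p, ∑ m, G⁻¹ p m * G p m
          + (n - 2) * ∑ p, ∑ m, G⁻¹ p m * (t p * t m)) := by
    simp only [scalarCoord, hric, Finset.mul_sum, ← Finset.sum_add_distrib]
    refine Finset.sum_congr rfl fun p _ => Finset.sum_congr rfl fun m _ => ?_
    ring
  rw [this, cG, ctt]
  ring

end IsLocalImmersion
end GaussEquation

/-! ### Ekeland's variational principle -/

section Ekeland

open Filter Topology

/-- Ekeland's variational principle. -/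
theorem exists_ekeland_point {X : Type*} [MetricSpace X] [CompleteSpace X] {S : Set X}
    (hS : IsClosed S) (hne : S.Nonempty) {H : X → ℝ} (hH : Continuous H) {m δ : ℝ}
    (hm : ∀ x ∈ S, m ≤ H x) (hδ : 0 < δ) :
    ∃ x ∈ S, ∀ y ∈ S, H y + δ * dist x y ≤ H x → y = x := by
  -- The relation `y ∈ D x` is a preorder by the triangle inequality; a point `x` with `D x = {x}`
  -- is sought.
  let D : X → Set X := fun x => {y | y ∈ S ∧ H y + δ * dist x y ≤ H x}
  have hDS : ∀ x, D x ⊆ S := fun x y hy => hy.1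
  have hself : ∀ x ∈ S, x ∈ D x := fun x hx => ⟨hx, by simp⟩
  have htrans : ∀ {x y z}, y ∈ D x → z ∈ D y → z ∈ D x := by
    intro x y z hy hz
    refine ⟨hz.1, ?_⟩
    have h1 := hy.2
    have h2 := hz.2
    have h3 := mul_le_mul_of_nonneg_left (dist_triangle x y z) hδ.le
    linarith
  have hbdd : ∀ x, BddBelow (H '' D x) := fun x => ⟨m, by
    rintro _ ⟨y, hy, rfl⟩; exact hm y hy.1⟩
  -- Choose a successor that covers at least half of the possible decrease of `H` on `D x`.
  have hnext : ∀ x : S, ∃ y : S, (y : X) ∈ D x ∧ H y ≤ (H x + sInf (H '' D x)) / 2 := by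
    intro x
    have hle : sInf (H '' D x) ≤ H x := csInf_le (hbdd x) ⟨x, hself x x.2, rfl⟩
    rcases hle.eq_or_lt with heq | hlt
    · exact ⟨x, hself x x.2, by rw [heq]; linarith⟩
    · obtain ⟨_, ⟨y, hy, rfl⟩, hy2⟩ := exists_lt_of_csInf_lt
        (⟨H x, x, hself x x.2, rfl⟩ : (H '' D x).Nonempty)
        (show sInf (H '' D x) < (H x + sInf (H '' D x)) / 2 by linarith)
      exact ⟨⟨y, hy.1⟩, hy, hy2.le⟩
  choose nx hnx1 hnx2 using hnext
  obtain ⟨x₀, hx₀⟩ := hne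
  obtain ⟨s, hs⟩ : ∃ s : ℕ → S, ∀ k, s (k + 1) = nx (s k) :=
    ⟨fun k => Nat.rec ⟨x₀, hx₀⟩ (fun _ x => nx x) k, fun _ => rfl⟩
  have hsD : ∀ k l : ℕ, k ≤ l → (s l : X) ∈ D (s k) := by
    intro k l hkl
    induction l, hkl using Nat.le_induction with
    | base => exact hself _ (s k).2
    | succ l _ ih => exact htrans ih (by rw [hs]; exact hnx1 (s l))
  have hanti : Antitone fun k => H (s k) := by
    intro k l hkl
    have := (hsD k l hkl).2
    have h2 : 0 ≤ δ * dist (s k : X) (s l) := mul_nonneg hδ.le dist_nonneg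
    show H (s l) ≤ H (s k)
    linarith
  have hbd : BddBelow (Set.range fun k => H (s k)) := ⟨m, by
    rintro _ ⟨k, rfl⟩; exact hm _ (s k).2⟩
  have hlim := tendsto_atTop_ciInf hanti hbd
  set L := ⨅ k, H (s k) with hL
  have hge : ∀ k, L ≤ H (s k) := fun k => ciInf_le hbd k
  have hcau : CauchySeq fun k => (s k : X) := by
    refine cauchySeq_of_le_tendsto_0' (fun k => (H (s k) - L) / δ) ?_ ?_
    · intro k l hkl
      have := (hsD k l hkl).2
      rw [le_div_iff₀ hδ]
      linarith [hge l]
    · have := (hlim.sub_const L).div_const δ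
      simpa using this
  obtain ⟨x, hx⟩ := cauchySeq_tendsto_of_complete hcau
  have hHx : H x = L := tendsto_nhds_unique ((hH.tendsto x).comp hx) hlim
  have hxS : x ∈ S := hS.mem_of_tendsto hx (Eventually.of_forall fun k => (s k).2)
  have hxD : ∀ k, x ∈ D (s k) := by
    intro k
    refine ⟨hxS, ?_⟩
    have ht : Tendsto (fun l => H (s l) + δ * dist (s k : X) (s l)) atTop
        (𝓝 (H x + δ * dist (s k : X) x)) :=
      ((hH.tendsto x).comp hx).add ((tendsto_const_nhds.dist hx).const_mul δ)
    exact le_of_tendsto ht ((eventually_ge_atTop k).mono fun l hl => (hsD k l hl).2)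
  refine ⟨x, hxS, fun y hy hyx => ?_⟩
  have hyD : ∀ k, y ∈ D (s k) := fun k => htrans (hxD k) ⟨hy, hyx⟩
  -- A point of every `D (s k)` has value at least `2 H(s (k+1)) - H(s k)`, by the halving rule. In
  -- the limit it is at least `L = H x`, which leaves no room for a positive distance.
  have h1 : ∀ k, 2 * H (s (k + 1)) - H (s k) ≤ H y := by
    intro k
    have h2 : sInf (H '' D (s k)) ≤ H y := csInf_le (hbdd _) ⟨y, hyD k, rfl⟩
    have h3 := hnx2 (s k)
    rw [← hs] at h3
    linarith
  have h4 : Tendsto (fun k => 2 * H (s (k + 1)) - H (s k)) atTop (𝓝 (2 * L - L)) :=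
    (((tendsto_add_atTop_iff_nat 1).2 hlim).const_mul 2).sub hlim
  have h5 : 2 * L - L ≤ H y := le_of_tendsto h4 (Eventually.of_forall h1)
  have h6 : dist x y ≤ 0 := by
    by_contra! hpos
    nlinarith
  exact (dist_le_zero.1 h6).symm

end Ekeland

/-! ### The scalar product on tangent spaces of the space forms -/

section Form

variable {m : ℕ}

theorem form_symm (c : ℝ) (p q : Ambient m) : form c p q = form c q p := by
  simp only [form, mul_comm]

/-- The scalar product of the ambient space as a continuous bilinear map. -/
noncomputable def formL (c : ℝ) (m : ℕ) : Ambient m →L[ℝ] Ambient m →L[ℝ] ℝ :=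
  (LinearMap.mk₂ ℝ (form c) (form_add_left c) (form_smul_left c)
    (fun p q r => by rw [form_symm, form_add_left, form_symm c q, form_symm c r])
    (fun a p q => by rw [form_symm, form_smul_left, form_symm c q, smul_eq_mul])
    ).toContinuousBilinearMap

@[simp] theorem formL_apply (c : ℝ) (p q : Ambient m) : formL c m p q = form c p q := rfl

theorem form_self_pos_of_nonneg {c : ℝ} (hc : 0 ≤ c) {ξ : Ambient m} (hξ : ξ ≠ 0) :
    0 < form c ξ ξ := by
  rw [form, if_neg hc.not_gt, one_mul, ← Fin.sum_univ_succ (fun i => ξ i * ξ i)]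
  obtain ⟨i, hi⟩ := Function.ne_iff.1 hξ
  exact Finset.sum_pos' (fun i _ => mul_self_nonneg _) ⟨i, Finset.mem_univ _, mul_self_pos.2 hi⟩

/-- The scalar product is positive definite on the tangent spaces of the space form. -/
theorem form_self_pos {c : ℝ} {p ξ : Ambient m} (hp : p ∈ SpaceForm c m) (ht : IsTangent c p ξ)
    (hξ : ξ ≠ 0) : 0 < form c ξ ξ := by
  rcases le_or_gt 0 c with hc | hc
  · exact form_self_pos_of_nonneg hc hξ
  simp only [SpaceForm, Set.mem_ofPred_eq, if_neg hc.ne, IsTangent] at hp ht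
  obtain ⟨hpp, hp0⟩ := hp
  have hp0 := hp0 hc
  simp only [form, if_pos hc] at hpp ht ⊢
  -- In Lorentz space a nonzero vector orthogonal to a timelike one is spacelike, by Cauchy-Schwarz
  -- for the spatial parts.
  have hcs := Finset.sum_mul_sq_le_sq_mul_sq Finset.univ (fun i : Fin m => p i.succ)
    (fun i => ξ i.succ)
  simp only [pow_two] at hcs
  set a := ∑ i : Fin m, p i.succ * p i.succ
  set b := ∑ i : Fin m, ξ i.succ * ξ i.succ with hb
  set d := ∑ i : Fin m, p i.succ * ξ i.succ
  have hb0 : 0 ≤ b := Finset.sum_nonneg fun i _ => mul_self_nonneg _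
  have hc' : 1 / c < 0 := one_div_neg.2 hc
  rcases hb0.eq_or_lt with h0 | hbpos
  · exfalso
    have hi : ∀ i : Fin m, ξ i.succ = 0 := fun i => by
      have := (Finset.sum_eq_zero_iff_of_nonneg
        (fun i _ => mul_self_nonneg (ξ (Fin.succ i)))).1 h0.symm i (Finset.mem_univ i)
      exact mul_self_eq_zero.1 this
    have hd : d = 0 := Finset.sum_eq_zero fun i _ => by rw [hi i, mul_zero]
    have h00 : ξ 0 = 0 := by
      rw [hd] at ht
      have : p 0 * ξ 0 = 0 := by linarith
      exact (mul_eq_zero.1 this).resolve_left hp0.ne'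
    exact hξ (funext fun i => by
      refine Fin.cases h00 hi i)
  · have h1 : d = p 0 * ξ 0 := by linarith
    have h2 : a < p 0 * p 0 := by linarith
    rw [h1] at hcs
    have h3 : p 0 * p 0 * (ξ 0 * ξ 0) < p 0 * p 0 * b := by
      nlinarith [mul_lt_mul_of_pos_right h2 hbpos]
    have := lt_of_mul_lt_mul_left h3 (mul_self_nonneg _)
    linarith

theorem IsTangent.sub {c : ℝ} {p v w : Ambient m} (hv : IsTangent c p v) (hw : IsTangent c p w) :
    IsTangent c p (v - w) := by
  unfold IsTangent at *
  split_ifs at * with hc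
  · simp [hv, hw]
  · simpa [hv, hw] using (map_sub (formL c m p) v w)

theorem IsTangent.mul_form {c : ℝ} {p v : Ambient m} (hv : IsTangent c p v) :
    c * form c v p = 0 := by
  unfold IsTangent at hv
  split_ifs at hv with hc
  · simp [hc]
  · rw [form_symm, hv, mul_zero]

end Form

/-! ### The immersion in a chart -/

section Charts

open Filter Topology

variable {n m : ℕ} {M : Type*} [TopologicalSpace M] [ChartedSpace (Coord n) M]
  [IsManifold (𝓡 n) ∞ M]

theorem mdifferentiableAt_chart_symm (x : M) {u : Coord n} (hu : u ∈ (extChartAt (𝓡 n) x).target) :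
    MDifferentiableAt 𝓘(ℝ, Coord n) (𝓡 n) (extChartAt (𝓡 n) x).symm u :=
  ((contMDiffOn_extChartAt_symm (n := ∞) x).contMDiffAt
    ((isOpen_extChartAt_target x).mem_nhds hu)).mdifferentiableAt (by simp)

theorem mdifferentiableAt_chart (x : M) {y : M} (hy : y ∈ (extChartAt (𝓡 n) x).source) :
    MDifferentiableAt (𝓡 n) 𝓘(ℝ, Coord n) (extChartAt (𝓡 n) x) y :=
  (contMDiffAt_extChartAt' (n := ∞) (by simpa using hy)).mdifferentiableAt (by simp)

/-- The differential of the inverse chart. -/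
noncomputable def chartSymmD (x : M) (u : Coord n) :
    Coord n →L[ℝ] TangentSpace (𝓡 n) ((extChartAt (𝓡 n) x).symm u) :=
  mfderiv 𝓘(ℝ, Coord n) (𝓡 n) (extChartAt (𝓡 n) x).symm u

/-- The differential of the chart at `x`, at the point with coordinates `u`. -/
noncomputable def chartD (x : M) (u : Coord n) :
    TangentSpace (𝓡 n) ((extChartAt (𝓡 n) x).symm u) →L[ℝ] Coord n :=
  mfderiv (𝓡 n) 𝓘(ℝ, Coord n) (extChartAt (𝓡 n) x) ((extChartAt (𝓡 n) x).symm u)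

theorem chartD_chartSymmD (x : M) {u : Coord n} (hu : u ∈ (extChartAt (𝓡 n) x).target)
    (v : Coord n) : chartD x u (chartSymmD x u v) = v := by
  have := mfderiv_extChartAt_comp_mfderivWithin_extChartAt_symm (I := 𝓡 n) hu
  rw [ModelWithCorners.range_eq_univ, mfderivWithin_univ] at this
  exact DFunLike.congr_fun this v

theorem chartSymmD_chartD (x : M) {u : Coord n} (hu : u ∈ (extChartAt (𝓡 n) x).target)
    (X : TangentSpace (𝓡 n) ((extChartAt (𝓡 n) x).symm u)) :
    chartSymmD x u (chartD x u X) = X := by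
  have := mfderivWithin_extChartAt_symm_comp_mfderiv_extChartAt (I := 𝓡 n) hu
  rw [ModelWithCorners.range_eq_univ, mfderivWithin_univ] at this
  exact DFunLike.congr_fun this X

theorem contDiffOn_inChart {f : M → Ambient m} (hf : ContMDiff (𝓡 n) 𝓘(ℝ, Ambient m) ∞ f) (x : M) :
    ContDiffOn ℝ ∞ (inChart n f x) (extChartAt (𝓡 n) x).target :=
  contMDiffOn_iff_contDiffOn.1 (hf.comp_contMDiffOn (contMDiffOn_extChartAt_symm x))

theorem fderiv_inChart {f : M → Ambient m} (hf : ContMDiff (𝓡 n) 𝓘(ℝ, Ambient m) ∞ f) (x : M)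
    {u : Coord n} (hu : u ∈ (extChartAt (𝓡 n) x).target) (v : Coord n) :
    fderiv ℝ (inChart n f x) u v
      = differential f ((extChartAt (𝓡 n) x).symm u) (chartSymmD x u v) := by
  have h1 : MDifferentiableAt (𝓡 n) 𝓘(ℝ, Ambient m) f ((extChartAt (𝓡 n) x).symm u) :=
    (hf _).mdifferentiableAt (by simp)
  have h2 := mfderiv_comp (I := 𝓘(ℝ, Coord n)) u h1 (mdifferentiableAt_chart_symm x hu)
  rw [mfderiv_eq_fderiv] at h2
  exact DFunLike.congr_fun h2 v

variable [RiemannianBundle (fun y : M => TangentSpace (𝓡 n) y)] {c : ℝ} {f : M → Ambient m}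

namespace IsIsometricImmersion

variable (hf : IsIsometricImmersion (n := n) c f) (x : M)
include hf

theorem form_fderiv {u : Coord n} (hu : u ∈ (extChartAt (𝓡 n) x).target) (v w : Coord n) :
    form c (fderiv ℝ (inChart n f x) u v) (fderiv ℝ (inChart n f x) u w)
      = inner ℝ (chartSymmD x u v) (chartSymmD x u w) := by
  rw [fderiv_inChart hf.smooth x hu, fderiv_inChart hf.smooth x hu, hf.isometric]

theorem isLocalImmersion :
    IsLocalImmersion (formL c m) c (inChart n f x) (extChartAt (𝓡 n) x).target where
  isOpen := isOpen_extChartAt_target x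
  smooth := contDiffOn_inChart hf.smooth x
  symm p q := form_symm c p q
  pos u hu v hv := by
    rw [formL_apply, hf.form_fderiv x hu]
    refine real_inner_self_pos.2 fun h0 => hv ?_
    rw [← chartD_chartSymmD x hu v, h0, map_zero]
  radial u hu v := by
    by_cases hc : c = 0
    · simp [hc]
    have hF : DifferentiableAt ℝ (inChart n f x) u :=
      (contDiffOn_inChart hf.smooth x).differentiableAt_of_isOpen (isOpen_extChartAt_target x) hu
    have h1 := congrArg (fun L => L v) (fderiv_eq_of_eqOn (W := ℝ) (isOpen_extChartAt_target x) hu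
      (p := fun y => formL c m (inChart n f x y) (inChart n f x y)) (q := fun _ => 1 / c)
      fun y hy => by
        have := hf.mem_spaceForm ((extChartAt (𝓡 n) x).symm y)
        simp only [SpaceForm, Set.mem_ofPred_eq, if_neg hc] at this
        exact this.1)
    simp only [fderiv_const_apply, zero_apply] at h1
    rw [fderiv_bilin (formL c m) hF hF, formL_apply, formL_apply,
      form_symm c (fderiv ℝ (inChart n f x) u v)] at h1
    rw [formL_apply]
    linear_combination c / 2 * h1

theorem metricInChart_eq {u : Coord n} (hu : u ∈ (extChartAt (𝓡 n) x).target) :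
    metricInChart x u = gramMatrix (formL c m) (coordBasis n) (inChart n f x) u := by
  ext i j
  simp only [metricInChart, gramMatrix, Matrix.of_apply, formL_apply, hf.form_fderiv x hu]
  simp [chartSymmD]

end IsIsometricImmersion
end Charts

/-! ### From principal normal vectors to principal frames -/

section PrincipalDatum

open Filter Topology

/-- Under a change of coordinates the Hessian acquires only a term in the image of the differential,
so its normal part is unaffected. This is used for transition maps. -/
theorem fderiv_fderiv_comp {E E' W : Type*} [NormedAddCommGroup E] [NormedSpace ℝ E]
    [NormedAddCommGroup E'] [NormedSpace ℝ E'] [NormedAddCommGroup W] [NormedSpace ℝ W]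
    {p : E' → W} {θ : E → E'} {u : E} (hp : ContDiffAt ℝ ∞ p (θ u)) (hθ : ContDiffAt ℝ ∞ θ u)
    (v w : E) :
    fderiv ℝ (fderiv ℝ (p ∘ θ)) u v w
      = fderiv ℝ (fderiv ℝ p) (θ u) (fderiv ℝ θ u v) (fderiv ℝ θ u w)
        + fderiv ℝ p (θ u) (fderiv ℝ (fderiv ℝ θ) u v w) := by
  have h1 : (fderiv ℝ (p ∘ θ)) =ᶠ[𝓝 u] fun x => (fderiv ℝ p (θ x)).comp (fderiv ℝ θ x) := by
    have hp1 : ∀ᶠ y in 𝓝 (θ u), DifferentiableAt ℝ p y :=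
      ((hp.of_le (m := 1) (by simp)).eventually (by simp)).mono fun y hy =>
        hy.differentiableAt (by simp)
    have hθ1 : ∀ᶠ y in 𝓝 u, DifferentiableAt ℝ θ y :=
      ((hθ.of_le (m := 1) (by simp)).eventually (by simp)).mono fun y hy =>
        hy.differentiableAt (by simp)
    filter_upwards [hθ.continuousAt.eventually hp1, hθ1] with x hx hx'
    exact fderiv_comp x hx hx'
  have hp2 : DifferentiableAt ℝ (fderiv ℝ p) (θ u) :=
    (hp.fderiv_right (m := ∞) (by simp)).differentiableAt (by simp)
  have hθ2 : DifferentiableAt ℝ (fderiv ℝ θ) u :=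
    (hθ.fderiv_right (m := ∞) (by simp)).differentiableAt (by simp)
  have hθ3 : DifferentiableAt ℝ θ u := hθ.differentiableAt (by simp)
  have hc : DifferentiableAt ℝ (fun x => fderiv ℝ p (θ x)) u := hp2.comp u hθ3
  rw [h1.fderiv_eq, fderiv_clm_comp hc hθ2]
  have h3 : fderiv ℝ (fun x => fderiv ℝ p (θ x)) u
      = (fderiv ℝ (fderiv ℝ p) (θ u)).comp (fderiv ℝ θ u) := fderiv_comp u hp2 hθ3
  simp [h3, add_comm]

theorem exists_eq_add_normalPart {n m : ℕ} (c : ℝ) (F : Coord n → Ambient m) (u : Coord n)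
    (w : Ambient m) :
    ∃ γ, w = fderiv ℝ F u γ + normalPart c F u w + (c * form c w (F u)) • F u := by
  refine ⟨∑ k, ∑ l, ((gram c F u)⁻¹ k l * form c w (partialD k F u)) • EuclideanSpace.single l 1, ?_⟩
  simp only [map_sum, map_smul, normalPart, partialD]
  abel

variable {n m : ℕ} {M : Type*} [TopologicalSpace M] [ChartedSpace (Coord n) M]
  [RiemannianBundle (fun y : M => TangentSpace (𝓡 n) y)] {c : ℝ} {f : M → Ambient m}

/-- `η` and `ζ` are distinct normal vectors at `x`, and `T` a unit tangent vector, such that the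
second fundamental form is `⟨X, Y⟩ ζ + ⟨X, T⟩ ⟨Y, T⟩ (η - ζ)`. -/
structure IsPrincipalDatum (c : ℝ) (f : M → Ambient m) (x : M) (T : TangentSpace (𝓡 n) x)
    (η ζ : Ambient m) : Prop where
  unit : inner ℝ T T = (1 : ℝ)
  eta_normal : IsNormal n c f x η
  zeta_normal : IsNormal n c f x ζ
  ne : η ≠ ζ
  second : ∀ X Y : TangentSpace (𝓡 n) x, secondFundamentalForm c f x X Y
    = (inner ℝ X Y : ℝ) • ζ + ((inner ℝ X T : ℝ) * inner ℝ Y T) • (η - ζ)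

/-- `T` is a unit vector of the one-dimensional principal space, and every `X` is a multiple of `T`
plus an element of the other space. The choice is pointwise, without any continuity in `x`. -/
theorem HasType.exists_isPrincipalDatum {k : ℕ} (h : HasType n c f ![1, k]) (x : M) :
    ∃ (T : TangentSpace (𝓡 n) x) (η ζ : Ambient m), IsPrincipalDatum c f x T η ζ := by
  obtain ⟨η, hη, hdim⟩ := h x
  obtain ⟨⟨X₀, hX₀⟩, hne, hspan⟩ := finrank_eq_one_iff'.1 (hdim 0)
  have hne' : X₀ ≠ 0 := fun h0 => hne (Subtype.ext h0)
  have hpos : 0 < ‖X₀‖ := norm_pos_iff.2 hne'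
  obtain ⟨T, hT⟩ : ∃ T : TangentSpace (𝓡 n) x, T = ‖X₀‖⁻¹ • X₀ := ⟨_, rfl⟩
  have hTmem : T ∈ principalSpace (n := n) c f x (η 0) :=
    hT ▸ Submodule.smul_mem _ _ hX₀
  have hunit : inner ℝ T T = (1 : ℝ) := by
    rw [hT, real_inner_smul_left, real_inner_smul_right, real_inner_self_eq_norm_sq]
    field_simp
  refine ⟨T, η 0, η 1, hunit, hη.normal 0, hη.normal 1, hη.distinct.ne (by decide), fun X Y => ?_⟩
  have hX : X ∈ principalSpace (n := n) c f x (η 0) ⊔ principalSpace (n := n) c f x (η 1) := by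
    have h1 : X ∈ ⨆ i, principalSpace (n := n) c f x (η i) := by rw [hη.iSup_eq_top]; trivial
    refine (iSup_le fun i => ?_ : ⨆ i, principalSpace (n := n) c f x (η i) ≤ _) h1
    revert i
    rw [Fin.forall_fin_two]
    exact ⟨le_sup_left, le_sup_right⟩
  obtain ⟨X₁, hX₁, X₂, hX₂, rfl⟩ := Submodule.mem_sup.1 hX
  obtain ⟨a, ha⟩ := hspan ⟨X₁, hX₁⟩
  have ha' : X₁ = (a * ‖X₀‖) • T := by
    have h2 : a • X₀ = X₁ := congrArg Subtype.val ha
    rw [hT, smul_smul, mul_assoc, mul_inv_cancel₀ hpos.ne', mul_one, h2]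
  have hX₂T : inner ℝ X₂ T = (0 : ℝ) := by
    rw [real_inner_comm]
    exact hη.orthogonal 0 1 (by decide) T hTmem X₂ hX₂
  have hadd : secondFundamentalForm c f x (X₁ + X₂) Y
      = secondFundamentalForm c f x X₁ Y + secondFundamentalForm c f x X₂ Y := by
    simp only [secondFundamentalForm, secondFF, map_add, normalPart_add]
  rw [hadd, hX₁ Y, hX₂ Y, inner_add_left, inner_add_left, hX₂T, add_zero, ha',
    real_inner_smul_left, real_inner_smul_left, hunit, real_inner_comm Y T]
  module

variable [IsManifold (𝓡 n) ∞ M]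

omit [RiemannianBundle (fun y : M => TangentSpace (𝓡 n) y)] in
theorem fderiv_inChart_coords (hf : ContMDiff (𝓡 n) 𝓘(ℝ, Ambient m) ∞ f) (y : M)
    (X : TangentSpace (𝓡 n) y) :
    fderiv ℝ (inChart n f y) (extChartAt (𝓡 n) y y) (coords y X) = differential f y X := by
  have hF : DifferentiableAt ℝ (inChart n f y) (extChartAt (𝓡 n) y y) :=
    (contDiffOn_inChart hf y).differentiableAt_of_isOpen (isOpen_extChartAt_target y)
      (mem_extChartAt_target y)
  have h1 := mfderiv_comp (I := 𝓡 n) (I' := 𝓘(ℝ, Coord n)) (I'' := 𝓘(ℝ, Ambient m)) y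
    hF.mdifferentiableAt (mdifferentiableAt_chart y (mem_extChartAt_source y))
  have h2 : (inChart n f y ∘ extChartAt (𝓡 n) y) =ᶠ[𝓝 y] f := by
    filter_upwards [extChartAt_source_mem_nhds (I := 𝓡 n) y] with z hz
    simp only [Function.comp, inChart, (extChartAt (𝓡 n) y).left_inv hz]
  rw [h2.mfderiv_eq, mfderiv_eq_fderiv] at h1
  exact (DFunLike.congr_fun h1 X).symm

/-- The second fundamental form at `y` is computed in the preferred chart at `y`, while the frame
lives in the chart at `x`. The discrepancy from the transition map is tangential and is absorbed in
the free vector of `second`. -/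
theorem IsPrincipalDatum.frameAt (hf : IsIsometricImmersion (n := n) c f) (x : M) {u : Coord n}
    (hu : u ∈ (extChartAt (𝓡 n) x).target)
    {T : TangentSpace (𝓡 n) ((extChartAt (𝓡 n) x).symm u)} {η ζ : Ambient m}
    (h : IsPrincipalDatum c f ((extChartAt (𝓡 n) x).symm u) T η ζ) :
    IsPrincipalFrameAt (formL c m) c (inChart n f x) u (chartD x u T) η ζ := by
  let y := (extChartAt (𝓡 n) x).symm u
  have hT : ∀ v, form c (fderiv ℝ (inChart n f x) u v)
      (fderiv ℝ (inChart n f x) u (chartD x u T)) = inner ℝ (chartSymmD x u v) T := by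
    intro v
    rw [hf.form_fderiv x hu, chartSymmD_chartD x hu]
  refine ⟨?_, fun v => ?_, fun v => ?_, h.eta_normal.1.mul_form, h.zeta_normal.1.mul_form, ?_, ?_⟩
  · rw [formL_apply, hT, chartSymmD_chartD x hu]
    exact h.unit
  · rw [formL_apply, fderiv_inChart hf.smooth x hu]
    exact h.eta_normal.2 _
  · rw [formL_apply, fderiv_inChart hf.smooth x hu]
    exact h.zeta_normal.2 _
  · exact form_self_pos (hf.mem_spaceForm y) (h.eta_normal.1.sub h.zeta_normal.1)
      (sub_ne_zero.2 h.ne)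
  intro v w
  let θ : Coord n → Coord n := extChartAt (𝓡 n) y ∘ (extChartAt (𝓡 n) x).symm
  have hys : y ∈ (extChartAt (𝓡 n) y).source := mem_extChartAt_source y
  have hsymm : ContMDiffAt 𝓘(ℝ, Coord n) (𝓡 n) ∞ (extChartAt (𝓡 n) x).symm u :=
    (contMDiffOn_extChartAt_symm x).contMDiffAt ((isOpen_extChartAt_target x).mem_nhds hu)
  have hθs : ContDiffAt ℝ ∞ θ u :=
    contMDiffAt_iff_contDiffAt.1 (ContMDiffAt.comp u contMDiffAt_extChartAt hsymm)
  have hθd : ∀ v, fderiv ℝ θ u v = coords y (chartSymmD x u v) := by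
    intro v
    have h1 := mfderiv_comp (I := 𝓘(ℝ, Coord n)) (I' := 𝓡 n) (I'' := 𝓘(ℝ, Coord n)) u
      (mdifferentiableAt_chart y hys) (mdifferentiableAt_chart_symm x hu)
    rw [mfderiv_eq_fderiv] at h1
    exact DFunLike.congr_fun h1 v
  have hθu : θ u = extChartAt (𝓡 n) y y := rfl
  have hloc : inChart n f x =ᶠ[𝓝 u] inChart n f y ∘ θ := by
    filter_upwards [hsymm.continuousAt.preimage_mem_nhds (extChartAt_source_mem_nhds (I := 𝓡 n) y)]
      with z hz
    simp only [Function.comp, inChart, θ, (extChartAt (𝓡 n) y).left_inv hz]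
  have hIy := hf.isLocalImmersion y
  have hyt : extChartAt (𝓡 n) y y ∈ (extChartAt (𝓡 n) y).target := mem_extChartAt_target y
  have hFs : ContDiffAt ℝ ∞ (inChart n f y) (θ u) :=
    hIy.smooth.contDiffAt (hIy.isOpen.mem_nhds hyt)
  have hFy : inChart n f y (extChartAt (𝓡 n) y y) = f y := by
    simp only [inChart, (extChartAt (𝓡 n) y).left_inv hys]
  have hsec : fderiv ℝ (fderiv ℝ (inChart n f x)) u v w
      = fderiv ℝ (fderiv ℝ (inChart n f y)) (extChartAt (𝓡 n) y y) (coords y (chartSymmD x u v))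
          (coords y (chartSymmD x u w))
        + fderiv ℝ (inChart n f y) (extChartAt (𝓡 n) y y) (fderiv ℝ (fderiv ℝ θ) u v w) := by
    rw [hloc.fderiv.fderiv_eq, fderiv_fderiv_comp hFs hθs, hθd, hθd, hθu]
  obtain ⟨γ, hγ⟩ := exists_eq_add_normalPart c (inChart n f y) (extChartAt (𝓡 n) y y)
    (fderiv ℝ (fderiv ℝ (inChart n f y)) (extChartAt (𝓡 n) y y) (coords y (chartSymmD x u v))
          (coords y (chartSymmD x u w)))
  have hα : secondFundamentalForm c f y (chartSymmD x u v) (chartSymmD x u w) = _ :=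
    h.second (chartSymmD x u v) (chartSymmD x u w)
  simp only [secondFundamentalForm, secondFF] at hα
  rw [fderiv_fderiv_apply (hIy.differentiableAt_fderiv hyt)] at hα
  have hrad := hIy.radial_second hyt (coords y (chartSymmD x u v)) (coords y (chartSymmD x u w))
  rw [formL_apply, formL_apply, fderiv_inChart_coords hf.smooth, fderiv_inChart_coords hf.smooth,
    hf.isometric, form_symm] at hrad
  rw [hα, hrad, hFy] at hγ
  obtain ⟨X, hX⟩ : ∃ X : TangentSpace (𝓡 n) y,
      coords y X = γ + fderiv ℝ (fderiv ℝ θ) u v w := by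
    obtain ⟨Φ, hΦ⟩ := isInvertible_mfderiv_extChartAt (I := 𝓡 n) hys
    refine ⟨Φ.symm (γ + fderiv ℝ (fderiv ℝ θ) u v w), ?_⟩
    rw [coords, ← hΦ]
    exact Φ.apply_symm_apply _
  refine ⟨chartD x u X, ?_⟩
  have hXd : fderiv ℝ (inChart n f x) u (chartD x u X)
      = fderiv ℝ (inChart n f y) (extChartAt (𝓡 n) y y) γ
        + fderiv ℝ (inChart n f y) (extChartAt (𝓡 n) y y) (fderiv ℝ (fderiv ℝ θ) u v w) := by
    rw [fderiv_inChart hf.smooth x hu, chartSymmD_chartD x hu, ← map_add, ← hX,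
      fderiv_inChart_coords hf.smooth]
  simp only [formL_apply]
  rw [hXd, hT, hT, hf.form_fderiv x hu, hsec, hγ, show inChart n f x u = f y from rfl]
  module

end PrincipalDatum

/-! ### Second derivative test and the equation for the gap -/

section Calculus

open Filter Topology

theorem hasDerivAt_line {E : Type*} [NormedAddCommGroup E] [NormedSpace ℝ E] (u v : E) (s : ℝ) :
    HasDerivAt (fun s : ℝ => u + s • v) v s := by
  have h := ((hasDerivAt_id s).smul_const v).const_add u
  rwa [one_smul] at h

theorem HasDerivAt.eventually_add_mul_lt {q : ℝ → ℝ} {q' r : ℝ} (h : HasDerivAt q q' 0)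
    (hr : r < q') : ∀ᶠ s in 𝓝[>] (0 : ℝ), q 0 + r * s < q s := by
  have h1 := h.tendsto_slope_zero_right
  filter_upwards [h1.eventually_const_lt hr, self_mem_nhdsWithin] with s hs hs0
  rw [zero_add, smul_eq_mul, inv_mul_eq_div, lt_div_iff₀ hs0] at hs
  linarith

/-- A positive second derivative on a line would make the point also a local minimum there, hence
the function locally constant, with zero second derivative. -/
theorem IsLocalMax.fderiv_fderiv_nonpos {E : Type*} [NormedAddCommGroup E] [NormedSpace ℝ E]
    {p : E → ℝ} {u : E} (hm : IsLocalMax p u) (hp : ContDiffAt ℝ ∞ p u) (v : E) :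
    fderiv ℝ (fderiv ℝ p) u v v ≤ 0 := by
  by_contra! hpos
  let k : ℝ → E := fun s => u + s • v
  have hk : ∀ s, HasDerivAt k v s := hasDerivAt_line u v
  have hk0 : k 0 = u := by simp [k]
  have hkc : Tendsto k (𝓝 0) (𝓝 u) := by
    have := (hk 0).continuousAt.tendsto
    rwa [hk0] at this
  have hd : ∀ᶠ x in 𝓝 u, DifferentiableAt ℝ p x :=
    ((hp.of_le (m := 1) (by simp)).eventually (by simp)).mono fun y hy =>
      hy.differentiableAt (by simp)
  have hd2 : DifferentiableAt ℝ (fderiv ℝ p) u :=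
    (hp.fderiv_right (m := ∞) (by simp)).differentiableAt (by simp)
  have h1 : deriv (p ∘ k) =ᶠ[𝓝 0] fun s => fderiv ℝ p (k s) v := by
    filter_upwards [hkc.eventually hd] with s hs
    exact (hs.hasFDerivAt.comp_hasDerivAt s (hk s)).deriv
  have h2 : deriv (deriv (p ∘ k)) 0 = fderiv ℝ (fderiv ℝ p) u v v := by
    rw [h1.deriv_eq]
    have h3 : HasFDerivAt (fderiv ℝ p) (fderiv ℝ (fderiv ℝ p) u) (k 0) := by
      rw [hk0]; exact hd2.hasFDerivAt
    have h4 := (h3.comp_hasDerivAt 0 (hk 0)).clm_apply (hasDerivAt_const (0 : ℝ) v)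
    simpa using h4.deriv
  have hmax : IsLocalMax (p ∘ k) 0 := by
    have := hkc.eventually hm
    filter_upwards [this] with s hs
    simpa [hk0] using hs
  have hmin : IsLocalMin (p ∘ k) 0 := isLocalMin_of_deriv_deriv_pos (by rw [h2]; exact hpos)
    hmax.deriv_eq_zero (hd.self_of_nhds.continuousAt.comp_of_eq (hk 0).continuousAt hk0)
  have hconst : (p ∘ k) =ᶠ[𝓝 0] fun _ => (p ∘ k) 0 := by
    filter_upwards [hmax, hmin] with s h3 h4 using le_antisymm h3 h4
  have h5 : deriv (p ∘ k) =ᶠ[𝓝 0] fun _ => 0 := by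
    filter_upwards [hconst.deriv] with s hs
    rw [hs, deriv_const]
  rw [← h2, h5.deriv_eq, deriv_const] at hpos
  exact lt_irrefl _ hpos

variable {E A : Type*} [NormedAddCommGroup E] [NormedSpace ℝ E]
  [NormedAddCommGroup A] [NormedSpace ℝ A]

/-- The function `N ⟨ζ, ζ⟩ - ρ = 2 (⟨ζ, ζ⟩ - ⟨η, ζ⟩)` varies only in the direction of `T`. -/
theorem IsPrincipalFrame.fderiv_gap {B : A →L[ℝ] A →L[ℝ] ℝ} {c : ℝ} {F : E → A} {Ω : Set E}
    {T : E → E} {η ζ : E → A} [FiniteDimensional ℝ E] (h : IsPrincipalFrame B c F Ω T η ζ)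
    (hE : 3 ≤ Module.finrank ℝ E) {ρ N : ℝ}
    (hρ : ∀ x ∈ Ω, 2 * B (η x) (ζ x) + (N - 2) * B (ζ x) (ζ x) = ρ) {u : E} (hu : u ∈ Ω) (v : E) :
    fderiv ℝ (fun x => N * B (ζ x) (ζ x) - ρ) u v
      = -(N * umbilicity B T η ζ u * B (fderiv ℝ F u v) (fderiv ℝ F u (T u))
        * (N * B (ζ u) (ζ u) - ρ)) := by
  have hζ := h.differentiableAt_zeta hu
  rw [fderiv_sub_const, fderiv_const_mul (differentiableAt_bilin B hζ hζ), smul_apply, smul_eq_mul,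
    h.fderiv_zeta_zeta hu hE]
  linear_combination (N * umbilicity B T η ζ u * B (fderiv ℝ F u v) (fderiv ℝ F u (T u)))
    * hρ u hu

/-- If `N ⟨ζ, ζ⟩ - ρ` vanishes at a point, then it vanishes nearby. -/
theorem IsPrincipalFrame.eventually_gap_eq_zero {B : A →L[ℝ] A →L[ℝ] ℝ} {c : ℝ} {F : E → A}
    {Ω : Set E} {T : E → E} {η ζ : E → A} [FiniteDimensional ℝ E]
    (h : IsPrincipalFrame B c F Ω T η ζ) (hE : 3 ≤ Module.finrank ℝ E) {ρ N : ℝ}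
    (hρ : ∀ x ∈ Ω, 2 * B (η x) (ζ x) + (N - 2) * B (ζ x) (ζ x) = ρ) {u₀ : E} (hu₀ : u₀ ∈ Ω)
    (h0 : N * B (ζ u₀) (ζ u₀) - ρ = 0) : ∀ᶠ u in 𝓝 u₀, N * B (ζ u) (ζ u) - ρ = 0 := by
  -- The gap satisfies `dw = -w L` with a continuous one-form `L`. On a small ball `L` is bounded,
  -- and uniqueness for this linear equation applies along each segment from `u₀`.
  let L : E → E →L[ℝ] ℝ := fun u =>
    (N * umbilicity B T η ζ u) • (B (fderiv ℝ F u (T u))).comp (fderiv ℝ F u)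
  have hL : ContinuousOn L Ω :=
    (continuousOn_const.mul h.smooth_umbilicity.continuousOn).smul
      ((B.continuous.comp_continuousOn h.smooth_tau.continuousOn).clm_comp
        h.smooth_fderiv.continuousOn)
  have hLc : ContinuousAt L u₀ := hL.continuousAt (h.isOpen.mem_nhds hu₀)
  have hev : ∀ᶠ u in 𝓝 u₀, u ∈ Ω ∧ ‖L u‖ < ‖L u₀‖ + 1 :=
    (h.isOpen.eventually_mem hu₀).and
      (hLc.norm.eventually_lt_const (lt_add_one _))
  obtain ⟨r, hr, hball⟩ := Metric.eventually_nhds_iff_ball.1 hev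
  filter_upwards [Metric.ball_mem_nhds u₀ hr] with u hu
  let k : ℝ → E := fun s => u₀ + s • (u - u₀)
  have hk : ∀ s, HasDerivAt k (u - u₀) s := hasDerivAt_line u₀ (u - u₀)
  have hkb : ∀ s ∈ Set.Icc (0 : ℝ) 1, k s ∈ Metric.ball u₀ r := by
    intro s hs
    have := (convex_ball u₀ r).add_smul_sub_mem (Metric.mem_ball_self hr) hu hs
    exact this
  let w : E → ℝ := fun x => N * B (ζ x) (ζ x) - ρ
  have hwd : ∀ x ∈ Ω, DifferentiableAt ℝ w x := fun x hx =>
    ((differentiableAt_bilin B (h.differentiableAt_zeta hx)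
      (h.differentiableAt_zeta hx)).const_mul N).sub_const ρ
  have hder : ∀ s ∈ Set.Icc (0 : ℝ) 1,
      HasDerivAt (w ∘ k) (-(L (k s) (u - u₀) * w (k s))) s := by
    intro s hs
    have hx := (hball _ (hkb s hs)).1
    have h1 := (hwd _ hx).hasFDerivAt.comp_hasDerivAt s (hk s)
    rw [show fderiv ℝ w (k s) (u - u₀) = _ from h.fderiv_gap hE hρ hx (u - u₀)] at h1
    refine h1.congr_deriv ?_
    simp only [L, smul_apply, ContinuousLinearMap.comp_apply, smul_eq_mul, w]
    rw [h.symm (fderiv ℝ F (k s) (T (k s)))]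
  have hz := eq_zero_of_abs_deriv_le_mul_abs_self_of_eq_zero_right (f := w ∘ k)
    (f' := fun s => -(L (k s) (u - u₀) * w (k s))) (K := (‖L u₀‖ + 1) * ‖u - u₀‖) (a := 0) (b := 1)
    (fun s hs => (hder s hs).continuousAt.continuousWithinAt)
    (fun s hs => (hder s ⟨hs.1, hs.2.le⟩).hasDerivWithinAt)
    (by simpa [k, w] using h0)
    (fun s hs => by
      rw [norm_neg, norm_mul]
      refine mul_le_mul_of_nonneg_right ?_ (norm_nonneg _)
      exact (L (k s)).le_of_opNorm_le (hball _ (hkb s ⟨hs.1, hs.2.le⟩)).2.le _)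
    1 ⟨zero_le_one, le_rfl⟩
  simpa [k, w] using hz

end Calculus

/-! ### Directional derivatives and distances in a chart -/

section ChartAnalysis

open Filter Topology

variable {n m : ℕ} {M : Type*}

theorem continuousAt_of_chart [TopologicalSpace M] [ChartedSpace (Coord n) M]
    {W : Type*} [TopologicalSpace W] {g : M → W} {x : M}
    (h : ContinuousAt (fun u => g ((extChartAt (𝓡 n) x).symm u)) (extChartAt (𝓡 n) x x)) :
    ContinuousAt g x := by
  have h1 := h.comp (continuousAt_extChartAt (I := 𝓡 n) x)
  refine h1.congr ?_
  filter_upwards [extChartAt_source_mem_nhds (I := 𝓡 n) x] with z hz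
  simp only [Function.comp, (extChartAt (𝓡 n) x).left_inv hz]

/-- The derivative of a real function `g` in the direction of a tangent vector. -/
noncomputable def directionalD [TopologicalSpace M] [ChartedSpace (Coord n) M] (g : M → ℝ) (x : M)
    (X : TangentSpace (𝓡 n) x) : ℝ :=
  mfderiv (𝓡 n) 𝓘(ℝ, ℝ) g x X

theorem directionalD_eq_fderiv_chart [TopologicalSpace M] [ChartedSpace (Coord n) M]
    [IsManifold (𝓡 n) ∞ M] {g : M → ℝ} (x : M) {u : Coord n}
    (hu : u ∈ (extChartAt (𝓡 n) x).target)
    (hg : DifferentiableAt ℝ (fun u => g ((extChartAt (𝓡 n) x).symm u)) u)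
    (X : TangentSpace (𝓡 n) ((extChartAt (𝓡 n) x).symm u)) :
    directionalD g ((extChartAt (𝓡 n) x).symm u) X
      = fderiv ℝ (fun u => g ((extChartAt (𝓡 n) x).symm u)) u (chartD x u X) := by
  have hs : (extChartAt (𝓡 n) x).symm u ∈ (extChartAt (𝓡 n) x).source :=
    (extChartAt (𝓡 n) x).map_target hu
  have h1 := mfderiv_comp_of_eq (I := 𝓡 n) (I' := 𝓘(ℝ, Coord n)) (I'' := 𝓘(ℝ, ℝ))
    (x := (extChartAt (𝓡 n) x).symm u) hg.mdifferentiableAt (mdifferentiableAt_chart x hs)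
    ((extChartAt (𝓡 n) x).right_inv hu)
  have h2 : ((fun u => g ((extChartAt (𝓡 n) x).symm u)) ∘ extChartAt (𝓡 n) x)
      =ᶠ[𝓝 ((extChartAt (𝓡 n) x).symm u)] g := by
    filter_upwards [(isOpen_extChartAt_source x).mem_nhds hs] with z hz
    simp only [Function.comp, (extChartAt (𝓡 n) x).left_inv hz]
  rw [h2.mfderiv_eq, mfderiv_eq_fderiv] at h1
  have h3 : directionalD g ((extChartAt (𝓡 n) x).symm u) X
      = fderiv ℝ (fun u => g ((extChartAt (𝓡 n) x).symm u))
        (extChartAt (𝓡 n) x ((extChartAt (𝓡 n) x).symm u)) (chartD x u X) :=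
    DFunLike.congr_fun h1 X
  rwa [(extChartAt (𝓡 n) x).right_inv hu] at h3

open Manifold in
/-- In the direction of a coordinate vector of length less than `2`, the distance grows at most at
rate `2`. -/
theorem eventually_dist_chart_le [MetricSpace M] [ChartedSpace (Coord n) M] [IsManifold (𝓡 n) ∞ M]
    [RiemannianBundle (fun x : M => TangentSpace (𝓡 n) x)]
    [IsRiemannianManifold (𝓡 n) M] {c : ℝ} {f : M → Ambient m}
    (hf : IsIsometricImmersion (n := n) c f) (x : M) {v : Coord n}
    (hv : form c (fderiv ℝ (inChart n f x) (extChartAt (𝓡 n) x x) v)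
      (fderiv ℝ (inChart n f x) (extChartAt (𝓡 n) x x) v) < 4) :
    ∀ᶠ s in 𝓝[>] (0 : ℝ),
      dist x ((extChartAt (𝓡 n) x).symm (extChartAt (𝓡 n) x x + s • v)) ≤ 2 * s := by
  set φ := extChartAt (𝓡 n) x with hφ
  have hI := hf.isLocalImmersion x
  have hu : φ x ∈ φ.target := mem_extChartAt_target x
  let k : ℝ → Coord n := fun s => φ x + s • v
  have hk : ∀ s, HasDerivAt k v s := hasDerivAt_line (φ x) v
  have hk0 : k 0 = φ x := by simp [k]
  have hc : ContinuousAt (fun u => formL c m (fderiv ℝ (inChart n f x) u v)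
      (fderiv ℝ (inChart n f x) u v)) (φ x) :=
    (contDiffOn_bilin _ (hI.smooth_fderiv.clm_apply contDiffOn_const)
      (hI.smooth_fderiv.clm_apply contDiffOn_const)).continuousOn.continuousAt
      (hI.isOpen.mem_nhds hu)
  -- By continuity the coordinate line keeps speed less than `2` for a short time, so its length
  -- bounds the distance.
  have hev : ∀ᶠ u in 𝓝 (φ x), u ∈ φ.target ∧ formL c m (fderiv ℝ (inChart n f x) u v)
      (fderiv ℝ (inChart n f x) u v) < 4 :=
    (hI.isOpen.eventually_mem hu).and (hc.eventually_lt_const hv)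
  have hkt : Tendsto k (𝓝 0) (𝓝 (φ x)) := by
    have := (hk 0).continuousAt.tendsto
    rwa [hk0] at this
  obtain ⟨r, hr, hball⟩ := Metric.eventually_nhds_iff_ball.1 (hkt.eventually hev)
  filter_upwards [Ioo_mem_nhdsGT hr] with s hs
  have hin : ∀ t ∈ Set.Icc 0 s, t ∈ Metric.ball (0 : ℝ) r := by
    intro t ht
    rw [Metric.mem_ball, Real.dist_0_eq_abs, abs_of_nonneg ht.1]
    exact ht.2.trans_lt hs.2
  have hkd : ∀ t, MDifferentiableAt 𝓘(ℝ, ℝ) 𝓘(ℝ, Coord n) k t := fun t =>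
    (hk t).differentiableAt.mdifferentiableAt
  have hsm : ContMDiffOn 𝓘(ℝ, ℝ) (𝓡 n) 1 (φ.symm ∘ k) (Set.Icc 0 s) := by
    refine ((contMDiffOn_extChartAt_symm (n := ∞) x).of_le (by simp)).comp (t := φ.target) ?_ ?_
    · have : ContDiff ℝ 1 k := contDiff_const.add (contDiff_id.smul contDiff_const)
      exact this.contMDiff.contMDiffOn
    · exact fun t ht => (hball t (hin t ht)).1
  have hle : riemannianEDist (𝓡 n) x (φ.symm (k s)) ≤ pathELength (𝓡 n) (φ.symm ∘ k) 0 s :=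
    riemannianEDist_le_pathELength hsm
      (by simp only [Function.comp, hk0]; exact extChartAt_to_inv x) rfl hs.1.le
  have hlen : pathELength (𝓡 n) (φ.symm ∘ k) 0 s ≤ ENNReal.ofReal (2 * s) := by
    rw [pathELength_eq_lintegral_mfderiv_Icc]
    calc _ ≤ ∫⁻ _ in Set.Icc 0 s, ENNReal.ofReal 2 := by
          refine MeasureTheory.setLIntegral_mono' measurableSet_Icc fun t ht => ?_
          obtain ⟨h1, h2⟩ := hball t (hin t ht)
          have h3 := mfderiv_comp (I := 𝓘(ℝ, ℝ)) (I' := 𝓘(ℝ, Coord n)) (I'' := 𝓡 n) t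
            (mdifferentiableAt_chart_symm x h1) (hkd t)
          have h4 : mfderiv 𝓘(ℝ, ℝ) (𝓡 n) (φ.symm ∘ k) t (1 : ℝ) = chartSymmD x (k t) v := by
            rw [mfderiv_eq_fderiv] at h3
            have h5 := DFunLike.congr_fun h3 (1 : ℝ)
            have h6 : fderiv ℝ k t (1 : ℝ) = v := by
              rw [(hk t).hasFDerivAt.fderiv]; simp
            refine h5.trans ?_
            show mfderiv 𝓘(ℝ, Coord n) (𝓡 n) φ.symm (k t) (fderiv ℝ k t (1 : ℝ)) = _
            rw [h6]
            rfl
          rw [formL_apply, hf.form_fderiv x h1, real_inner_self_eq_norm_sq] at h2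
          have h7 : ‖chartSymmD x (k t) v‖ ≤ 2 := by
            nlinarith [norm_nonneg (chartSymmD x (k t) v)]
          refine (congrArg (fun X : TangentSpace (𝓡 n) (φ.symm (k t)) => ‖X‖ₑ) h4).trans_le ?_
          rw [← ofReal_norm]
          exact ENNReal.ofReal_le_ofReal h7
      _ = ENNReal.ofReal (2 * s) := by
          rw [MeasureTheory.setLIntegral_const, Real.volume_Icc, sub_zero,
            ENNReal.ofReal_mul (by norm_num)]
  have h8 : edist x (φ.symm (k s)) ≤ ENNReal.ofReal (2 * s) := by
    rw [IsRiemannianManifold.out (I := 𝓡 n) x (φ.symm (k s))]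
    exact hle.trans hlen
  rw [edist_dist] at h8
  exact (ENNReal.ofReal_le_ofReal_iff (by linarith [hs.1])).1 h8

end ChartAnalysis

/-! ### Global functions built from the pointwise data -/

section GlobalFrame

open Filter Topology

variable {n m : ℕ} {M : Type*} [TopologicalSpace M] [ChartedSpace (Coord n) M]
  [IsManifold (𝓡 n) ∞ M] [RiemannianBundle (fun y : M => TangentSpace (𝓡 n) y)]
  {c : ℝ} {f : M → Ambient m} (hf : IsIsometricImmersion (n := n) c f)
  {T : ∀ x : M, TangentSpace (𝓡 n) x} {η ζ : M → Ambient m}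
  (hd : ∀ x, IsPrincipalDatum c f x (T x) (η x) (ζ x))

include hf hd

omit [IsManifold (𝓡 n) ∞ M] in
theorem form_zeta_nonneg (x : M) : 0 ≤ form c (ζ x) (ζ x) := by
  by_cases h : ζ x = 0
  · rw [h]; exact ((formL c m 0).map_zero).ge
  · exact (form_self_pos (hf.mem_spaceForm x) (hd x).zeta_normal.1 h).le

omit [IsManifold (𝓡 n) ∞ M] in
theorem zeta_eq_zero {x : M} (h : form c (ζ x) (ζ x) = 0) : ζ x = 0 := by
  by_contra h0
  exact (form_self_pos (hf.mem_spaceForm x) (hd x).zeta_normal.1 h0).ne' h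

/-- The scalar curvature in terms of the principal normals. -/
theorem scalarCurvature_eq (x : M) :
    scalarCurvature (n := n) x
      = n * (n - 1) * c + (n - 1) * (2 * form c (η x) (ζ x) + (n - 2) * form c (ζ x) (ζ x)) := by
  have hu : extChartAt (𝓡 n) x x ∈ (extChartAt (𝓡 n) x).target := mem_extChartAt_target x
  have h1 : metricInChart x =ᶠ[𝓝 (extChartAt (𝓡 n) x x)]
      gramMatrix (formL c m) (coordBasis n) (inChart n f x) :=
    eventually_of_mem ((isOpen_extChartAt_target x).mem_nhds hu) fun u hu =>
      hf.metricInChart_eq x hu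
  have h2 := (hf.isLocalImmersion x).scalarCoord_eq hu ((hd _).frameAt hf x hu)
  rw [(extChartAt (𝓡 n) x).left_inv (mem_extChartAt_source x)] at h2
  rw [scalarCurvature, scalarCoord_congr h1, h2]
  simp only [formL_apply]

/-- Near each point there is a smooth principal frame in the chart. -/
theorem exists_isPrincipalFrame (hn : 3 ≤ n) (x : M) :
    ∃ (Ω : Set (Coord n)) (T' : Coord n → Coord n), extChartAt (𝓡 n) x x ∈ Ω ∧
      Ω ⊆ (extChartAt (𝓡 n) x).target ∧
      IsPrincipalFrame (formL c m) c (inChart n f x) Ω T'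
        (fun u => η ((extChartAt (𝓡 n) x).symm u)) (fun u => ζ ((extChartAt (𝓡 n) x).symm u)) ∧
      ∀ u ∈ Ω, T' u = chartD x u (T ((extChartAt (𝓡 n) x).symm u)) ∨
        T' u = -chartD x u (T ((extChartAt (𝓡 n) x).symm u)) :=
  (hf.isLocalImmersion x).exists_frame (coordBasis n) (by simpa using hn)
    (fun u hu => (hd _).frameAt hf x hu) (mem_extChartAt_target x)

variable {ρ : ℝ} (hn : 3 ≤ n)
  (hρ : ∀ x, 2 * form c (η x) (ζ x) + ((n : ℝ) - 2) * form c (ζ x) (ζ x) = ρ)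

include hn

/-- The pointwise chosen `ζ` is smooth in a chart near each point, thanks to the local smooth frame.
-/
theorem continuous_gap : Continuous fun x => (n : ℝ) * form c (ζ x) (ζ x) - ρ := by
  refine continuous_iff_continuousAt.2 fun x => continuousAt_of_chart (n := n) ?_
  obtain ⟨Ω, T', hu, -, hF, -⟩ := exists_isPrincipalFrame hf hd hn x
  have h1 := differentiableAt_bilin (formL c m) (hF.differentiableAt_zeta hu)
    (hF.differentiableAt_zeta hu)
  exact ((h1.const_mul (n : ℝ)).sub_const ρ).continuousAt

include hρ

theorem isOpen_gap_eq_zero : IsOpen {x | (n : ℝ) * form c (ζ x) (ζ x) - ρ = 0} := by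
  refine isOpen_iff_mem_nhds.2 fun x hx => ?_
  obtain ⟨Ω, T', hu, -, hF, -⟩ := exists_isPrincipalFrame hf hd hn x
  have hx' : (n : ℝ) * form c (ζ x) (ζ x) - ρ = 0 := hx
  have h1 := hF.eventually_gap_eq_zero (by simpa using hn) (N := n) (ρ := ρ)
    (fun u _ => hρ _) hu (by
      rw [(extChartAt (𝓡 n) x).left_inv (mem_extChartAt_source x)]
      exact hx')
  have h2 := (continuousAt_extChartAt (I := 𝓡 n) x).eventually h1
  filter_upwards [h2, extChartAt_source_mem_nhds (I := 𝓡 n) x] with y hy hys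
  rw [(extChartAt (𝓡 n) x).left_inv hys] at hy
  exact hy

omit [RiemannianBundle (fun y : M => TangentSpace (𝓡 n) y)] hf hd in
/-- In a smooth principal frame, the logarithmic derivative of the gap along `T` is `-n ψ`. -/
theorem abs_directionalD_gap {x : M} {Ω : Set (Coord n)} {T' : Coord n → Coord n}
    (hΩ : Ω ⊆ (extChartAt (𝓡 n) x).target)
    (hF : IsPrincipalFrame (formL c m) c (inChart n f x) Ω T'
        (fun u => η ((extChartAt (𝓡 n) x).symm u)) (fun u => ζ ((extChartAt (𝓡 n) x).symm u)))
    (hT : ∀ u ∈ Ω, T' u = chartD x u (T ((extChartAt (𝓡 n) x).symm u)) ∨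
        T' u = -chartD x u (T ((extChartAt (𝓡 n) x).symm u))) {u : Coord n} (hu : u ∈ Ω)
    (hw : 0 < (n : ℝ) * form c (ζ ((extChartAt (𝓡 n) x).symm u))
      (ζ ((extChartAt (𝓡 n) x).symm u)) - ρ) :
    |directionalD (fun x => (n : ℝ) * form c (ζ x) (ζ x) - ρ)
      ((extChartAt (𝓡 n) x).symm u) (T ((extChartAt (𝓡 n) x).symm u))|
        / (n * ((n : ℝ) * form c (ζ ((extChartAt (𝓡 n) x).symm u))
      (ζ ((extChartAt (𝓡 n) x).symm u)) - ρ))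
      = |umbilicity (formL c m) T' (fun u => η ((extChartAt (𝓡 n) x).symm u))
          (fun u => ζ ((extChartAt (𝓡 n) x).symm u)) u| := by
  have hn0 : (0 : ℝ) < n := by exact_mod_cast (by omega : 0 < n)
  have hz := hF.differentiableAt_zeta hu
  have hg : DifferentiableAt ℝ (fun u => (n : ℝ) * form c (ζ ((extChartAt (𝓡 n) x).symm u))
      (ζ ((extChartAt (𝓡 n) x).symm u)) - ρ) u :=
    ((differentiableAt_bilin (formL c m) hz hz).const_mul (n : ℝ)).sub_const ρ
  have h1 := directionalD_eq_fderiv_chart (g := fun x => (n : ℝ) * form c (ζ x) (ζ x) - ρ) x (hΩ hu) hg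
    (T ((extChartAt (𝓡 n) x).symm u))
  have h2 := hF.fderiv_gap (by simpa using hn) (N := n) (ρ := ρ) (fun u _ => hρ _) hu (T' u)
  rw [(hF.frame u hu).unit] at h2
  -- The chosen `T` and the smooth `T'` may differ by a sign, which the absolute value forgets.
  have h3 : |fderiv ℝ (fun u => (n : ℝ) * form c (ζ ((extChartAt (𝓡 n) x).symm u))
      (ζ ((extChartAt (𝓡 n) x).symm u)) - ρ) u
        (chartD x u (T ((extChartAt (𝓡 n) x).symm u)))|
      = |fderiv ℝ (fun u => (n : ℝ) * form c (ζ ((extChartAt (𝓡 n) x).symm u))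
      (ζ ((extChartAt (𝓡 n) x).symm u)) - ρ) u (T' u)| := by
    rcases hT u hu with h | h
    · rw [h]
    · rw [h, map_neg, abs_neg]
  simp only [formL_apply] at h2
  rw [h1, h3, h2, abs_neg, mul_one, mul_right_comm, abs_mul, abs_of_pos (mul_pos hn0 hw),
    mul_div_cancel_left₀ _ (mul_pos hn0 hw).ne']

end GlobalFrame

/-! ### The completeness argument and the compact case -/

section Main

open Filter Topology

variable {n m : ℕ} {M : Type*} [MetricSpace M] [ChartedSpace (Coord n) M]
  [IsManifold (𝓡 n) ∞ M] [RiemannianBundle (fun y : M => TangentSpace (𝓡 n) y)]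
  {c : ℝ} {f : M → Ambient m}

/-- On a complete manifold, `n ⟨ζ, ζ⟩ - ρ` cannot be bounded below by a positive constant if the
sectional curvatures `⟨η, ζ⟩ + c` are negative. -/
theorem false_of_gap_pos [IsRiemannianManifold (𝓡 n) M] [CompleteSpace M] [Nonempty M]
    (hf : IsIsometricImmersion (n := n) c f)
    {T : ∀ x : M, TangentSpace (𝓡 n) x} {η ζ : M → Ambient m}
    (hd : ∀ x, IsPrincipalDatum c f x (T x) (η x) (ζ x)) {ρ : ℝ} (hn : 3 ≤ n)
    (hρ : ∀ x, 2 * form c (η x) (ζ x) + ((n : ℝ) - 2) * form c (ζ x) (ζ x) = ρ)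
    {w₀ : ℝ} (hw₀ : 0 < w₀) (hw : ∀ x, w₀ ≤ (n : ℝ) * form c (ζ x) (ζ x) - ρ)
    (hac : ∀ x, form c (η x) (ζ x) + c < 0) : False := by
  have hn0 : (0 : ℝ) < n := by exact_mod_cast (by omega : 0 < n)
  have hE : 3 ≤ Module.finrank ℝ (Coord n) := by simpa using hn
  let w : M → ℝ := fun x => (n : ℝ) * form c (ζ x) (ζ x) - ρ
  have hwpos : ∀ x, 0 < w x := fun x => hw₀.trans_le (hw x)
  have hwc : Continuous w := continuous_gap hf hd hn
  -- This is `|ψ|`, expressed through the gap so that it is globally defined although `T` is only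
  -- chosen up to sign.
  let Ψ : M → ℝ := fun x => |directionalD w x (T x)| / (n * w x)
  have hΨ0 : ∀ x, 0 ≤ Ψ x := fun x => div_nonneg (abs_nonneg _) (mul_pos hn0 (hwpos x)).le
  have hloc : ∀ x : M, ∃ (Ω : Set (Coord n)) (T' : Coord n → Coord n) (ψ : Coord n → ℝ),
      IsOpen Ω ∧ extChartAt (𝓡 n) x x ∈ Ω ∧ ContDiffOn ℝ ∞ ψ Ω ∧
      (∀ u ∈ Ω, Ψ ((extChartAt (𝓡 n) x).symm u) = |ψ u|) ∧
      (∀ u ∈ Ω, DifferentiableAt ℝ (fun u => w ((extChartAt (𝓡 n) x).symm u)) u) ∧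
      form c (fderiv ℝ (inChart n f x) (extChartAt (𝓡 n) x x) (T' (extChartAt (𝓡 n) x x)))
        (fderiv ℝ (inChart n f x) (extChartAt (𝓡 n) x x) (T' (extChartAt (𝓡 n) x x))) = 1 ∧
      fderiv ℝ (fun u => w ((extChartAt (𝓡 n) x).symm u)) (extChartAt (𝓡 n) x x)
        (T' (extChartAt (𝓡 n) x x)) = -(n * ψ (extChartAt (𝓡 n) x x) * w x) ∧
      fderiv ℝ ψ (extChartAt (𝓡 n) x x) (T' (extChartAt (𝓡 n) x x))
        = -ψ (extChartAt (𝓡 n) x x) ^ 2 - form c (η x) (ζ x) - c := by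
    intro x
    obtain ⟨Ω, T', hu, hΩ, hF, hT⟩ := exists_isPrincipalFrame hf hd hn x
    have hx : (extChartAt (𝓡 n) x).symm (extChartAt (𝓡 n) x x) = x :=
      (extChartAt (𝓡 n) x).left_inv (mem_extChartAt_source x)
    refine ⟨Ω, T', _, hF.isOpen, hu, hF.smooth_umbilicity,
      fun u hu => abs_directionalD_gap hn hρ hΩ hF hT hu (hwpos _), fun u hu => ?_,
      (hF.frame _ hu).unit, ?_, ?_⟩
    · exact ((differentiableAt_bilin (formL c m) (hF.differentiableAt_zeta hu)
        (hF.differentiableAt_zeta hu)).const_mul (n : ℝ)).sub_const ρ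
    · have h2 := hF.fderiv_gap hE (N := n) (ρ := ρ) (fun u _ => hρ _) hu
        (T' (extChartAt (𝓡 n) x x))
      rw [(hF.frame _ hu).unit, mul_one, hx] at h2
      exact h2
    · have h2 := hF.riccati hu hE (N := n) (ρ := ρ) (fun u _ => hρ _) fun u _ => (hwpos _).ne'
      rw [hx] at h2
      exact h2
  have hΨc : Continuous Ψ := by
    refine continuous_iff_continuousAt.2 fun x => continuousAt_of_chart (n := n) ?_
    obtain ⟨Ω, T', ψ, hΩ, hu, hψ, hΨψ, -⟩ := hloc x
    refine (hψ.continuousOn.continuousAt (hΩ.mem_nhds hu)).abs.congr ?_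
    filter_upwards [hΩ.mem_nhds hu] with u hu
    exact (hΨψ u hu).symm
  -- If `ψ` vanished identically, the Riccati equation would give `⟨η, ζ⟩ + c = 0`.
  obtain ⟨x₁, hx₁⟩ : ∃ x, Ψ x ≠ 0 := by
    by_contra! hall
    obtain ⟨x⟩ := ‹Nonempty M›
    obtain ⟨Ω, T', ψ, hΩ, hu, -, hΨψ, -, -, -, hric⟩ := hloc x
    have h0 : ∀ u ∈ Ω, ψ u = 0 := fun u hu => by
      rw [← abs_eq_zero, ← hΨψ u hu, hall]
    rw [fderiv_eq_of_eqOn hΩ hu (q := fun _ => 0) h0, h0 _ hu] at hric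
    simp only [fderiv_const_apply, zero_apply] at hric
    linarith [hac x]
  let Q : M → ℝ := fun x => Ψ x ^ n / w x
  have hQc : Continuous Q := (hΨc.pow n).div hwc fun x => (hwpos x).ne'
  have hq : 0 < Q x₁ := div_pos (pow_pos ((hΨ0 x₁).lt_of_ne' hx₁) n) (hwpos x₁)
  let S : Set M := {x | Q x₁ ≤ Q x}
  have hSc : IsClosed S := isClosed_le continuous_const hQc
  have hqw : 0 < Q x₁ * w₀ := mul_pos hq hw₀
  -- On `S` one has `Ψⁿ ≥ Q(x₁) w₀`. Capping `ψ₀` at `1` gives `Ψⁿ ≤ Ψ` whenever `Ψ < ψ₀`, which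
  -- avoids extracting an `n`-th root.
  obtain ⟨ψ₀, hψ₀, hψ₀1, hψ₀q⟩ : ∃ ψ₀ : ℝ, 0 < ψ₀ ∧ ψ₀ ≤ 1 ∧ ψ₀ ≤ Q x₁ * w₀ :=
    ⟨min 1 (Q x₁ * w₀), lt_min one_pos hqw, min_le_left _ _, min_le_right _ _⟩
  have hSψ : ∀ x ∈ S, ψ₀ ≤ Ψ x := by
    intro x hx
    by_contra! hlt
    have h1 : Q x₁ * w x ≤ Ψ x ^ n := (le_div_iff₀ (hwpos x)).1 hx
    have h2 : Ψ x ^ n ≤ Ψ x :=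
      pow_le_of_le_one (hΨ0 x) (hlt.le.trans hψ₀1) (by omega)
    have h3 : Q x₁ * w₀ ≤ Q x₁ * w x := mul_le_mul_of_nonneg_left (hw x) hq.le
    linarith
  -- The slope is a quarter of the guaranteed rate of decrease `nψ₀w₀`: one factor `2` is lost in
  -- the derivative estimate and one in the distance estimate.
  obtain ⟨x, hxS, hmax⟩ := exists_ekeland_point hSc ⟨x₁, le_refl (Q x₁)⟩ hwc (fun x _ => hw x)
    (show 0 < n * ψ₀ * w₀ / 4 by positivity)
  obtain ⟨Ω, T', ψ, hΩ, hu, hψ, hΨψ, hwd, hunit, hwT, hric⟩ := hloc x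
  have hx : (extChartAt (𝓡 n) x).symm (extChartAt (𝓡 n) x x) = x :=
    (extChartAt (𝓡 n) x).left_inv (mem_extChartAt_source x)
  set u₀ := extChartAt (𝓡 n) x x with hu₀
  have hΨx : Ψ x = |ψ u₀| := by
    have := hΨψ u₀ hu
    rwa [hx] at this
  have hψpos : 0 < |ψ u₀| := hΨx ▸ hψ₀.trans_le (hSψ x hxS)
  -- `ε` is the sign of `ψ`; along `ε T'` the gap decreases.
  obtain ⟨ε, hε, hεψ⟩ : ∃ ε : ℝ, ε * ε = 1 ∧ |ψ u₀| = ε * ψ u₀ := by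
    rcases abs_choice (ψ u₀) with h | h
    · exact ⟨1, by ring, by rw [h]; ring⟩
    · exact ⟨-1, by ring, by rw [h]; ring⟩
  set p := ε * ψ u₀ with hp
  have hp0 : 0 < p := hεψ ▸ hψpos
  let k : ℝ → Coord n := fun s => u₀ + s • (ε • T' u₀)
  have hk : ∀ s, HasDerivAt k (ε • T' u₀) s := hasDerivAt_line u₀ (ε • T' u₀)
  have hk0 : k 0 = u₀ := by simp [k]
  have hkt : Tendsto k (𝓝 0) (𝓝 u₀) := by
    have := (hk 0).continuousAt.tendsto
    rwa [hk0] at this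
  let y : ℝ → M := fun s => (extChartAt (𝓡 n) x).symm (k s)
  have hy0 : y 0 = x := by simp only [y, hk0, hx]
  have hwder : HasDerivAt (fun s => w (y s)) (-(n * p * w x)) 0 := by
    have h1 : HasFDerivAt (fun u => w ((extChartAt (𝓡 n) x).symm u))
        (fderiv ℝ (fun u => w ((extChartAt (𝓡 n) x).symm u)) u₀) (k 0) := by
      rw [hk0]; exact (hwd u₀ hu).hasFDerivAt
    have h2 := h1.comp_hasDerivAt 0 (hk 0)
    refine h2.congr_deriv ?_
    rw [map_smul, hwT, smul_eq_mul, hp]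
    ring
  have hψder : HasDerivAt (fun s => ε * ψ (k s)) (-p ^ 2 - form c (η x) (ζ x) - c) 0 := by
    have h1 : HasFDerivAt ψ (fderiv ℝ ψ u₀) (k 0) := by
      rw [hk0]; exact (hψ.differentiableAt_of_isOpen hΩ hu).hasFDerivAt
    have h2 := (h1.comp_hasDerivAt 0 (hk 0)).const_mul ε
    refine h2.congr_deriv ?_
    rw [map_smul, hric, smul_eq_mul, hp]
    linear_combination (-ψ u₀ ^ 2 - form c (η x) (ζ x) - c) * hε
      + ψ u₀ ^ 2 * hε
  -- The exponent `n` matches the factor in `T(w) = -nψw`, so the `ψ²` term of the Riccati equation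
  -- cancels and only `-(⟨η, ζ⟩ + c)` remains.
  have hQder : HasDerivAt (fun s => (ε * ψ (k s)) ^ n / w (y s))
      (n * p ^ (n - 1) * (-(form c (η x) (ζ x) + c)) / w x) 0 := by
    have h1 := (hψder.fun_pow n).fun_div hwder (by rw [hy0]; exact (hwpos x).ne')
    refine h1.congr_deriv ?_
    rw [hy0, hk0, ← hp]
    have hpn : p ^ n = p ^ (n - 1) * p := (pow_sub_one_mul (by omega) p).symm
    rw [hpn]
    have := (hwpos x).ne'
    field_simp
    ring
  have hQpos : 0 < n * p ^ (n - 1) * (-(form c (η x) (ζ x) + c)) / w x := by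
    have h1 : 0 < -(form c (η x) (ζ x) + c) := neg_pos.2 (hac x)
    have := hwpos x
    positivity
  have hψpx : ψ₀ ≤ p := by
    have := hSψ x hxS
    rwa [hΨx, hεψ] at this
  have hrate : n * ψ₀ * w₀ ≤ n * p * w x :=
    mul_le_mul (mul_le_mul_of_nonneg_left hψpx hn0.le) (hw x) hw₀.le (mul_pos hn0 hp0).le
  have hδ : 0 < n * ψ₀ * w₀ := mul_pos (mul_pos hn0 hψ₀) hw₀
  have e1 := hQder.eventually_add_mul_lt hQpos
  have e2 := hwder.neg.eventually_add_mul_lt (r := n * ψ₀ * w₀ / 2) (by linarith)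
  have e3 := eventually_dist_chart_le hf x (v := ε • T' u₀) (by
    rw [map_smul, form_smul_left, form_symm, form_smul_left, hunit, mul_one, hε]
    norm_num)
  have e4 : ∀ᶠ s in 𝓝[>] (0 : ℝ), k s ∈ Ω :=
    (hkt.eventually (hΩ.eventually_mem hu)).filter_mono nhdsWithin_le_nhds
  obtain ⟨s, h1, h2, h3, h4, hs⟩ :=
    (e1.and (e2.and (e3.and (e4.and (self_mem_nhdsWithin : Set.Ioi (0 : ℝ) ∈ 𝓝[>] 0))))).exists
  have hs : 0 < s := hs
  have h3 : dist x (y s) ≤ 2 * s := h3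
  simp only [Pi.neg_apply, hy0] at h2
  have hyS : y s ∈ S := by
    have hQx : Q x = p ^ n / w x := by simp only [Q, hΨx, hεψ]
    have h5 : Q x < (ε * ψ (k s)) ^ n / w (y s) := by
      rw [hQx]
      simpa [hk0, hy0, ← hp] using h1
    have h6 : (ε * ψ (k s)) ^ n / w (y s) ≤ Q (y s) := by
      refine div_le_div_of_nonneg_right ?_ (hwpos _).le
      have hε1 : |ε| = 1 := by
        rw [← Real.sqrt_sq_eq_abs, pow_two, hε, Real.sqrt_one]
      calc (ε * ψ (k s)) ^ n ≤ |(ε * ψ (k s)) ^ n| := le_abs_self _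
        _ = Ψ (y s) ^ n := by
          rw [abs_pow, abs_mul, hε1, one_mul, ← hΨψ (k s) h4]
    exact (show Q x₁ ≤ Q x from hxS).trans (h5.le.trans h6)
  have h7 : w (y s) + n * ψ₀ * w₀ / 4 * dist x (y s) ≤ w x := by
    have := mul_le_mul_of_nonneg_left h3 (show 0 ≤ n * ψ₀ * w₀ / 4 by linarith)
    linarith
  -- The nearby point lies in `S` and beats `x` in Ekeland's inequality, so it equals `x`; but the
  -- gap is strictly smaller there.
  have h8 := hmax (y s) hyS h7
  rw [h8] at h2
  have := mul_pos hδ hs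
  linarith

/-- A compact submanifold of a space form of nonpositive curvature is not totally geodesic in the
directions of the second principal normal everywhere. -/
theorem exists_zeta_ne_zero [CompactSpace M] [Nonempty M] (hc : c ≤ 0)
    (hf : IsIsometricImmersion (n := n) c f)
    {T : ∀ x : M, TangentSpace (𝓡 n) x} {η ζ : M → Ambient m}
    (hd : ∀ x, IsPrincipalDatum c f x (T x) (η x) (ζ x)) (hn : 3 ≤ n) : ∃ x, ζ x ≠ 0 := by
  by_contra! hall
  have hE : 3 ≤ Module.finrank ℝ (Coord n) := by simpa using hn
  have hfc : Continuous f := hf.smooth.continuous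
  -- At a maximum of `P ∘ f` take `X ≠ 0` orthogonal to `T`. Since `ζ = 0`, the second derivative
  -- `D²F(X, X)` is tangential apart from `-c |X|² F`.
  have key : ∀ (P : Ambient m → ℝ), ContDiff ℝ ∞ P → ∃ x : M, ∃ γ X : Coord n,
      (∀ v, fderiv ℝ (fun u => P (inChart n f x u)) (extChartAt (𝓡 n) x x) v = 0) ∧
      fderiv ℝ (fderiv ℝ (fun u => P (inChart n f x u))) (extChartAt (𝓡 n) x x) X X ≤ 0 ∧
      0 < form c (fderiv ℝ (inChart n f x) (extChartAt (𝓡 n) x x) X)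
        (fderiv ℝ (inChart n f x) (extChartAt (𝓡 n) x x) X) ∧
      fderiv ℝ (fderiv ℝ (inChart n f x)) (extChartAt (𝓡 n) x x) X X
        = fderiv ℝ (inChart n f x) (extChartAt (𝓡 n) x x) γ
          - (c * form c (fderiv ℝ (inChart n f x) (extChartAt (𝓡 n) x x) X)
        (fderiv ℝ (inChart n f x) (extChartAt (𝓡 n) x x) X)) •
            inChart n f x (extChartAt (𝓡 n) x x) := by
    intro P hP
    obtain ⟨x, -, hx⟩ := isCompact_univ.exists_isMaxOn Set.univ_nonempty
      (hP.continuous.comp hfc).continuousOn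
    have hxi : inChart n f x (extChartAt (𝓡 n) x x) = f x := by
      simp only [inChart, (extChartAt (𝓡 n) x).left_inv (mem_extChartAt_source x)]
    have hI := hf.isLocalImmersion x
    have hu : extChartAt (𝓡 n) x x ∈ (extChartAt (𝓡 n) x).target := mem_extChartAt_target x
    have hm : IsLocalMax (fun u => P (inChart n f x u)) (extChartAt (𝓡 n) x x) := by
      refine Eventually.of_forall fun u => ?_
      simp only [hxi]
      exact hx (Set.mem_univ _)
    have hfr := (hd _).frameAt hf x hu
    obtain ⟨t₀, ht₀⟩ : ∃ t₀, t₀ = chartD x (extChartAt (𝓡 n) x x)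
      (T ((extChartAt (𝓡 n) x).symm (extChartAt (𝓡 n) x x))) := ⟨_, rfl⟩
    rw [← ht₀] at hfr
    obtain ⟨X, hX0, hXT, -⟩ := exists_ne_zero_of_two_functionals hE
      ((formL c m (fderiv ℝ (inChart n f x) (extChartAt (𝓡 n) x x) t₀))
        ∘L (fderiv ℝ (inChart n f x) (extChartAt (𝓡 n) x x))).toLinearMap 0
    have hXT' : formL c m (fderiv ℝ (inChart n f x) (extChartAt (𝓡 n) x x) X)
        (fderiv ℝ (inChart n f x) (extChartAt (𝓡 n) x x) t₀) = 0 := by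
      rw [hI.symm]; exact hXT
    obtain ⟨γ, hγ⟩ := hfr.second X X
    refine ⟨x, γ, X, fun v => ?_, ?_, hI.pos _ hu X hX0, ?_⟩
    · rw [hm.fderiv_eq_zero, zero_apply]
    · exact hm.fderiv_fderiv_nonpos
        (hP.contDiffAt.comp _ (hI.smooth.contDiffAt (hI.isOpen.mem_nhds hu))) X
    · rw [hγ, hXT', hall]
      simp
  rcases hc.eq_or_lt with rfl | hc
  -- Euclidean case: the Hessian of `|F|²` in direction `X` would be `2|X|² > 0` at its maximum.
  · obtain ⟨x, γ, X, h1, h2, h3, h4⟩ := key (fun p => formL 0 m p p)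
      ((formL 0 m).contDiff.clm_apply contDiff_id)
    have hI := hf.isLocalImmersion x
    have hu : extChartAt (𝓡 n) x x ∈ (extChartAt (𝓡 n) x).target := mem_extChartAt_target x
    have hfd : ∀ u ∈ (extChartAt (𝓡 n) x).target, ∀ v,
        fderiv ℝ (fun u => formL 0 m (inChart n f x u) (inChart n f x u)) u v
          = 2 * formL 0 m (fderiv ℝ (inChart n f x) u v) (inChart n f x u) := by
      intro u hu v
      rw [fderiv_bilin _ (hI.differentiableAt hu) (hI.differentiableAt hu),
        hI.symm (inChart n f x u)]
      ring
    have hps : ContDiffOn ℝ ∞ (fun u => formL 0 m (inChart n f x u) (inChart n f x u))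
        (extChartAt (𝓡 n) x).target := contDiffOn_bilin _ hI.smooth hI.smooth
    rw [← fderiv_fderiv_apply ((contDiffOn_infty_fderiv hI.isOpen hps).differentiableAt_of_isOpen
      hI.isOpen hu), fderiv_eq_of_eqOn hI.isOpen hu fun u hu => hfd u hu X,
      fderiv_const_mul (differentiableAt_bilin _ (hI.differentiableAt_partial hu X)
        (hI.differentiableAt hu)), smul_apply,
      fderiv_bilin _ (hI.differentiableAt_partial hu X) (hI.differentiableAt hu),
      fderiv_fderiv_apply (hI.differentiableAt_fderiv hu), h4] at h2
    have h5 := h1 γ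
    rw [hfd _ hu] at h5
    simp only [zero_mul, zero_smul, sub_zero, smul_eq_mul, formL_apply] at h2 h5
    linarith
  -- Hyperbolic case: the height `p₀` is positive on the upper sheet, and its Hessian in direction
  -- `X` would be `-c |X|² p₀ > 0` at its maximum.
  · obtain ⟨x, γ, X, h1, h2, h3, h4⟩ := key (fun p => ContinuousLinearMap.proj (R := ℝ)
      (φ := fun _ : Fin (m + 1) => ℝ) 0 p) (ContinuousLinearMap.contDiff _)
    set ℓ : Ambient m →L[ℝ] ℝ := ContinuousLinearMap.proj (R := ℝ)
      (φ := fun _ : Fin (m + 1) => ℝ) 0 with hℓ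
    have hI := hf.isLocalImmersion x
    have hu : extChartAt (𝓡 n) x x ∈ (extChartAt (𝓡 n) x).target := mem_extChartAt_target x
    have hfd : ∀ u ∈ (extChartAt (𝓡 n) x).target, ∀ v,
        fderiv ℝ (fun u => ℓ (inChart n f x u)) u v = ℓ (fderiv ℝ (inChart n f x) u v) := by
      intro u hu v
      exact DFunLike.congr_fun (ℓ.hasFDerivAt.comp u (hI.differentiableAt hu).hasFDerivAt).fderiv v
    have hps : ContDiffOn ℝ ∞ (fun u => ℓ (inChart n f x u)) (extChartAt (𝓡 n) x).target :=
      ℓ.contDiff.comp_contDiffOn hI.smooth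
    have h6 : fderiv ℝ (fun u => ℓ (fderiv ℝ (inChart n f x) u X)) (extChartAt (𝓡 n) x x) X
        = ℓ (fderiv ℝ (fderiv ℝ (inChart n f x)) (extChartAt (𝓡 n) x x) X X) := by
      rw [← fderiv_fderiv_apply (hI.differentiableAt_fderiv hu)]
      exact DFunLike.congr_fun
        (ℓ.hasFDerivAt.comp _ (hI.differentiableAt_partial hu X).hasFDerivAt).fderiv X
    rw [← fderiv_fderiv_apply ((contDiffOn_infty_fderiv hI.isOpen hps).differentiableAt_of_isOpen
      hI.isOpen hu), fderiv_eq_of_eqOn hI.isOpen hu fun u hu => hfd u hu X, h6, h4, map_sub,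
      map_smul, ← hfd _ hu, h1] at h2
    have hpos : 0 < ℓ (inChart n f x (extChartAt (𝓡 n) x x)) := by
      have := hf.mem_spaceForm ((extChartAt (𝓡 n) x).symm (extChartAt (𝓡 n) x x))
      simp only [SpaceForm, Set.mem_ofPred_eq, if_neg hc.ne] at this
      exact this.2 hc
    have h7 := mul_pos (mul_pos (neg_pos.2 hc) h3) hpos
    rw [smul_eq_mul] at h2
    linarith

end Main

/-! ### The cases of the theorem -/

theorem theorem1 {n k : ℕ} (hn : 3 ≤ n)
    {M : Type*} [MetricSpace M] [ChartedSpace (Coord n) M] [IsManifold (𝓡 n) ∞ M]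
    [RiemannianBundle (fun x : M => TangentSpace (𝓡 n) x)]
    [IsContMDiffRiemannianBundle (𝓡 n) ∞ (Coord n) (fun x : M => TangentSpace (𝓡 n) x)]
    [IsRiemannianManifold (𝓡 n) M] [ConnectedSpace M] [CompleteSpace M]
    (R : ℝ) (hR : ∀ x : M, scalarCurvature (n := n) x = R)
    (c : ℝ) (f : M → Ambient (n + k)) (hf : IsIsometricImmersion (n := n) c f)
    (hflat : FlatNormalBundle n c f) (hproper : IsProperImmersion n c f)
    (htype : HasType n c f ![1, n - 1]) :
    (c = 0 → 0 ≤ R ∧ (CompactSpace M → 0 < R)) ∧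
    (0 < c → ((n : ℝ) - 1) * ((n : ℝ) - 2) * c < R) ∧
    (c < 0 → (n : ℝ) * ((n : ℝ) - 1) * c ≤ R ∧
      (CompactSpace M → (n : ℝ) * ((n : ℝ) - 1) * c < R)) := by
  choose T η ζ hd using htype.exists_isPrincipalDatum
  have hn3 : (3 : ℝ) ≤ n := by exact_mod_cast hn
  have hn1 : (0 : ℝ) < n - 1 := by linarith
  obtain ⟨ρ, hRρ⟩ : ∃ ρ, R = n * (n - 1) * c + (n - 1) * ρ :=
    ⟨(R - n * (n - 1) * c) / (n - 1), by field_simp; ring⟩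
  have hρ : ∀ x, 2 * form c (η x) (ζ x) + ((n : ℝ) - 2) * form c (ζ x) (ζ x) = ρ := by
    intro x
    have h1 := scalarCurvature_eq hf hd x
    rw [hR x, hRρ] at h1
    exact mul_left_cancel₀ hn1.ne' (by linarith)
  have hb := form_zeta_nonneg hf hd
  have hnonpos : c ≤ 0 → 0 ≤ ρ := by
    intro hc
    -- If `ρ < 0`, the gap is at least `-ρ > 0`, and `2⟨η, ζ⟩ = ρ - (n-2)⟨ζ, ζ⟩ < 0`.
    by_contra! hneg
    refine false_of_gap_pos hf hd hn hρ (neg_pos.2 hneg) (fun x => ?_) fun x => ?_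
    · have := mul_nonneg (by linarith : (0 : ℝ) ≤ n) (hb x)
      linarith
    · have := mul_nonneg (by linarith : (0 : ℝ) ≤ (n : ℝ) - 2) (hb x)
      linarith [hρ x]
  have hcompact : c ≤ 0 → CompactSpace M → 0 < ρ := by
    intro hc hM
    refine (hnonpos hc).lt_of_ne' fun h0 => ?_
    obtain ⟨x₀, hx₀⟩ := exists_zeta_ne_zero hc hf hd hn
    have hcont := continuous_gap (ρ := ρ) hf hd hn
    have hclopen : IsClopen {x | (n : ℝ) * form c (ζ x) (ζ x) - ρ = 0} :=
      ⟨isClosed_eq hcont continuous_const, isOpen_gap_eq_zero hf hd hn hρ⟩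
    -- By connectedness the gap vanishes nowhere or everywhere; the latter would force `ζ = 0`
    -- throughout, as `ρ = 0`.
    have hne : ∀ x, (n : ℝ) * form c (ζ x) (ζ x) - ρ ≠ 0 := by
      rcases isClopen_iff.1 hclopen with h | h
      · exact fun x hx => (h ▸ hx : x ∈ (∅ : Set M))
      · have h1 : (n : ℝ) * form c (ζ x₀) (ζ x₀) - ρ = 0 :=
          (h ▸ Set.mem_univ x₀ : x₀ ∈ {x | (n : ℝ) * form c (ζ x) (ζ x) - ρ = 0})
        rw [h0, sub_zero] at h1
        exact absurd (zeta_eq_zero hf hd ((mul_eq_zero.1 h1).resolve_left (by linarith))) hx₀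
    have hbpos : ∀ x, 0 < form c (ζ x) (ζ x) := fun x =>
      (hb x).lt_of_ne' fun h => hne x (by rw [h, h0]; ring)
    obtain ⟨x₁, -, hx₁⟩ := isCompact_univ.exists_isMinOn Set.univ_nonempty hcont.continuousOn
    refine false_of_gap_pos hf hd hn hρ
      (w₀ := (n : ℝ) * form c (ζ x₁) (ζ x₁) - ρ) ?_ (fun x => hx₁ (Set.mem_univ x)) fun x => ?_
    · rw [h0, sub_zero]
      exact mul_pos (by linarith) (hbpos x₁)
    · have := mul_pos (by linarith : (0 : ℝ) < (n : ℝ) - 2) (hbpos x)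
      linarith [hρ x]
  have hpos : 0 < c → -2 * c < ρ := by
    intro hc
    -- If `ρ ≤ -2c`, the gap is at least `2c`, and `2(⟨η, ζ⟩ + c) ≤ -(n-2)⟨ζ, ζ⟩`. Strict negativity
    -- needs `ζ ≠ 0`, which holds because `ζ = 0` at a point would give `ρ = 0`.
    by_contra! hle
    refine false_of_gap_pos hf hd hn hρ (w₀ := 2 * c) (by linarith) (fun x => ?_) fun x => ?_
    · have := mul_nonneg (by linarith : (0 : ℝ) ≤ n) (hb x)
      linarith
    · rcases (hb x).eq_or_lt with h0 | hlt
      · exfalso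
        have hζ := zeta_eq_zero hf hd h0.symm
        have ha : form c (η x) (ζ x) = 0 := by rw [hζ]; exact (formL c _ (η x)).map_zero
        have := hρ x
        rw [ha, ← h0] at this
        linarith
      · have := mul_pos (by linarith : (0 : ℝ) < (n : ℝ) - 2) hlt
        linarith [hρ x]
  refine ⟨fun hc => ⟨?_, fun hM => ?_⟩, fun hc => ?_, fun hc => ⟨?_, fun hM => ?_⟩⟩
  · have := mul_nonneg hn1.le (hnonpos hc.le)
    rw [hRρ, hc]; linarith
  · have := mul_pos hn1 (hcompact hc.le hM)
    rw [hRρ, hc]; linarith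
  · have := mul_lt_mul_of_pos_left (hpos hc) hn1
    rw [hRρ]; linarith
  · have := mul_nonneg hn1.le (hnonpos hc.le)
    rw [hRρ]; linarith
  · have := mul_pos hn1 (hcompact hc.le hM)
    rw [hRρ]; linarith
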